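/- **Theorem 3.1.** Let $T>0$, let $\Omega=\mathbb{R}/L\mathbb{Z}$ with $L>0$ (periodic boundary conditions), let $m\in\mathbb{N}$ be odd, $\sigma_0\in\{-1,+1\}$ and $\mu\ge 0$, with $\mu=0$ if $m=1$. Let $f\in W^{2,\infty}_{\mathrm{loc}}(\mathbb{R})$ with $f''\in L^\infty(\mathbb{R})$. Let $u_0\in W^{m,\infty}(\Omega)$ and let $u\in W^{m,\infty}((0,T)\times\Omega)$ be a solution of $$\partial_t u+\partial_x f(u)-\mu\,\partial_{xx}u+\sigma_0\,\partial_x^m u=0$$ with initial data $u_0$. For $\tau>0$ consider the hyperbolic system for $q=(q_0,\dots,q_{m-1})$ on $(0,T)\times\Omega$ $$\partial_t q_0+\partial_x f(q_0)+\sigma_0\,\partial_x q_{m-1}=0,$$ $$\tau\,\partial_t q_j+\sigma_0(-1)^j\,\partial_x q_{m-j-1}=\sigma_0(-1)^j q_{m-j}-\delta_{j,1}\,\mu\, q_1,\qquad j\in\{1,\dots,m-1\},$$ with initial data $$q|_{t=0}=\bigl(u_0,\ \partial_x u_0,\ \dots,\ \partial_x^{m-2}u_0,\ \partial_x^{m-1}u_0-\sigma_0\mu\,\partial_x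 u_0\bigr),$$ where for $m=1$ this means $q_0|_{t=0}=u_0$. An *entropy solution* is a $q$ with $q_j\in L^2((0,T)\times\Omega)$ and $Q(q)\in L^1((0,T)\times\Omega)$ which satisfies the system with its initial data in the sense of distributions on $[0,T)\times\Omega$ and, with $\eta(q)=\tfrac12q_0^2+\sum_{j=1}^{m-1}\tfrac{\tau}{2}q_j^2$ and $Q(q)=\int_0^{q_0}s f'(s)\,ds+\tfrac{\sigma_0}{2}\sum_{j=0}^{m-1}(-1)^jq_jq_{m-1-j}$, also satisfies, in the same sense and with initial value $\eta(q|_{t=0})$, $$\partial_t\eta(q)+\partial_xQ(q)\le\sum_{j=1}^{m-1}q_j\bigl(\sigma_0(-1)^jq_{m-j}-\delta_{j,1}\,\mu\, q_1\bigr).$$ Then there are $C>0$ and $\tau_0>0$ such that for every $\tau\in(0,\tau_0]$ every entropy solution $q$ satisfies $$\|u-q_0\|_{L^\infty(0,T;L^2(\Omega))}+\sum_{j=1}^{m-2}\sqrt{\tau}\,\|\partial_x^j u-q_j\|_{L^\infty(0,T;L^2(\Omega))}+\sqrt{\tau}\,\bigl\|\sigma_0\partial_x^{m-1}u-\mu\,\partial_x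 u-\sigma_0 q_{m-1}\bigr\|_{L^\infty(0,T;L^2(\Omega))}\le C\,\tau .$$ The constants $C$ and $\tau_0$ depend neither on $\tau$ nor on $q$. -/

import Mathlib

open scoped ContDiff ENNReal

noncomputable section

namespace HyperbolicApprox

open MeasureTheory

/-! The spatial domain is the circle of length `L`. A function on `(0,T) × circle` is represented
by its values on the cell `(0,T) × (0,L)`; the periodic boundary conditions are encoded in the
test functions, which are smooth and `L`-periodic in space and need not vanish at `x = 0` or
`x = L`. -/

/-- Lebesgue measure on one space-time cell `(0,T) × (0,L)`. -/
def cell (T L : ℝ) : Measure (ℝ × ℝ) :=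
  volume.restrict (Set.Ioo 0 T ×ˢ Set.Ioo 0 L)

/-- Lebesgue measure on one spatial period `(0,L)`. -/
def period (L : ℝ) : Measure ℝ :=
  volume.restrict (Set.Ioo 0 L)

/-- `∂_t^a ∂_x^b φ` for a (smooth) function `φ (t, x)`. -/
def mixedDeriv (a b : ℕ) (φ : ℝ → ℝ → ℝ) (t x : ℝ) : ℝ :=
  iteratedDeriv a (fun s => iteratedDeriv b (φ s) x) t

/-- Smooth functions on `ℝ × circle`. -/
structure IsSmoothPeriodic (L : ℝ) (φ : ℝ → ℝ → ℝ) : Prop where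
  smooth : ContDiff ℝ ∞ (fun p : ℝ × ℝ => φ p.1 p.2)
  periodic : ∀ t x, φ t (x + L) = φ t x

/-- Test functions in `C_c^∞((0,T) × circle)`. -/
def IsInteriorTest (T L : ℝ) (φ : ℝ → ℝ → ℝ) : Prop :=
  IsSmoothPeriodic L φ ∧
    ∃ a b : ℝ, 0 < a ∧ b < T ∧ ∀ t x, (t < a ∨ b < t) → φ t x = 0

/-- Test functions in `C_c^∞([0,T) × circle)`, which need not vanish at the initial time. -/
def IsCauchyTest (T L : ℝ) (φ : ℝ → ℝ → ℝ) : Prop :=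
  IsSmoothPeriodic L φ ∧ ∃ b : ℝ, b < T ∧ ∀ t x, b < t → φ t x = 0

/-- `w` is the weak derivative `∂_t^a ∂_x^b u` on `(0,T) × circle`. -/
def IsWeakDeriv (T L : ℝ) (a b : ℕ) (u w : ℝ → ℝ → ℝ) : Prop :=
  ∀ φ, IsInteriorTest T L φ →
    ∫ p, u p.1 p.2 * mixedDeriv a b φ p.1 p.2 ∂(cell T L)
      = (-1) ^ (a + b) * ∫ p, w p.1 p.2 * φ p.1 p.2 ∂(cell T L)

/-- `u ∈ W^{m,∞}((0,T) × circle)`, and `D a b` is its weak derivative `∂_t^a ∂_x^b u` for all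
`a + b ≤ m`. -/
def IsSobolev (T L : ℝ) (m : ℕ) (u : ℝ → ℝ → ℝ) (D : ℕ → ℕ → ℝ → ℝ → ℝ) : Prop :=
  MemLp (fun p : ℝ × ℝ => u p.1 p.2) ∞ (cell T L) ∧
  ∀ a b, a + b ≤ m →
    MemLp (fun p : ℝ × ℝ => D a b p.1 p.2) ∞ (cell T L) ∧ IsWeakDeriv T L a b u (D a b)

/-- `w` is the weak derivative `∂_x^k v` on the circle. -/
def IsWeakDerivPeriod (L : ℝ) (k : ℕ) (v w : ℝ → ℝ) : Prop :=
  ∀ ψ : ℝ → ℝ, ContDiff ℝ ∞ ψ → (∀ x, ψ (x + L) = ψ x) →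
    ∫ x, v x * iteratedDeriv k ψ x ∂(period L) = (-1) ^ k * ∫ x, w x * ψ x ∂(period L)

/-- `v ∈ W^{m,∞}(circle)`, and `d k` is its weak derivative `∂_x^k v` for all `k ≤ m`. -/
def IsSobolevPeriod (L : ℝ) (m : ℕ) (v : ℝ → ℝ) (d : ℕ → ℝ → ℝ) : Prop :=
  MemLp v ∞ (period L) ∧
  ∀ k, k ≤ m → MemLp (d k) ∞ (period L) ∧ IsWeakDerivPeriod L k v (d k)

/-- `g` is the `k`-th weak derivative of `f` on the real line. -/
def IsWeakDerivLine (k : ℕ) (f g : ℝ → ℝ) : Prop :=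
  ∀ ψ : ℝ → ℝ, ContDiff ℝ ∞ ψ → HasCompactSupport ψ →
    ∫ s, f s * iteratedDeriv k ψ s = (-1) ^ k * ∫ s, g s * ψ s

/-- `f ∈ W^{2,∞}_loc(ℝ)` (with `f` its continuous representative) and `f'' ∈ L^∞(ℝ)`. -/
def IsAdmissibleFlux (f : ℝ → ℝ) : Prop :=
  Continuous f ∧ ∃ f₁ f₂ : ℝ → ℝ,
    IsWeakDerivLine 1 f f₁ ∧ (∀ r : ℝ, MemLp f₁ ∞ (volume.restrict (Set.Ioo (-r) r))) ∧
    IsWeakDerivLine 2 f f₂ ∧ MemLp f₂ ∞ volume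

/-- `u` solves `∂_t u + ∂_x f(u) - μ ∂_x² u + σ ∂_x^m u = 0` on `(0,T) × circle` with
`u(0,·) = u₀`, in the sense of distributions on `[0,T) × circle`. -/
def IsLimitSolution (T L : ℝ) (m : ℕ) (σ μ : ℝ) (f : ℝ → ℝ) (u₀ : ℝ → ℝ)
    (u : ℝ → ℝ → ℝ) : Prop :=
  ∀ φ, IsCauchyTest T L φ →
    ∫ p, (u p.1 p.2 * mixedDeriv 1 0 φ p.1 p.2
        + f (u p.1 p.2) * mixedDeriv 0 1 φ p.1 p.2
        + μ * (u p.1 p.2 * mixedDeriv 0 2 φ p.1 p.2)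
        - σ * ((-1) ^ m * (u p.1 p.2 * mixedDeriv 0 m φ p.1 p.2))) ∂(cell T L)
      + ∫ x, u₀ x * φ 0 x ∂(period L) = 0

/-! The hyperbolic system for `v = (v 0, …, v (m-1))`; entries `v j` with `j ≥ m` play no role.
It reads `c_j ∂_t q_j + ∂_x (flux j) = source j` with `c_0 = 1` and `c_j = τ` for `j ≥ 1`. -/

/-- The factor in front of `∂_t q_j`. -/
def timeCoeff (τ : ℝ) (j : ℕ) : ℝ := if j = 0 then 1 else τ

/-- `f(v_0) + σ v_{m-1}` for `j = 0`, and `σ (-1)^j v_{m-1-j}` for `j ≥ 1`. -/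
def flux (m : ℕ) (σ : ℝ) (f : ℝ → ℝ) (v : ℕ → ℝ) (j : ℕ) : ℝ :=
  (if j = 0 then f (v 0) else 0) + σ * (-1) ^ j * v (m - 1 - j)

/-- `0` for `j = 0`, and `σ (-1)^j v_{m-j} - δ_{j,1} μ v_1` for `j ≥ 1`. -/
def source (m : ℕ) (σ μ : ℝ) (v : ℕ → ℝ) (j : ℕ) : ℝ :=
  if j = 0 then 0 else σ * (-1) ^ j * v (m - j) - (if j = 1 then μ * v 1 else 0)

/-- The energy density `v_0²/2 + ∑_{j=1}^{m-1} τ v_j²/2`. -/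
def energy (m : ℕ) (τ : ℝ) (v : ℕ → ℝ) : ℝ :=
  ∑ j ∈ Finset.range m, timeCoeff τ j / 2 * v j ^ 2

/-- The flux associated with the energy density: its derivative in `v_i` is
`∑_j v_j ∂(flux j)/∂v_i` when `m` is odd. -/
def energyFlux (m : ℕ) (σ : ℝ) (f : ℝ → ℝ) (v : ℕ → ℝ) : ℝ :=
  (∫ s in (0 : ℝ)..(v 0), s * deriv f s)
    + σ / 2 * ∑ j ∈ Finset.range m, (-1) ^ j * (v j * v (m - 1 - j))

/-- The production `∑_j v_j (source j)` of energy by the source terms. -/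
def energyProduction (m : ℕ) (σ μ : ℝ) (v : ℕ → ℝ) : ℝ :=
  ∑ j ∈ Finset.range m, v j * source m σ μ v j

/-- The point values `j ↦ q_j(t,x)` at `p = (t,x)`. -/
def values (q : ℕ → ℝ → ℝ → ℝ) (p : ℝ × ℝ) : ℕ → ℝ := fun j => q j p.1 p.2

/-- `q` is a weak entropy solution of the hyperbolic system on `(0,T) × circle` with initial
data `g`: it satisfies the equations and the inequality
`∂_t energy + ∂_x energyFlux ≤ energyProduction` in the sense of distributions on
`[0,T) × circle`. -/
structure IsEntropySolution (T L : ℝ) (m : ℕ) (σ μ τ : ℝ) (f : ℝ → ℝ) (g : ℕ → ℝ → ℝ)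
    (q : ℕ → ℝ → ℝ → ℝ) : Prop where
  memLp : ∀ j < m, MemLp (fun p : ℝ × ℝ => q j p.1 p.2) 2 (cell T L)
  integrable_energyFlux : Integrable (fun p => energyFlux m σ f (values q p)) (cell T L)
  equation : ∀ j < m, ∀ φ, IsCauchyTest T L φ →
    ∫ p, (timeCoeff τ j * q j p.1 p.2 * mixedDeriv 1 0 φ p.1 p.2
        + flux m σ f (values q p) j * mixedDeriv 0 1 φ p.1 p.2
        + source m σ μ (values q p) j * φ p.1 p.2) ∂(cell T L)
      + ∫ x, timeCoeff τ j * g j x * φ 0 x ∂(period L) = 0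
  entropy : ∀ φ, IsCauchyTest T L φ → (∀ t x, 0 ≤ φ t x) →
    0 ≤ ∫ p, (energy m τ (values q p) * mixedDeriv 1 0 φ p.1 p.2
        + energyFlux m σ f (values q p) * mixedDeriv 0 1 φ p.1 p.2
        + energyProduction m σ μ (values q p) * φ p.1 p.2) ∂(cell T L)
      + ∫ x, energy m τ (fun j => g j x) * φ 0 x ∂(period L)

/-- The initial data `(u₀, ∂_x u₀, …, ∂_x^{m-2} u₀, ∂_x^{m-1} u₀ - σ μ ∂_x u₀)`, where
`d k = ∂_x^k u₀`. -/
def initialData (m : ℕ) (σ μ : ℝ) (d : ℕ → ℝ → ℝ) (j : ℕ) (x : ℝ) : ℝ :=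
  if j = m - 1 then d j x - σ * μ * d 1 x else d j x

/-- The norm of `w` in `L^∞(0,T; L²(circle))`, with values in `[0,∞]`. -/
def normLinfL2 (T L : ℝ) (w : ℝ → ℝ → ℝ) : ℝ≥0∞ :=
  essSup (fun t => eLpNorm (w t) 2 (period L)) (volume.restrict (Set.Ioo 0 T))

end HyperbolicApprox

end

open HyperbolicApprox

/-! The proof compares an entropy solution `q` with the state
`V = (u, ∂_x u, …, ∂_x^{m-2} u, ∂_x^{m-1} u - σ μ ∂_x u)` built from the limit solution
(`limitState`). This state satisfies the first equation of the hyperbolic system exactly and the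
other ones up to the residual `τ ∂_t V_j` (`IsReference`). With `e = q - V`, the energy is quadratic,
so the relative energy is the energy of `e`. Subtracting from the entropy inequality the equations
for `e` tested with `V` and the energy balance of `V` gives (`IsReference.energy_inequality`)

  `d/dt ∫ energy(e) ≤ C ∫ e_0² - τ ∑_{j ≥ 1} ∫ ∂_t V_j e_j`.

As `m` is odd, the linear flux is symmetric and the source dissipates energy; the nonlinear flux
only leaves the quadratic remainder `f(q_0) - f(u) - f'(u) e_0`, because `f'` is Lipschitz.

Cauchy's inequality would bound the last sum only by `energy(e) + O(τ)`, as the energy controls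
`√τ e_j`; the rate `τ` in the theorem needs `O(τ²)`. Since `∂_t V_j` is, up to the viscous
correction, the derivative `∂_x^j ∂_t u`, the integrals `∫ ∂_t ∂_x^a u e_k` can be rearranged: the
equations `∂_x e_{k-1} ≈ e_k` (up to the viscous correction), whose defect is a residual of order `τ`
plus `τ ∂_t e_{m-k}`, move a derivative from the weight to the error
(`IsReference.negligible_constraint`). For `a + k ≤ m - 1`
this leads down to the component `e_0`, which the energy controls without a power of `τ`; otherwise
it leads up to `e_{m-1}`, where the conservation law for `e_0` gives the bound
(`IsReference.negligible_conservation`). The time derivatives that arise are integrated by parts,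
and then fall on the weight or on the cut-off in time, which contributes `ε` times the energy at the
final time and can be absorbed. The outcome of this calculus is `IsReference.negligible_pairing`.

A Gronwall argument (`integral_le_of_weak_gronwall`) then gives `∫ energy(e) ≤ C τ²` at almost every
time. It is carried out in weak form, with the solution of a backward equation as test function,
since the entropy inequality is only distributional in time.

The functions `V_j` are not smooth, and are admissible as test functions by mollification. The
mollification (`moll`) is periodic in space and looks forward in time, so that it is defined up to the
initial time without an extension of the function.
-/

open scoped ContDiff ENNReal

noncomputable section

namespace HyperbolicApprox

open MeasureTheory Filter Topology Set

/-! ### Smooth periodic functions -/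

section

lemma mixedDeriv_zero_zero (φ : ℝ → ℝ → ℝ) : mixedDeriv 0 0 φ = φ := by
  ext t x; simp [mixedDeriv]

lemma mixedDeriv_one_zero (φ : ℝ → ℝ → ℝ) (t x : ℝ) :
    mixedDeriv 1 0 φ t x = deriv (fun s => φ s x) t := by
  simp [mixedDeriv]

lemma mixedDeriv_zero_one (φ : ℝ → ℝ → ℝ) (t x : ℝ) :
    mixedDeriv 0 1 φ t x = deriv (φ t) x := by
  simp [mixedDeriv]

lemma mixedDeriv_x (a b : ℕ) (φ : ℝ → ℝ → ℝ) :
    mixedDeriv a b (mixedDeriv 0 1 φ) = mixedDeriv a (b + 1) φ := by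
  have h : ∀ s, mixedDeriv 0 1 φ s = deriv (φ s) := fun s => by
    ext x; exact mixedDeriv_zero_one φ s x
  ext t x
  change iteratedDeriv a (fun s => iteratedDeriv b (mixedDeriv 0 1 φ s) x) t = _
  simp only [h, mixedDeriv, iteratedDeriv_succ']

lemma mixedDeriv_x_iter (a b c : ℕ) (φ : ℝ → ℝ → ℝ) :
    mixedDeriv a b (mixedDeriv 0 c φ) = mixedDeriv a (b + c) φ := by
  induction c generalizing φ with
  | zero => rw [mixedDeriv_zero_zero]; rfl
  | succ c ih => rw [← mixedDeriv_x 0 c, ih, mixedDeriv_x]; rfl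

namespace IsSmoothPeriodic

variable {L : ℝ} {φ w : ℝ → ℝ → ℝ}

lemma hasDerivAt_t (h : IsSmoothPeriodic L φ) (t x : ℝ) :
    HasDerivAt (fun s => φ s x) (fderiv ℝ (fun p : ℝ × ℝ => φ p.1 p.2) (t, x) (1, 0)) t := by
  have h1 : HasFDerivAt (fun p : ℝ × ℝ => φ p.1 p.2)
      (fderiv ℝ (fun p : ℝ × ℝ => φ p.1 p.2) (t, x)) (t, x) :=
    ((h.smooth.differentiable (by simp)) (t, x)).hasFDerivAt
  have h2 : HasDerivAt (fun s : ℝ => (s, x)) ((1 : ℝ), (0 : ℝ)) t :=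
    (hasDerivAt_id t).prodMk (hasDerivAt_const t x)
  exact HasFDerivAt.comp_hasDerivAt t h1 h2

lemma hasDerivAt_x (h : IsSmoothPeriodic L φ) (t x : ℝ) :
    HasDerivAt (φ t) (fderiv ℝ (fun p : ℝ × ℝ => φ p.1 p.2) (t, x) (0, 1)) x := by
  have h1 : HasFDerivAt (fun p : ℝ × ℝ => φ p.1 p.2)
      (fderiv ℝ (fun p : ℝ × ℝ => φ p.1 p.2) (t, x)) (t, x) :=
    ((h.smooth.differentiable (by simp)) (t, x)).hasFDerivAt
  have h2 : HasDerivAt (fun s : ℝ => (t, s)) ((0 : ℝ), (1 : ℝ)) x :=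
    (hasDerivAt_const x t).prodMk (hasDerivAt_id x)
  exact HasFDerivAt.comp_hasDerivAt x h1 h2

lemma t_eq (h : IsSmoothPeriodic L φ) (t x : ℝ) :
    mixedDeriv 1 0 φ t x = fderiv ℝ (fun p : ℝ × ℝ => φ p.1 p.2) (t, x) (1, 0) := by
  rw [mixedDeriv_one_zero]; exact (h.hasDerivAt_t t x).deriv

lemma x_eq (h : IsSmoothPeriodic L φ) (t x : ℝ) :
    mixedDeriv 0 1 φ t x = fderiv ℝ (fun p : ℝ × ℝ => φ p.1 p.2) (t, x) (0, 1) := by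
  rw [mixedDeriv_zero_one]; exact (h.hasDerivAt_x t x).deriv

lemma dt (h : IsSmoothPeriodic L φ) : IsSmoothPeriodic L (mixedDeriv 1 0 φ) where
  smooth := by
    have : (fun p : ℝ × ℝ => mixedDeriv 1 0 φ p.1 p.2)
        = fun p => fderiv ℝ (fun p : ℝ × ℝ => φ p.1 p.2) p (1, 0) := by
      ext p; exact h.t_eq p.1 p.2
    rw [this]
    exact (h.smooth.fderiv_right (m := ∞) (by simp)).clm_apply contDiff_const
  periodic t x := by
    simp only [mixedDeriv_one_zero, h.periodic]

lemma dx (h : IsSmoothPeriodic L φ) : IsSmoothPeriodic L (mixedDeriv 0 1 φ) where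
  smooth := by
    have : (fun p : ℝ × ℝ => mixedDeriv 0 1 φ p.1 p.2)
        = fun p => fderiv ℝ (fun p : ℝ × ℝ => φ p.1 p.2) p (0, 1) := by
      ext p; exact h.x_eq p.1 p.2
    rw [this]
    exact (h.smooth.fderiv_right (m := ∞) (by simp)).clm_apply contDiff_const
  periodic t x := by
    have : (fun y => φ t (y + L)) = φ t := by ext y; exact h.periodic t y
    simp only [mixedDeriv_zero_one]
    rw [← deriv_comp_add_const, this]

lemma dx_iter (h : IsSmoothPeriodic L φ) (b : ℕ) : IsSmoothPeriodic L (mixedDeriv 0 b φ) := by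
  induction b with
  | zero => rwa [mixedDeriv_zero_zero]
  | succ b ih =>
    have := mixedDeriv_x_iter 0 1 b φ
    rw [add_comm] at this
    rw [← this]; exact ih.dx

/-- The mixed second derivatives agree. -/
lemma dt_dx (h : IsSmoothPeriodic L φ) :
    mixedDeriv 1 0 (mixedDeriv 0 1 φ) = mixedDeriv 0 1 (mixedDeriv 1 0 φ) := by
  set Φ : ℝ × ℝ → ℝ := fun p => φ p.1 p.2 with hΦ
  have hd : ∀ p : ℝ × ℝ, DifferentiableAt ℝ (fderiv ℝ Φ) p := fun p =>
    ((h.smooth.fderiv_right (m := ∞) (by simp)).differentiable (by simp)) p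
  have key : ∀ (p v w : ℝ × ℝ), fderiv ℝ (fun q => fderiv ℝ Φ q v) p w
      = fderiv ℝ (fderiv ℝ Φ) p w v := by
    intro p v w
    rw [fderiv_clm_apply (hd p) (differentiableAt_const v)]
    simp
  ext t x
  rw [h.dx.t_eq, h.dt.x_eq]
  have e1 : (fun p : ℝ × ℝ => mixedDeriv 0 1 φ p.1 p.2) = fun q => fderiv ℝ Φ q (0, 1) := by
    ext p; exact h.x_eq p.1 p.2
  have e2 : (fun p : ℝ × ℝ => mixedDeriv 1 0 φ p.1 p.2) = fun q => fderiv ℝ Φ q (1, 0) := by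
    ext p; exact h.t_eq p.1 p.2
  rw [e1, e2, key, key]
  have hs : IsSymmSndFDerivAt ℝ Φ (t, x) :=
    (h.smooth.contDiffAt).isSymmSndFDerivAt
      (by rw [minSmoothness_of_isRCLikeNormedField]; exact WithTop.coe_le_coe.2 le_top)
  exact hs _ _

lemma dt_dx_iter (h : IsSmoothPeriodic L φ) (b : ℕ) :
    mixedDeriv 1 0 (mixedDeriv 0 b φ) = mixedDeriv 0 b (mixedDeriv 1 0 φ) := by
  induction b generalizing φ with
  | zero => simp [mixedDeriv_zero_zero]
  | succ b ih => rw [← mixedDeriv_x, ih h.dx, h.dt_dx, mixedDeriv_x]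

lemma mixedDeriv_t (h : IsSmoothPeriodic L φ) (a b : ℕ) :
    mixedDeriv a b (mixedDeriv 1 0 φ) = mixedDeriv (a + 1) b φ := by
  ext t x
  have : ∀ s, iteratedDeriv b (mixedDeriv 1 0 φ s) x
      = deriv (fun s => iteratedDeriv b (φ s) x) s := by
    intro s
    have := congrFun (congrFun (h.dt_dx_iter b) s) x
    rw [mixedDeriv_one_zero] at this
    simpa [mixedDeriv] using this.symm
  simp only [mixedDeriv, iteratedDeriv_succ']
  congr 1
  ext s; simpa [mixedDeriv] using this s

lemma mul_time (h : IsSmoothPeriodic L φ) {χ : ℝ → ℝ} (hχ : ContDiff ℝ ∞ χ) :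
    IsSmoothPeriodic L (fun t x => χ t * φ t x) where
  smooth := (hχ.comp contDiff_fst).mul h.smooth
  periodic t x := by simp only [h.periodic]

lemma mul_time_dt (h : IsSmoothPeriodic L φ) {χ : ℝ → ℝ} (hχ : ContDiff ℝ ∞ χ) (t x : ℝ) :
    mixedDeriv 1 0 (fun t x => χ t * φ t x) t x
      = deriv χ t * φ t x + χ t * mixedDeriv 1 0 φ t x := by
  rw [mixedDeriv_one_zero, mixedDeriv_one_zero]
  exact deriv_mul ((hχ.differentiable (by simp)) t) (h.hasDerivAt_t t x).differentiableAt

lemma of_time {χ : ℝ → ℝ} (hχ : ContDiff ℝ ∞ χ) : IsSmoothPeriodic L (fun t _ => χ t) :=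
  ⟨hχ.comp contDiff_fst, fun _ _ => rfl⟩

lemma continuous (h : IsSmoothPeriodic L φ) : Continuous (fun p : ℝ × ℝ => φ p.1 p.2) :=
  h.smooth.continuous

end IsSmoothPeriodic

lemma mixedDeriv_zero_mul_time (χ : ℝ → ℝ) (φ : ℝ → ℝ → ℝ) (b : ℕ) (t x : ℝ) :
    mixedDeriv 0 b (fun t x => χ t * φ t x) t x = χ t * mixedDeriv 0 b φ t x := by
  simp [mixedDeriv, iteratedDeriv_const_mul_field]

lemma mixedDeriv_of_time_t (χ : ℝ → ℝ) (t x : ℝ) :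
    mixedDeriv 1 0 (fun t _ => χ t) t x = deriv χ t := by
  rw [mixedDeriv_one_zero]

lemma mixedDeriv_of_time_x (χ : ℝ → ℝ) (t x : ℝ) :
    mixedDeriv 0 1 (fun t _ => χ t) t x = 0 := by
  rw [mixedDeriv_zero_one]; simp

end

/-! ### The flux function -/

section

lemma exists_bound_of_memLp_top {α : Type*} [MeasurableSpace α] {ν : Measure α} {W : α → ℝ}
    (hW : MemLp W ∞ ν) : ∃ B : ℝ, 0 ≤ B ∧ ∀ᵐ p ∂ν, |W p| ≤ B := by
  refine ⟨(eLpNorm W ∞ ν).toReal, ENNReal.toReal_nonneg, ?_⟩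
  filter_upwards [ae_le_eLpNormEssSup (f := W) (μ := ν)] with s hs
  have h1 : ‖W s‖ₑ ≤ eLpNorm W ∞ ν := by rwa [eLpNorm_exponent_top]
  have := ENNReal.toReal_mono hW.2.ne h1
  simpa using this

/-- Second-order Taylor estimate for a function whose derivative is Lipschitz. -/
lemma abs_taylor_le_of_lipschitz {f G : ℝ → ℝ} {M : ℝ} (hf : ∀ x, HasDerivAt f (G x) x)
    (hG : ∀ x y, |G x - G y| ≤ M * |x - y|) (x y : ℝ) :
    |f y - f x - G x * (y - x)| ≤ M * (y - x) ^ 2 := by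
  have hM : 0 ≤ M := by
    have := (abs_nonneg _).trans (hG 1 0); simpa using this
  have h := (convex_uIcc x y).norm_image_sub_le_of_norm_hasDerivWithin_le
    (f := fun z => f z - G x * z) (f' := fun z => G z - G x) (C := M * |y - x|) (x := x) (y := y)
    (fun z _ => ((hf z).sub ((hasDerivAt_id z).const_mul (G x)) |>.congr_deriv
      (by simp)).hasDerivWithinAt)
    (fun z hz => by
      rw [Real.norm_eq_abs]
      exact (hG z x).trans (mul_le_mul_of_nonneg_left (abs_sub_left_of_mem_uIcc hz) hM))
    left_mem_uIcc right_mem_uIcc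
  rw [Real.norm_eq_abs, Real.norm_eq_abs, mul_assoc, abs_mul_abs_self] at h
  calc |f y - f x - G x * (y - x)| = |f y - G x * y - (f x - G x * x)| := by congr 1; ring
    _ ≤ M * ((y - x) * (y - x)) := h
    _ = M * (y - x) ^ 2 := by ring

/-- A continuous function whose second weak derivative is bounded satisfies a second-order
expansion at every point with uniform quadratic error. The expansion holds for mollifications,
and the slopes are bounded, so that a limit of slopes exists along a subsequence. -/
lemma exists_quadratic_expansion {f f₂ : ℝ → ℝ} (hf : Continuous f)
    (h₂ : IsWeakDerivLine 2 f f₂) (hb : MemLp f₂ ∞ volume) :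
    ∃ M : ℝ, ∀ x, ∃ c : ℝ, ∀ y, |f y - f x - c * (y - x)| ≤ M * (y - x) ^ 2 := by
  obtain ⟨M, hM0, hM⟩ := exists_bound_of_memLp_top hb
  let ρ : ℕ → ContDiffBump (0 : ℝ) := fun n =>
    ⟨1 / (n + 1) / 2, 1 / (n + 1), by positivity, by
      have : (0 : ℝ) < 1 / (n + 1) := by positivity
      linarith⟩
  let κ : ℕ → ℝ → ℝ := fun n => (ρ n).normed volume
  have hκs : ∀ n, ContDiff ℝ ∞ (κ n) := fun n => (ρ n).contDiff_normed
  have hκc : ∀ n, HasCompactSupport (κ n) := fun n => (ρ n).hasCompactSupport_normed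
  let Lm := (ContinuousLinearMap.lsmul ℝ ℝ : ℝ →L[ℝ] ℝ →L[ℝ] ℝ)
  let F : ℕ → ℝ → ℝ := fun n => convolution (κ n) f Lm volume
  have hF : ∀ x, Tendsto (fun n => F n x) atTop (𝓝 (f x)) := fun x =>
    ContDiffBump.convolution_tendsto_right_of_continuous (φ := ρ)
      tendsto_one_div_add_atTop_nhds_zero_nat hf x
  have hder : ∀ n x, HasDerivAt (F n) (convolution (deriv (κ n)) f Lm volume x) x := fun n x =>
    (hκc n).hasDerivAt_convolution_left Lm ((hκs n).of_le (by simp)) hf.locallyIntegrable x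
  have hκ1 : ∀ n, ContDiff ℝ ∞ (deriv (κ n)) := fun n =>
    ((contDiff_infty_iff_deriv).1 (hκs n)).2
  have hder2 : ∀ n x, HasDerivAt (fun x => convolution (deriv (κ n)) f Lm volume x)
      (convolution (deriv (deriv (κ n))) f Lm volume x) x := fun n x =>
    (hκc n).deriv.hasDerivAt_convolution_left Lm ((hκ1 n).of_le (by simp)) hf.locallyIntegrable x
  have hbd : ∀ n x, |convolution (deriv (deriv (κ n))) f Lm volume x| ≤ M := by
    intro n x
    have hsm : ContDiff ℝ ∞ (fun s => κ n (x - s)) := (hκs n).comp (contDiff_const.sub contDiff_id)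
    have hcs : HasCompactSupport (fun s => κ n (x - s)) :=
      (hκc n).comp_homeomorph (Homeomorph.subLeft x)
    have e : iteratedDeriv 2 (fun s => κ n (x - s)) = fun s => deriv (deriv (κ n)) (x - s) := by
      rw [iteratedDeriv_succ, iteratedDeriv_one]
      have : deriv (fun s => κ n (x - s)) = fun s => - deriv (κ n) (x - s) := by
        ext s; exact deriv_comp_const_sub _ _ _
      rw [this]
      ext s
      rw [deriv.fun_neg, deriv_comp_const_sub, neg_neg]
    have h := h₂ _ hsm hcs
    rw [e] at h
    have e2 : convolution (deriv (deriv (κ n))) f Lm volume x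
        = ∫ s, f₂ s * κ n (x - s) := by
      rw [convolution_eq_swap]
      simp only [Lm, ContinuousLinearMap.lsmul_apply, smul_eq_mul]
      rw [show (∫ s, f₂ s * κ n (x - s)) = (-1) ^ 2 * ∫ s, f₂ s * κ n (x - s) by simp, ← h]
      congr 1; ext s; ring
    rw [e2, ← Real.norm_eq_abs]
    have hint : Integrable (fun s => κ n (x - s)) :=
      hsm.continuous.integrable_of_hasCompactSupport hcs
    calc ‖∫ s, f₂ s * κ n (x - s)‖ ≤ ∫ s, M * κ n (x - s) := by
          apply norm_integral_le_of_norm_le (hint.const_mul M)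
          filter_upwards [hM] with s hs
          rw [norm_mul, Real.norm_eq_abs, Real.norm_eq_abs,
            abs_of_nonneg ((ρ n).nonneg_normed (x - s))]
          exact mul_le_mul_of_nonneg_right hs ((ρ n).nonneg_normed _)
      _ = M := by
          rw [integral_const_mul, integral_sub_left_eq_self (κ n) volume x]
          simp [κ, (ρ n).integral_normed]
  have hlip : ∀ n x y, |convolution (deriv (κ n)) f Lm volume x
      - convolution (deriv (κ n)) f Lm volume y| ≤ M * |x - y| := fun n x y =>
    convex_univ.norm_image_sub_le_of_norm_hasDerivWithin_le
      (fun z _ => (hder2 n z).hasDerivWithinAt) (fun z _ => hbd n z) (mem_univ y) (mem_univ x)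
  have htay := fun n => abs_taylor_le_of_lipschitz (hder n) (hlip n)
  refine ⟨M, fun x => ?_⟩
  set s : ℕ → ℝ := fun n => convolution (deriv (κ n)) f Lm volume x with hs
  have hsb : Bornology.IsBounded (range s) := by
    have h1 : Tendsto (fun n => F n (x + 1) - F n x) atTop (𝓝 (f (x + 1) - f x)) :=
      (hF _).sub (hF _)
    obtain ⟨R, hR⟩ := (Metric.isBounded_range_of_tendsto _ h1).exists_norm_le
    refine isBounded_iff_forall_norm_le.2 ⟨R + M, ?_⟩
    rintro _ ⟨n, rfl⟩
    have h2 := htay n x (x + 1)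
    have h3 := hR _ (mem_range_self n)
    simp only [Real.norm_eq_abs] at h3 ⊢
    simp only [add_sub_cancel_left, mul_one, one_pow] at h2
    have h4 : s n = (F n (x + 1) - F n x) - (F n (x + 1) - F n x - s n) := by ring
    rw [h4]
    exact (abs_sub _ _).trans (add_le_add h3 h2)
  obtain ⟨c, -, φ, hφ, hc⟩ := tendsto_subseq_of_bounded hsb (fun n => mem_range_self n)
  refine ⟨c, fun y => ?_⟩
  have hl : Tendsto (fun n => |F (φ n) y - F (φ n) x - s (φ n) * (y - x)|) atTop
      (𝓝 |f y - f x - c * (y - x)|) :=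
    ((((hF y).comp hφ.tendsto_atTop).sub ((hF x).comp hφ.tendsto_atTop)).sub
      (hc.mul_const _)).abs
  exact le_of_tendsto hl (Eventually.of_forall fun n => htay (φ n) x y)

/-- An admissible flux is continuously differentiable with Lipschitz derivative. -/
lemma IsAdmissibleFlux.exists_lipschitz {f : ℝ → ℝ} (hf : IsAdmissibleFlux f) :
    ∃ M : ℝ, 0 ≤ M ∧ Differentiable ℝ f ∧ Continuous (deriv f) ∧
      ∀ x y, |f y - f x - deriv f x * (y - x)| ≤ M * (y - x) ^ 2 := by
  obtain ⟨hc, f₁, f₂, -, -, h2, hb⟩ := hf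
  obtain ⟨M, hM⟩ := exists_quadratic_expansion hc h2 hb
  choose G hG using hM
  have hM0 : 0 ≤ M := by
    have := (abs_nonneg _).trans (hG 0 1); simpa using this
  have hd : ∀ x, HasDerivAt f (G x) x := by
    intro x
    rw [hasDerivAt_iff_isLittleO]
    have h1 : (fun y => f y - f x - (y - x) • G x) =O[𝓝 x] fun y => (y - x) ^ 2 := by
      apply Asymptotics.IsBigO.of_bound M
      refine Eventually.of_forall fun y => ?_
      have := hG x y
      simp only [Real.norm_eq_abs, smul_eq_mul, abs_pow, sq_abs]
      rwa [mul_comm (y - x)]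
    refine h1.trans_isLittleO ?_
    have h2 : (fun y : ℝ => (y - x) ^ 2) = fun y => (y - x) * (y - x) := by ext; ring
    have h3 : (fun y : ℝ => y - x) =o[𝓝 x] (fun _ => (1 : ℝ)) := by
      rw [Asymptotics.isLittleO_one_iff]
      have : Tendsto (fun y : ℝ => y - x) (𝓝 x) (𝓝 (x - x)) :=
        (continuous_id.sub continuous_const).tendsto x
      simpa using this
    rw [h2]
    simpa using h3.mul_isBigO (Asymptotics.isBigO_refl (fun y : ℝ => y - x) (𝓝 x))
  have he : deriv f = G := by ext x; exact (hd x).deriv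
  refine ⟨M, hM0, fun x => (hd x).differentiableAt, ?_, fun x y => by rw [he]; exact hG x y⟩
  rw [he]
  have hlip : LipschitzWith (Real.toNNReal (2 * M)) G := by
    refine LipschitzWith.of_dist_le_mul fun x y => ?_
    rw [Real.dist_eq, Real.dist_eq, Real.coe_toNNReal _ (by positivity)]
    rcases eq_or_ne x y with rfl | hxy
    · simp
    have hpos : 0 < |x - y| := abs_pos.2 (sub_ne_zero.2 hxy)
    have h1 := hG x y
    have h2 := hG y x
    have h3 : |(G x - G y) * (x - y)| ≤ 2 * M * (x - y) ^ 2 := by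
      have e : (G x - G y) * (x - y) = (f y - f x - G x * (y - x)) + (f x - f y - G y * (x - y)) := by
        ring
      rw [e]
      refine (abs_add_le _ _).trans ?_
      nlinarith
    rw [abs_mul, ← sq_abs, sq, ← mul_assoc] at h3
    exact le_of_mul_le_mul_right h3 hpos
  exact hlip.continuous

end

/-! ### Periodic mollification -/

section

/-- Lebesgue measure on `(t₀,T) × (0,L)`. -/
def strip (t₀ T L : ℝ) : Measure (ℝ × ℝ) :=
  volume.restrict (Ioo t₀ T ×ˢ Ioo 0 L)

/-- Test functions in `C_c^∞((t₀,T) × circle)`. -/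
def IsTest (t₀ T L : ℝ) (φ : ℝ → ℝ → ℝ) : Prop :=
  IsSmoothPeriodic L φ ∧
    ∃ a b : ℝ, t₀ < a ∧ b < T ∧ ∀ t x, (t < a ∨ b < t) → φ t x = 0

instance isFiniteMeasure_strip (t₀ T L : ℝ) : IsFiniteMeasure (strip t₀ T L) := by
  constructor
  rw [strip, Measure.restrict_apply_univ, Measure.volume_eq_prod, Measure.prod_prod]
  simp [ENNReal.mul_lt_top]

/-- Mollification of an integrable function on a bounded set by a smooth kernel: smoothness and
differentiation under the integral sign. -/
lemma smooth_integral_kernel {K : ℝ × ℝ → ℝ} (hK : ContDiff ℝ ∞ K) {S : Set (ℝ × ℝ)}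
    (hS : MeasurableSet S) (hSb : Bornology.IsBounded S) {W : ℝ × ℝ → ℝ}
    (hW : IntegrableOn W S) :
    ContDiff ℝ ∞ (fun p => ∫ p' in S, K (p - p') * W p') ∧
    ∀ p v, fderiv ℝ (fun p => ∫ p' in S, K (p - p') * W p') p v
      = ∫ p' in S, fderiv ℝ K (p - p') v * W p' := by
  obtain ⟨R, hR0, hR⟩ := hSb.exists_pos_norm_le
  have hloc : ∀ p₀ : ℝ × ℝ, ContDiffAt ℝ ∞ (fun p => ∫ p' in S, K (p - p') * W p') p₀ ∧
      ∀ v, fderiv ℝ (fun p => ∫ p' in S, K (p - p') * W p') p₀ v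
      = ∫ p' in S, fderiv ℝ K (p₀ - p') v * W p' := by
    intro p₀
    let ζ : ContDiffBump (0 : ℝ × ℝ) := ⟨R + ‖p₀‖ + 2, R + ‖p₀‖ + 3, by positivity, by linarith⟩
    let g : ℝ × ℝ → ℝ := fun z => ζ z * K z
    have hg : ContDiff ℝ ∞ g := ζ.contDiff.mul hK
    have hgc : HasCompactSupport g := ζ.hasCompactSupport.mul_right
    have hball : ∀ p ∈ Metric.ball p₀ 1, ∀ p' ∈ S,
        p - p' ∈ Metric.ball (0 : ℝ × ℝ) (R + ‖p₀‖ + 2) := by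
      intro p hp p' hp'
      rw [mem_ball_zero_iff]
      rw [mem_ball_iff_norm] at hp
      have h1 : ‖p‖ ≤ ‖p₀‖ + ‖p - p₀‖ := by
        calc ‖p‖ = ‖p₀ + (p - p₀)‖ := by congr 1; abel
          _ ≤ _ := norm_add_le _ _
      have := norm_sub_le p p'
      have := hR p' hp'
      linarith
    have hgK : ∀ z ∈ Metric.ball (0 : ℝ × ℝ) (R + ‖p₀‖ + 2), g z = K z := by
      intro z hz
      simp only [g]
      rw [ζ.one_of_mem_closedBall (Metric.ball_subset_closedBall hz), one_mul]
    let Lm := (ContinuousLinearMap.lsmul ℝ ℝ : ℝ →L[ℝ] ℝ →L[ℝ] ℝ)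
    have hWi : Integrable (S.indicator W) := hW.integrable_indicator hS
    have hF : (fun p => ∫ p' in S, K (p - p') * W p')
        =ᶠ[𝓝 p₀] convolution (S.indicator W) g Lm volume := by
      filter_upwards [Metric.ball_mem_nhds p₀ one_pos] with p hp
      rw [convolution_def, ← integral_indicator hS]
      congr 1; ext p'
      by_cases h : p' ∈ S
      · simp only [indicator_of_mem h, Lm, ContinuousLinearMap.lsmul_apply, smul_eq_mul]
        rw [hgK _ (hball p hp p' h), mul_comm]
      · simp [indicator_of_notMem h]
    refine ⟨((hgc.contDiff_convolution_right Lm hWi.locallyIntegrable hg).contDiffAt).congr_of_eventuallyEq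
      hF, fun v => ?_⟩
    rw [hF.fderiv_eq, (hgc.hasFDerivAt_convolution_right Lm hWi.locallyIntegrable
      (hg.of_le (by simp)) p₀).fderiv, convolution_precompR_apply Lm hWi.locallyIntegrable
      (hgc.fderiv ℝ) (hg.continuous_fderiv (by simp)), convolution_def, ← integral_indicator hS]
    congr 1; ext p'
    by_cases h : p' ∈ S
    · simp only [indicator_of_mem h, Lm, ContinuousLinearMap.lsmul_apply, smul_eq_mul]
      rw [mul_comm]
      congr 2
      apply Filter.EventuallyEq.fderiv_eq
      filter_upwards [Metric.isOpen_ball.mem_nhds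
        (hball p₀ (Metric.mem_ball_self one_pos) p' h)] with z hz using hgK z hz
    · simp [indicator_of_notMem h]
  exact ⟨contDiff_iff_contDiffAt.2 fun p => (hloc p).1, fun p v => (hloc p).2 v⟩

/-- The representative of `y` modulo `L` that is closest to the origin. -/
def wrap (L y : ℝ) : ℝ := y - L * round (y / L)

lemma wrap_add {L : ℝ} (hL : 0 < L) (y : ℝ) : wrap L (y + L) = wrap L y := by
  unfold wrap
  rw [add_div, div_self hL.ne', round_add_one]
  push_cast; ring

lemma abs_wrap_le {L : ℝ} (hL : 0 < L) (y : ℝ) (k : ℤ) : |wrap L y| ≤ |y - L * k| := by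
  have h := round_le (y / L) k
  have e : ∀ c : ℝ, |y - L * c| = L * |y / L - c| := fun c => by
    rw [← abs_of_pos hL, ← abs_mul, abs_of_pos hL, mul_sub, mul_div_cancel₀ _ hL.ne']
  unfold wrap
  rw [e, e]
  exact mul_le_mul_of_nonneg_left h hL.le

lemma wrap_eq_of_abs_lt {L : ℝ} (hL : 0 < L) {y : ℝ} {k : ℤ} (h : |y - L * k| < L / 2) :
    wrap L y = y - L * k := by
  have : round (y / L) = k := by
    rw [round_eq_iff]
    rw [abs_lt] at h
    constructor
    · rw [le_div_iff₀ hL]; linarith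
    · rw [div_lt_iff₀ hL]; linarith
  unfold wrap
  rw [this]

lemma smooth_wrap {L : ℝ} (hL : 0 < L) {ρ : ℝ × ℝ → ℝ} (hρ : ContDiff ℝ ∞ ρ)
    (h0 : ∀ z : ℝ × ℝ, L / 4 ≤ |z.2| → ρ z = 0) :
    ContDiff ℝ ∞ (fun z : ℝ × ℝ => ρ (z.1, wrap L z.2)) := by
  rw [contDiff_iff_contDiffAt]
  rintro ⟨s₀, y₀⟩
  set k := round (y₀ / L) with hk
  have hnear : ∀ᶠ z : ℝ × ℝ in 𝓝 (s₀, y₀), |z.2 - y₀| < L / 8 := by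
    have : ContinuousAt (fun z : ℝ × ℝ => |z.2 - y₀|) (s₀, y₀) := by fun_prop
    exact this.eventually_lt continuousAt_const (by simpa using hL)
  by_cases hc : |wrap L y₀| < 3 * L / 8
  · have : (fun z : ℝ × ℝ => ρ (z.1, wrap L z.2))
        =ᶠ[𝓝 (s₀, y₀)] fun z => ρ (z.1, z.2 - L * k) := by
      filter_upwards [hnear] with z hz
      rw [wrap_eq_of_abs_lt hL (k := k)]
      have e : z.2 - L * k = wrap L y₀ + (z.2 - y₀) := by unfold wrap; rw [← hk]; ring
      rw [e]
      have := abs_add_le (wrap L y₀) (z.2 - y₀)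
      linarith
    refine ContDiffAt.congr_of_eventuallyEq ?_ this
    exact (hρ.comp (contDiff_fst.prodMk (contDiff_snd.sub contDiff_const))).contDiffAt
  · have : (fun z : ℝ × ℝ => ρ (z.1, wrap L z.2)) =ᶠ[𝓝 (s₀, y₀)] fun _ => 0 := by
      filter_upwards [hnear] with z hz
      apply h0
      have h1 := abs_wrap_le hL y₀ (round (z.2 / L))
      have e : y₀ - L * round (z.2 / L) = wrap L z.2 - (z.2 - y₀) := by unfold wrap; ring
      rw [e] at h1
      have := abs_sub (wrap L z.2) (z.2 - y₀)
      simp only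
      linarith [not_lt.1 hc]
    exact contDiffAt_const.congr_of_eventuallyEq this

/-- Mollification radii. -/
def radius (L : ℝ) (n : ℕ) : ℝ := L / 8 * (1 / ((n : ℝ) + 1))

lemma radius_pos {L : ℝ} (hL : 0 < L) (n : ℕ) : 0 < radius L n := by
  unfold radius; positivity

lemma radius_le {L : ℝ} (hL : 0 < L) (n : ℕ) : radius L n ≤ L / 8 := by
  have : 1 / ((n : ℝ) + 1) ≤ 1 := by
    rw [div_le_one (by positivity)]; linarith [(Nat.cast_nonneg n : (0 : ℝ) ≤ n)]
  unfold radius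
  nlinarith

lemma tendsto_radius (L : ℝ) : Tendsto (radius L) atTop (𝓝 0) := by
  have := (tendsto_one_div_add_atTop_nhds_zero_nat (𝕜 := ℝ)).const_mul (L / 8)
  rwa [mul_zero] at this

/-- A smooth bump on the plane, supported in the (square) ball of radius `radius L n`. -/
def bump {L : ℝ} (hL : 0 < L) (n : ℕ) : ContDiffBump (0 : ℝ × ℝ) :=
  ⟨radius L n / 2, radius L n, half_pos (radius_pos hL n), half_lt_self (radius_pos hL n)⟩

/-- The bump, made periodic in the second variable. -/
def kernel {L : ℝ} (hL : 0 < L) (n : ℕ) (z : ℝ × ℝ) : ℝ :=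
  (bump hL n).normed volume (z.1, wrap L z.2)

lemma bump_eq_zero {L : ℝ} (hL : 0 < L) (n : ℕ) {z : ℝ × ℝ}
    (h : radius L n ≤ |z.1| ∨ radius L n ≤ |z.2|) : (bump hL n).normed volume z = 0 := by
  rw [← Function.notMem_support, (bump hL n).support_normed_eq, mem_ball_zero_iff, Prod.norm_def,
    max_lt_iff, Real.norm_eq_abs, Real.norm_eq_abs]
  rcases h with h | h
  · exact fun hh => absurd hh.1 (not_lt.2 h)
  · exact fun hh => absurd hh.2 (not_lt.2 h)

lemma kernel_nonneg {L : ℝ} (hL : 0 < L) (n : ℕ) (z : ℝ × ℝ) : 0 ≤ kernel hL n z :=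
  (bump hL n).nonneg_normed _

lemma contDiff_kernel {L : ℝ} (hL : 0 < L) (n : ℕ) : ContDiff ℝ ∞ (kernel hL n) :=
  smooth_wrap hL ((bump hL n).contDiff_normed) fun z hz => bump_eq_zero hL n
    (Or.inr (by have := radius_le hL n; linarith))

/-- Mollification in space-time, periodic in space and looking forward in time, so that near the
initial time `t₀` only values of `W` at times after `t₀` are used. -/
def moll {L : ℝ} (hL : 0 < L) (t₀ T : ℝ) (n : ℕ) (W : ℝ × ℝ → ℝ) (t x : ℝ) : ℝ :=
  ∫ p, kernel hL n ((t + 2 * radius L n, x) - p) * W p ∂(strip t₀ T L)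

variable {t₀ T L : ℝ}

lemma measurableSet_box : MeasurableSet (Ioo t₀ T ×ˢ Ioo 0 L) :=
  measurableSet_Ioo.prod measurableSet_Ioo

lemma isBounded_box : Bornology.IsBounded (Ioo t₀ T ×ˢ Ioo 0 L) :=
  (Metric.isBounded_Ioo _ _).prod (Metric.isBounded_Ioo _ _)

lemma ae_strip_mem : ∀ᵐ p ∂(strip t₀ T L), p.1 ∈ Ioo t₀ T ∧ p.2 ∈ Ioo 0 L :=
  ae_restrict_mem (μ := volume) (measurableSet_box (t₀ := t₀) (T := T) (L := L))

lemma moll_smooth (hL : 0 < L) (n : ℕ) {W : ℝ × ℝ → ℝ} (hW : Integrable W (strip t₀ T L)) :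
    IsSmoothPeriodic L (moll hL t₀ T n W) where
  smooth := (smooth_integral_kernel (contDiff_kernel hL n) measurableSet_box isBounded_box hW).1.comp
    ((contDiff_fst.add contDiff_const).prodMk contDiff_snd)
  periodic t x := by
    unfold moll
    congr 1; ext p
    congr 1
    simp only [kernel, Prod.fst_sub, Prod.snd_sub]
    rw [show x + L - p.2 = (x - p.2) + L by ring, wrap_add hL]

lemma kernel_test (hL : 0 < L) (n : ℕ) {t x : ℝ} (ht : t₀ ≤ t) (ht' : t + 3 * radius L n < T) :
    IsTest t₀ T L (fun s y => kernel hL n ((t + 2 * radius L n, x) - (s, y))) := by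
  have hr := radius_pos hL n
  refine ⟨⟨(contDiff_kernel hL n).comp (contDiff_const.sub contDiff_id), fun s y => ?_⟩,
    t + radius L n, t + 3 * radius L n, by linarith, ht', fun s y hs => bump_eq_zero hL n
      (Or.inl ?_)⟩
  · simp only [kernel, Prod.mk_sub_mk]
    rw [← wrap_add hL (x - (y + L))]
    congr 3; ring
  · simp only [Prod.mk_sub_mk]
    rcases hs with hs | hs
    · rw [abs_of_nonneg (by linarith)]; linarith
    · rw [abs_of_nonpos (by linarith)]; linarith

lemma fderiv_kernel_reflect (hL : 0 < L) (n : ℕ) (c p v : ℝ × ℝ) :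
    fderiv ℝ (fun p => kernel hL n (c - p)) p v = - fderiv ℝ (kernel hL n) (c - p) v := by
  have h1 : HasFDerivAt (kernel hL n) (fderiv ℝ (kernel hL n) (c - p)) (c - p) :=
    ((contDiff_kernel hL n).differentiable (by simp) _).hasFDerivAt
  have h2 : HasFDerivAt (fun p : ℝ × ℝ => c - p) (-(ContinuousLinearMap.id ℝ (ℝ × ℝ))) p :=
    (hasFDerivAt_id p).const_sub c
  rw [show (fun p => kernel hL n (c - p)) = kernel hL n ∘ (fun p => c - p) from rfl,
    (h1.comp p h2).fderiv]
  simp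

/-- `Wt` is the weak time derivative of `W` on `(t₀,T) × circle`. -/
def WeakT (t₀ T L : ℝ) (W Wt : ℝ × ℝ → ℝ) : Prop :=
  ∀ φ, IsTest t₀ T L φ →
    ∫ p, W p * mixedDeriv 1 0 φ p.1 p.2 ∂(strip t₀ T L)
      = - ∫ p, Wt p * φ p.1 p.2 ∂(strip t₀ T L)

/-- `Wx` is the weak space derivative of `W` on `(t₀,T) × circle`. -/
def WeakX (t₀ T L : ℝ) (W Wx : ℝ × ℝ → ℝ) : Prop :=
  ∀ φ, IsTest t₀ T L φ →
    ∫ p, W p * mixedDeriv 0 1 φ p.1 p.2 ∂(strip t₀ T L)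
      = - ∫ p, Wx p * φ p.1 p.2 ∂(strip t₀ T L)

lemma moll_fderiv (hL : 0 < L) (n : ℕ) {W : ℝ × ℝ → ℝ} (hW : Integrable W (strip t₀ T L))
    (t x : ℝ) (v : ℝ × ℝ) :
    fderiv ℝ (fun p : ℝ × ℝ => moll hL t₀ T n W p.1 p.2) (t, x) v
      = ∫ p, fderiv ℝ (kernel hL n) ((t + 2 * radius L n, x) - p) v * W p ∂(strip t₀ T L) := by
  have h := (smooth_integral_kernel (contDiff_kernel hL n) (measurableSet_box (t₀ := t₀) (T := T)
    (L := L)) isBounded_box hW)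
  have e : (fun p : ℝ × ℝ => moll hL t₀ T n W p.1 p.2) = fun p =>
      (fun p => ∫ p' in Ioo t₀ T ×ˢ Ioo 0 L, kernel hL n (p - p') * W p')
        (p + (2 * radius L n, 0)) := by
    ext ⟨s, y⟩
    simp only [moll, strip, Prod.mk_add_mk, add_zero]
  rw [e]
  refine (congrArg (fun A => A v) (fderiv_comp_add_right (𝕜 := ℝ)
    (f := fun p => ∫ p' in Ioo t₀ T ×ˢ Ioo 0 L, kernel hL n (p - p') * W p')
    (2 * radius L n, (0 : ℝ)))).trans ?_
  rw [h.2]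
  simp [strip]

lemma moll_dt (hL : 0 < L) (n : ℕ) {W Wt : ℝ × ℝ → ℝ} (hW : Integrable W (strip t₀ T L))
    (h : WeakT t₀ T L W Wt) {t : ℝ} (x : ℝ) (ht : t₀ ≤ t) (ht' : t + 3 * radius L n < T) :
    mixedDeriv 1 0 (moll hL t₀ T n W) t x = moll hL t₀ T n Wt t x := by
  have hk := kernel_test hL n (x := x) ht ht'
  have h1 := h _ hk
  simp only [hk.1.t_eq] at h1
  rw [(moll_smooth hL n hW).t_eq, moll_fderiv hL n hW, moll]
  simp only [fderiv_kernel_reflect, mul_neg, integral_neg, neg_inj] at h1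
  simp only [mul_comm (W _), mul_comm (Wt _)] at h1
  exact h1

lemma moll_dx (hL : 0 < L) (n : ℕ) {W Wx : ℝ × ℝ → ℝ} (hW : Integrable W (strip t₀ T L))
    (h : WeakX t₀ T L W Wx) {t : ℝ} (x : ℝ) (ht : t₀ ≤ t) (ht' : t + 3 * radius L n < T) :
    mixedDeriv 0 1 (moll hL t₀ T n W) t x = moll hL t₀ T n Wx t x := by
  have hk := kernel_test hL n (x := x) ht ht'
  have h1 := h _ hk
  simp only [hk.1.x_eq] at h1
  rw [(moll_smooth hL n hW).x_eq, moll_fderiv hL n hW, moll]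
  simp only [fderiv_kernel_reflect, mul_neg, integral_neg, neg_inj] at h1
  simp only [mul_comm (W _), mul_comm (Wx _)] at h1
  exact h1

lemma integral_bump_reflect (hL : 0 < L) (n : ℕ) (c : ℝ × ℝ) :
    ∫ p, (bump hL n).normed volume (c - p) = 1 := by
  rw [integral_sub_left_eq_self ((bump hL n).normed volume) volume c]
  exact (bump hL n).integral_normed

lemma integrable_bump_reflect (hL : 0 < L) (n : ℕ) (c : ℝ × ℝ) :
    Integrable (fun p => (bump hL n).normed volume (c - p)) :=
  ((bump hL n).integrable_normed (μ := volume)).comp_sub_left c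

/-- On one period only three translates of the bump contribute to the periodic kernel. -/
lemma kernel_le (hL : 0 < L) (n : ℕ) (t : ℝ) {x y : ℝ} (s : ℝ) (h : |x - y| < L) :
    kernel hL n ((t, x) - (s, y)) ≤ (bump hL n).normed volume ((t, x - L) - (s, y))
      + (bump hL n).normed volume ((t, x) - (s, y))
      + (bump hL n).normed volume ((t, x + L) - (s, y)) := by
  have n1 := (bump hL n).nonneg_normed (μ := volume) ((t, x - L) - (s, y))
  have n2 := (bump hL n).nonneg_normed (μ := volume) ((t, x) - (s, y))
  have n3 := (bump hL n).nonneg_normed (μ := volume) ((t, x + L) - (s, y))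
  simp only [kernel, Prod.mk_sub_mk] at *
  rw [abs_lt] at h
  have hk : round ((x - y) / L) = -1 ∨ round ((x - y) / L) = 0 ∨ round ((x - y) / L) = 1 := by
    have h1 : (-1 : ℝ) < (x - y) / L := by rw [lt_div_iff₀ hL]; linarith
    have h2 : (x - y) / L < 1 := by rw [div_lt_iff₀ hL]; linarith
    have h3 := sub_half_lt_round ((x - y) / L)
    have h4 := round_le_add_half ((x - y) / L)
    have h5 : (-2 : ℤ) < round ((x - y) / L) := by
      have : ((-2 : ℤ) : ℝ) < round ((x - y) / L) := by push_cast; linarith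
      exact_mod_cast this
    have h6 : round ((x - y) / L) < (2 : ℤ) := by
      have : (round ((x - y) / L) : ℝ) < ((2 : ℤ) : ℝ) := by push_cast; linarith
      exact_mod_cast this
    omega
  unfold wrap
  rcases hk with hk | hk | hk <;> rw [hk]
  · rw [show x - y - L * ((-1 : ℤ) : ℝ) = x + L - y by push_cast; ring]; linarith
  · rw [show x - y - L * ((0 : ℤ) : ℝ) = x - y by push_cast; ring]; linarith
  · rw [show x - y - L * ((1 : ℤ) : ℝ) = x - L - y by push_cast; ring]; linarith

lemma abs_moll_le (hL : 0 < L) (n : ℕ) {W : ℝ × ℝ → ℝ} {B : ℝ} (hB0 : 0 ≤ B)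
    (hB : ∀ᵐ p ∂(strip t₀ T L), |W p| ≤ B) (t : ℝ) {x : ℝ} (hx : x ∈ Ioo 0 L) :
    |moll hL t₀ T n W t x| ≤ 3 * B := by
  set t' := t + 2 * radius L n
  let G : ℝ × ℝ → ℝ := fun p => (bump hL n).normed volume ((t', x - L) - p)
      + (bump hL n).normed volume ((t', x) - p) + (bump hL n).normed volume ((t', x + L) - p)
  have hG0 : ∀ p, 0 ≤ G p := fun p => add_nonneg (add_nonneg ((bump hL n).nonneg_normed _)
    ((bump hL n).nonneg_normed _)) ((bump hL n).nonneg_normed _)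
  have hGi : Integrable G := ((integrable_bump_reflect hL n _).add
    (integrable_bump_reflect hL n _)).add (integrable_bump_reflect hL n _)
  have hG : ∫ p, G p = 3 := by
    have h12 : Integrable (fun p => (bump hL n).normed volume ((t', x - L) - p)
        + (bump hL n).normed volume ((t', x) - p)) :=
      (integrable_bump_reflect hL n _).add (integrable_bump_reflect hL n _)
    simp only [G]
    rw [integral_add h12 (integrable_bump_reflect hL n _), integral_add (integrable_bump_reflect hL n _)
      (integrable_bump_reflect hL n _)]
    simp only [integral_bump_reflect]; norm_num
  calc |moll hL t₀ T n W t x| ≤ ∫ p, G p * B ∂(strip t₀ T L) := by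
        rw [← Real.norm_eq_abs]
        refine norm_integral_le_of_norm_le (hGi.restrict.mul_const B) ?_
        filter_upwards [hB, ae_strip_mem] with p hp hm
        rw [norm_mul, Real.norm_eq_abs, Real.norm_eq_abs, abs_of_nonneg (kernel_nonneg hL n _)]
        refine mul_le_mul (kernel_le hL n t' p.1 ?_) hp (abs_nonneg _) (hG0 _)
        rw [abs_lt]
        constructor <;> linarith [hx.1, hx.2, hm.2.1, hm.2.2]
    _ = (∫ p, G p ∂(strip t₀ T L)) * B := integral_mul_const _ _
    _ ≤ (∫ p, G p) * B := mul_le_mul_of_nonneg_right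
        (setIntegral_le_integral hGi (Eventually.of_forall hG0)) hB0
    _ = 3 * B := by rw [hG]

/-- The mollifications converge almost everywhere, by Lebesgue's differentiation theorem. -/
lemma tendsto_moll (hL : 0 < L) {W : ℝ × ℝ → ℝ} (hW : Integrable W (strip t₀ T L)) :
    ∀ᵐ p ∂(strip t₀ T L), Tendsto (fun n => moll hL t₀ T n W p.1 p.2) atTop (𝓝 (W p)) := by
  set S : Set (ℝ × ℝ) := Ioo t₀ T ×ˢ Ioo 0 L with hS
  have hSm : MeasurableSet S := measurableSet_box
  have hWi : Integrable (S.indicator W) := IntegrableOn.integrable_indicator hW hSm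
  have hae := (Besicovitch.vitaliFamily (volume : Measure (ℝ × ℝ))).ae_tendsto_average_norm_sub
    hWi.locallyIntegrable
  filter_upwards [ae_restrict_of_ae (s := S) hae, ae_strip_mem] with p₀ h₀ hm
  have hr4 : Tendsto (fun n => 4 * radius L n) atTop (𝓝 0) := by
    simpa using (tendsto_radius L).const_mul 4
  have hr : Tendsto (fun n => 4 * radius L n) atTop (𝓝[>] 0) :=
    tendsto_nhdsWithin_iff.2 ⟨hr4, Eventually.of_forall fun n => by
      have := radius_pos hL n; simpa using this⟩
  have hav := (h₀.comp (Besicovitch.tendsto_filterAt volume p₀)).comp hr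
  set c : ℕ → ℝ × ℝ := fun n => (p₀.1 + 2 * radius L n, p₀.2) with hc
  have hlim : Tendsto (fun n => ∫ p, (bump hL n).normed volume (c n - p) • S.indicator W p) atTop
      (𝓝 (S.indicator W p₀)) := by
    apply tendsto_integral_smul_of_tendsto_average_norm_sub (8 ^ (Module.finrank ℝ (ℝ × ℝ))) hav
    · exact Eventually.of_forall fun n => hWi.integrableOn
    · simp only [integral_bump_reflect]; exact tendsto_const_nhds
    · refine Eventually.of_forall fun n p hp => ?_
      have hrn := radius_pos hL n
      by_contra hcon
      apply hp
      apply bump_eq_zero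
      simp only [Metric.mem_closedBall, Prod.dist_eq, max_le_iff, not_and_or,
        not_le, Real.dist_eq] at hcon
      rcases hcon with hcon | hcon
      · left
        simp only [hc, Prod.fst_sub]
        have := abs_sub (2 * radius L n) (p₀.1 + 2 * radius L n - p.1)
        rw [show 2 * radius L n - (p₀.1 + 2 * radius L n - p.1) = p.1 - p₀.1 by ring,
          abs_of_pos (by linarith : 0 < 2 * radius L n)] at this
        linarith
      · right
        simp only [hc, Prod.snd_sub]
        rw [abs_sub_comm]; linarith
    · refine Eventually.of_forall fun n p => ?_
      have hrn := radius_pos hL n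
      rw [abs_of_nonneg ((bump hL n).nonneg_normed _)]
      refine ((bump hL n).normed_le_div_measure_closedBall_rIn volume _).trans (le_of_eq ?_)
      have e1 : (bump hL n).rIn = radius L n / 2 := rfl
      rw [e1, measureReal_def, measureReal_def, Measure.addHaar_closedBall _ _ (by positivity),
        Measure.addHaar_closedBall _ _ (by positivity), ENNReal.toReal_mul, ENNReal.toReal_mul,
        ENNReal.toReal_ofReal (by positivity), ENNReal.toReal_ofReal (by positivity),
        show (fun n => 4 * radius L n) n = 8 * (radius L n / 2) by
          change 4 * radius L n = _; ring, mul_pow]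
      have hv : (volume (Metric.ball (0 : ℝ × ℝ) 1)).toReal ≠ 0 :=
        ENNReal.toReal_ne_zero.2 ⟨(Metric.measure_ball_pos _ _ one_pos).ne',
          measure_ball_lt_top.ne⟩
      field_simp
  rw [indicator_of_mem (show p₀ ∈ S from hm)] at hlim
  refine hlim.congr' ?_
  have hd : 0 < min p₀.2 (L - p₀.2) := lt_min hm.2.1 (by linarith [hm.2.2])
  filter_upwards [(tendsto_radius L).eventually_lt_const hd] with n hn
  rw [lt_min_iff] at hn
  have h8 := radius_le hL n
  unfold moll strip
  rw [← integral_indicator hSm]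
  congr 1; ext p
  by_cases h : p ∈ S
  · rw [indicator_of_mem h, indicator_of_mem h, smul_eq_mul]
    congr 1
    have hp2 : p.2 ∈ Ioo 0 L := h.2
    by_cases hlt : |p₀.2 - p.2| < L / 2
    · simp only [kernel, hc]
      rw [show wrap L (((p₀.1 + 2 * radius L n, p₀.2) - p).2)
        = ((p₀.1 + 2 * radius L n, p₀.2) - p).2 from by
          rw [wrap_eq_of_abs_lt hL (k := 0)] <;> simp [hlt]]
    · rw [bump_eq_zero hL n (Or.inr (by simp only [hc, Prod.snd_sub]; linarith [not_lt.1 hlt]))]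
      symm
      apply bump_eq_zero hL n
      right
      simp only [Prod.snd_sub]
      unfold wrap
      rcases lt_trichotomy (round ((p₀.2 - p.2) / L)) 0 with hk | hk | hk
      · have : (round ((p₀.2 - p.2) / L) : ℝ) ≤ -1 := by exact_mod_cast Int.le_sub_one_of_lt hk
        refine le_abs.2 (Or.inl ?_)
        nlinarith [hp2.2]
      · rw [hk]; simp only [Int.cast_zero, mul_zero, sub_zero]; linarith [not_lt.1 hlt]
      · have : (1 : ℝ) ≤ round ((p₀.2 - p.2) / L) := by exact_mod_cast hk
        refine le_abs.2 (Or.inr ?_)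
        nlinarith [hp2.1]
  · simp [indicator_of_notMem h]

end

/-! ### Calculus with weak derivatives -/

section

variable {t₀ T L : ℝ}

lemma memLp_top_of_continuous {F : ℝ × ℝ → ℝ} (hF : Continuous F) : MemLp F ∞ (strip t₀ T L) := by
  obtain ⟨C, hC⟩ := ((isCompact_Icc (a := t₀) (b := T)).prod
    (isCompact_Icc (a := 0) (b := L))).exists_bound_of_continuousOn hF.continuousOn
  refine memLp_top_of_bound hF.aestronglyMeasurable C ?_
  filter_upwards [ae_strip_mem] with p hp
  exact hC p ⟨Ioo_subset_Icc_self hp.1, Ioo_subset_Icc_self hp.2⟩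

lemma strip_eq_prod : strip t₀ T L
    = (volume.restrict (Ioo t₀ T)).prod (volume.restrict (Ioo 0 L)) := by
  rw [strip, Measure.prod_restrict, Measure.volume_eq_prod]

lemma integrable_mul_top {α : Type*} [MeasurableSpace α] {ν : Measure α} {A W : α → ℝ}
    (hA : Integrable A ν) (hW : MemLp W ∞ ν) : Integrable (fun p => A p * W p) ν :=
  hA.mul_of_top_left hW

lemma memLp_top_mul {α : Type*} [MeasurableSpace α] {ν : Measure α} {A W : α → ℝ}
    (hA : MemLp A ∞ ν) (hW : MemLp W ∞ ν) : MemLp (fun p => A p * W p) ∞ ν :=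
  hW.mul hA

lemma moll_aesm (hL : 0 < L) (n : ℕ) {W : ℝ × ℝ → ℝ} (hW : Integrable W (strip t₀ T L)) :
    AEStronglyMeasurable (fun p : ℝ × ℝ => moll hL t₀ T n W p.1 p.2) (strip t₀ T L) :=
  (moll_smooth hL n hW).continuous.aestronglyMeasurable

lemma tendsto_integral_moll (hL : 0 < L) {A W : ℝ × ℝ → ℝ} (hA : Integrable A (strip t₀ T L))
    (hW : MemLp W ∞ (strip t₀ T L)) :
    Tendsto (fun n => ∫ p, A p * moll hL t₀ T n W p.1 p.2 ∂(strip t₀ T L)) atTop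
      (𝓝 (∫ p, A p * W p ∂(strip t₀ T L))) := by
  obtain ⟨B, hB0, hB⟩ := exists_bound_of_memLp_top hW
  have hWi := hW.integrable le_top
  refine tendsto_integral_of_dominated_convergence (fun p => |A p| * (3 * B))
    (fun n => hA.aestronglyMeasurable.mul (moll_aesm hL n hWi)) (hA.abs.mul_const _)
    (fun n => ?_) ?_
  · filter_upwards [ae_strip_mem] with p hp
    rw [norm_mul, Real.norm_eq_abs, Real.norm_eq_abs]
    exact mul_le_mul_of_nonneg_left (abs_moll_le hL n hB0 hB _ hp.2) (abs_nonneg _)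
  · filter_upwards [tendsto_moll hL hWi] with p hp using hp.const_mul _

lemma eventually_radius (L : ℝ) {b : ℝ} (hb : b < T) :
    ∀ᶠ n in atTop, b + 3 * radius L n < T := by
  have : Tendsto (fun n => b + 3 * radius L n) atTop (𝓝 (b + 3 * 0)) :=
    ((tendsto_radius L).const_mul 3).const_add b
  exact this.eventually_lt_const (by linarith)

lemma tendsto_integral_moll_dt (hL : 0 < L) {A W Wt : ℝ × ℝ → ℝ}
    (hA : Integrable A (strip t₀ T L)) {b : ℝ} (hb : b < T) (hAb : ∀ p, b < p.1 → A p = 0)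
    (hW : MemLp W ∞ (strip t₀ T L)) (hWt : MemLp Wt ∞ (strip t₀ T L))
    (h : WeakT t₀ T L W Wt) :
    Tendsto (fun n => ∫ p, A p * mixedDeriv 1 0 (moll hL t₀ T n W) p.1 p.2 ∂(strip t₀ T L)) atTop
      (𝓝 (∫ p, A p * Wt p ∂(strip t₀ T L))) := by
  refine (tendsto_integral_moll hL hA hWt).congr' ?_
  filter_upwards [eventually_radius L hb] with n hn
  refine integral_congr_ae ?_
  filter_upwards [ae_strip_mem] with p hp
  rcases le_or_gt p.1 b with h1 | h1
  · rw [moll_dt hL n (hW.integrable le_top) h p.2 hp.1.1.le (by linarith)]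
  · simp [hAb p h1]

lemma tendsto_integral_moll_dx (hL : 0 < L) {A W Wx : ℝ × ℝ → ℝ}
    (hA : Integrable A (strip t₀ T L)) {b : ℝ} (hb : b < T) (hAb : ∀ p, b < p.1 → A p = 0)
    (hW : MemLp W ∞ (strip t₀ T L)) (hWx : MemLp Wx ∞ (strip t₀ T L))
    (h : WeakX t₀ T L W Wx) :
    Tendsto (fun n => ∫ p, A p * mixedDeriv 0 1 (moll hL t₀ T n W) p.1 p.2 ∂(strip t₀ T L)) atTop
      (𝓝 (∫ p, A p * Wx p ∂(strip t₀ T L))) := by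
  refine (tendsto_integral_moll hL hA hWx).congr' ?_
  filter_upwards [eventually_radius L hb] with n hn
  refine integral_congr_ae ?_
  filter_upwards [ae_strip_mem] with p hp
  rcases le_or_gt p.1 b with h1 | h1
  · rw [moll_dx hL n (hW.integrable le_top) h p.2 hp.1.1.le (by linarith)]
  · simp [hAb p h1]

/-- The fundamental lemma of the calculus of variations for periodic test functions: the
mollification kernel is itself a test function. -/
lemma ae_eq_zero_of_integral_test (hL : 0 < L) {h : ℝ × ℝ → ℝ} (hi : Integrable h (strip t₀ T L))
    (h0 : ∀ φ, IsTest t₀ T L φ → ∫ p, h p * φ p.1 p.2 ∂(strip t₀ T L) = 0) :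
    ∀ᵐ p ∂(strip t₀ T L), h p = 0 := by
  filter_upwards [tendsto_moll hL hi, ae_strip_mem] with p hp hm
  refine tendsto_nhds_unique hp (tendsto_const_nhds.congr' ?_)
  filter_upwards [eventually_radius L hm.1.2] with n hn
  have := h0 _ (kernel_test hL n (x := p.2) hm.1.1.le hn)
  rw [← this, moll]
  congr 1; ext q; rw [mul_comm]

/-- The integral of a space derivative over full periods vanishes. -/
lemma integral_dx_eq_zero (hL : 0 < L) {G G' : ℝ → ℝ → ℝ}
    (hG : ∀ t x, HasDerivAt (G t) (G' t x) x) (hc : Continuous fun p : ℝ × ℝ => G' p.1 p.2)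
    (hp : ∀ t x, G t (x + L) = G t x) : ∫ p, G' p.1 p.2 ∂(strip t₀ T L) = 0 := by
  have hi : Integrable (fun p : ℝ × ℝ => G' p.1 p.2) (strip t₀ T L) :=
    (memLp_top_of_continuous hc).integrable le_top
  rw [strip_eq_prod] at hi ⊢
  rw [integral_prod _ hi]
  have : ∀ t, ∫ x in Ioo 0 L, G' t x = 0 := by
    intro t
    rw [← integral_Ioc_eq_integral_Ioo, ← intervalIntegral.integral_of_le hL.le,
      intervalIntegral.integral_eq_sub_of_hasDerivAt (fun x _ => hG t x)]
    · have := hp t 0; rw [zero_add] at this; rw [this, sub_self]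
    · exact (hc.comp (by fun_prop : Continuous fun x : ℝ => (t, x))).intervalIntegrable _ _
  simp [this]

lemma IsTest.mixedDeriv_x {φ : ℝ → ℝ → ℝ} (h : IsTest t₀ T L φ) (b : ℕ) :
    IsTest t₀ T L (mixedDeriv 0 b φ) := by
  obtain ⟨hs, a, c, ha, hc, h0⟩ := h
  refine ⟨hs.dx_iter b, a, c, ha, hc, fun t x ht => ?_⟩
  have : φ t = fun _ => 0 := by ext y; exact h0 t y ht
  simp [mixedDeriv, this]

lemma IsTest.mixedDeriv_t {φ : ℝ → ℝ → ℝ} (h : IsTest t₀ T L φ) :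
    IsTest t₀ T L (mixedDeriv 1 0 φ) := by
  obtain ⟨hs, a, c, ha, hc, h0⟩ := h
  refine ⟨hs.dt, a, c, ha, hc, fun t x ht => ?_⟩
  rw [mixedDeriv_one_zero]
  have : (fun s => φ s x) =ᶠ[𝓝 t] fun _ => 0 := by
    rcases ht with ht | ht
    · filter_upwards [gt_mem_nhds ht] with s hs' using h0 s x (Or.inl hs')
    · filter_upwards [lt_mem_nhds ht] with s hs' using h0 s x (Or.inr hs')
  rw [this.deriv_eq]; simp

lemma IsCauchyTest.mixedDeriv_x {φ : ℝ → ℝ → ℝ} (h : IsCauchyTest T L φ) (b : ℕ) :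
    IsCauchyTest T L (mixedDeriv 0 b φ) := by
  obtain ⟨hs, c, hc, h0⟩ := h
  refine ⟨hs.dx_iter b, c, hc, fun t x ht => ?_⟩
  have : φ t = fun _ => 0 := by ext y; exact h0 t y ht
  simp [mixedDeriv, this]

lemma IsTest.cauchy {φ : ℝ → ℝ → ℝ} (h : IsTest t₀ T L φ) : IsCauchyTest T L φ := by
  obtain ⟨hs, a, c, ha, hc, h0⟩ := h
  exact ⟨hs, c, hc, fun t x ht => h0 t x (Or.inr ht)⟩

/-- The chain rule for a bounded function with bounded weak space derivative. -/
lemma WeakX.comp (hL : 0 < L) {W Wx : ℝ × ℝ → ℝ} (hW : MemLp W ∞ (strip t₀ T L))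
    (hWx : MemLp Wx ∞ (strip t₀ T L)) (h : WeakX t₀ T L W Wx) {F : ℝ → ℝ}
    (hF : Differentiable ℝ F) (hF' : Continuous (deriv F)) :
    WeakX t₀ T L (fun p => F (W p)) (fun p => deriv F (W p) * Wx p) := by
  intro φ hφ
  obtain ⟨hs, a, b, ha, hb, h0⟩ := hφ
  have hWi := hW.integrable le_top
  have hWxi := hWx.integrable le_top
  obtain ⟨B, hB0, hB⟩ := exists_bound_of_memLp_top hW
  obtain ⟨B', hB0', hB'⟩ := exists_bound_of_memLp_top hWx
  obtain ⟨C, hC⟩ := (isCompact_Icc (a := -(3 * B)) (b := 3 * B)).exists_bound_of_continuousOn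
    hF.continuous.continuousOn
  obtain ⟨C', hC'⟩ := (isCompact_Icc (a := -(3 * B)) (b := 3 * B)).exists_bound_of_continuousOn
    hF'.continuousOn
  have hφi : Integrable (fun p : ℝ × ℝ => φ p.1 p.2) (strip t₀ T L) :=
    (memLp_top_of_continuous hs.continuous).integrable le_top
  have hφxi : Integrable (fun p : ℝ × ℝ => mixedDeriv 0 1 φ p.1 p.2) (strip t₀ T L) :=
    (memLp_top_of_continuous hs.dx.continuous).integrable le_top
  set w : ℕ → ℝ → ℝ → ℝ := fun n => moll hL t₀ T n W with hw
  have hws : ∀ n, IsSmoothPeriodic L (w n) := fun n => moll_smooth hL n hWi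
  have hmem : ∀ n (p : ℝ × ℝ), p.2 ∈ Ioo 0 L → w n p.1 p.2 ∈ Icc (-(3 * B)) (3 * B) :=
    fun n p hp => abs_le.1 (abs_moll_le hL n hB0 hB _ hp)
  have hpart : ∀ n, ∫ p, F (w n p.1 p.2) * mixedDeriv 0 1 φ p.1 p.2 ∂(strip t₀ T L)
      = - ∫ p, deriv F (w n p.1 p.2) * mixedDeriv 0 1 (w n) p.1 p.2 * φ p.1 p.2
        ∂(strip t₀ T L) := by
    intro n
    have c1 : Continuous fun p : ℝ × ℝ => F (w n p.1 p.2) * mixedDeriv 0 1 φ p.1 p.2 :=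
      (hF.continuous.comp (hws n).continuous).mul hs.dx.continuous
    have c2 : Continuous fun p : ℝ × ℝ =>
        deriv F (w n p.1 p.2) * mixedDeriv 0 1 (w n) p.1 p.2 * φ p.1 p.2 :=
      ((hF'.comp (hws n).continuous).mul (hws n).dx.continuous).mul hs.continuous
    have := integral_dx_eq_zero (t₀ := t₀) (T := T) hL (G := fun t x => F (w n t x) * φ t x)
      (G' := fun t x => deriv F (w n t x) * mixedDeriv 0 1 (w n) t x * φ t x
        + F (w n t x) * mixedDeriv 0 1 φ t x)
      (fun t x => by
        rw [(hws n).x_eq, hs.x_eq]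
        exact ((hF _).hasDerivAt.comp x ((hws n).hasDerivAt_x t x)).mul (hs.hasDerivAt_x t x))
      (c2.add c1) (fun t x => by simp only [(hws n).periodic, hs.periodic])
    rw [integral_add ((memLp_top_of_continuous c2).integrable le_top)
      ((memLp_top_of_continuous c1).integrable le_top)] at this
    linarith
  have hlim1 : Tendsto (fun n => ∫ p, F (w n p.1 p.2) * mixedDeriv 0 1 φ p.1 p.2 ∂(strip t₀ T L))
      atTop (𝓝 (∫ p, F (W p) * mixedDeriv 0 1 φ p.1 p.2 ∂(strip t₀ T L))) := by
    refine tendsto_integral_of_dominated_convergence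
      (fun p => C * |mixedDeriv 0 1 φ p.1 p.2|)
      (fun n => ((hF.continuous.comp (hws n).continuous).mul
        hs.dx.continuous).aestronglyMeasurable) (hφxi.abs.const_mul C) (fun n => ?_) ?_
    · filter_upwards [ae_strip_mem] with p hp
      rw [norm_mul]
      exact mul_le_mul_of_nonneg_right (hC _ (hmem n p hp.2)) (abs_nonneg _)
    · filter_upwards [tendsto_moll hL hWi] with p hp
      exact ((hF.continuous.tendsto _).comp hp).mul_const _
  have hlim2 : Tendsto (fun n => ∫ p, deriv F (w n p.1 p.2) * mixedDeriv 0 1 (w n) p.1 p.2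
        * φ p.1 p.2 ∂(strip t₀ T L))
      atTop (𝓝 (∫ p, deriv F (W p) * Wx p * φ p.1 p.2 ∂(strip t₀ T L))) := by
    have : Tendsto (fun n => ∫ p, deriv F (w n p.1 p.2) * moll hL t₀ T n Wx p.1 p.2
        * φ p.1 p.2 ∂(strip t₀ T L))
        atTop (𝓝 (∫ p, deriv F (W p) * Wx p * φ p.1 p.2 ∂(strip t₀ T L))) := by
      refine tendsto_integral_of_dominated_convergence
        (fun p => C' * (3 * B') * |φ p.1 p.2|)
        (fun n => (((hF'.comp (hws n).continuous).mul (moll_smooth hL n hWxi).continuous).mul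
          hs.continuous).aestronglyMeasurable) (hφi.abs.const_mul _) (fun n => ?_) ?_
      · filter_upwards [ae_strip_mem] with p hp
        rw [norm_mul, norm_mul]
        have h1 := hC' _ (hmem n p hp.2)
        exact mul_le_mul_of_nonneg_right (mul_le_mul h1
          (abs_moll_le hL n hB0' hB' _ hp.2) (abs_nonneg _) ((norm_nonneg _).trans h1))
          (abs_nonneg _)
      · filter_upwards [tendsto_moll hL hWi, tendsto_moll hL hWxi] with p hp hp'
        exact (((hF'.tendsto _).comp hp).mul hp').mul_const _
    refine this.congr' ?_
    filter_upwards [eventually_radius L hb] with n hn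
    refine integral_congr_ae ?_
    filter_upwards [ae_strip_mem] with p hp
    rcases le_or_gt p.1 b with h1 | h1
    · rw [moll_dx hL n hWi h p.2 hp.1.1.le (by linarith)]
    · simp [h0 _ p.2 (Or.inr h1)]
  exact tendsto_nhds_unique hlim1 ((hlim2.neg).congr fun n => (hpart n).symm)

/-- A smooth cut-off that vanishes for small times. -/
def rise (n : ℕ) (t : ℝ) : ℝ := Real.smoothTransition (((n : ℝ) + 1) * t - 1)

lemma contDiff_rise (n : ℕ) : ContDiff ℝ ∞ (rise n) :=
  Real.smoothTransition.contDiff.comp ((contDiff_const.mul contDiff_id).sub contDiff_const)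

lemma tendsto_rise {t : ℝ} (ht : 0 < t) : Tendsto (fun n => rise n t) atTop (𝓝 1) := by
  refine tendsto_const_nhds.congr' ?_
  obtain ⟨N, hN⟩ := exists_nat_gt (2 / t)
  filter_upwards [eventually_ge_atTop N] with n hn
  symm
  apply Real.smoothTransition.one_of_one_le
  rw [div_lt_iff₀ ht] at hN
  have : (N : ℝ) ≤ n := by exact_mod_cast hn
  nlinarith

/-- Identities that involve space derivatives of the test function only extend from interior test
functions to test functions which do not vanish at the initial time. -/
lemma integral_cauchy_of_test {W V : ℝ × ℝ → ℝ} (hW : Integrable W (strip 0 T L))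
    (hV : Integrable V (strip 0 T L)) (k : ℕ) (c : ℝ)
    (h : ∀ φ, IsTest 0 T L φ → ∫ p, W p * mixedDeriv 0 k φ p.1 p.2 ∂(strip 0 T L)
      = c * ∫ p, V p * φ p.1 p.2 ∂(strip 0 T L)) {φ : ℝ → ℝ → ℝ} (hφ : IsCauchyTest T L φ) :
    ∫ p, W p * mixedDeriv 0 k φ p.1 p.2 ∂(strip 0 T L)
      = c * ∫ p, V p * φ p.1 p.2 ∂(strip 0 T L) := by
  obtain ⟨hs, b, hb, h0⟩ := hφ
  have hlim : ∀ {A : ℝ × ℝ → ℝ} {ψ : ℝ → ℝ → ℝ}, Integrable A (strip 0 T L) →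
      IsSmoothPeriodic L ψ →
      Tendsto (fun n => ∫ p, A p * (rise n p.1 * ψ p.1 p.2) ∂(strip 0 T L)) atTop
        (𝓝 (∫ p, A p * ψ p.1 p.2 ∂(strip 0 T L))) := by
    intro A ψ hA hψ
    have hi := integrable_mul_top hA (memLp_top_of_continuous (t₀ := 0) (T := T) (L := L)
      hψ.continuous)
    refine tendsto_integral_of_dominated_convergence (fun p => |A p * ψ p.1 p.2|)
      (fun n => hA.aestronglyMeasurable.mul ((((contDiff_rise n).continuous.comp
        continuous_fst).mul hψ.continuous).aestronglyMeasurable)) hi.abs (fun n => ?_) ?_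
    · refine Eventually.of_forall fun p => ?_
      rw [mul_left_comm, norm_mul]
      refine mul_le_of_le_one_left (norm_nonneg _) ?_
      rw [Real.norm_eq_abs, rise, abs_of_nonneg (Real.smoothTransition.nonneg _)]
      exact Real.smoothTransition.le_one _
    · filter_upwards [ae_strip_mem] with p hp
      simpa using ((tendsto_rise hp.1.1).mul_const (ψ p.1 p.2)).const_mul (A p)
  have h1 := hlim hW (hs.dx_iter k)
  have h2 := (hlim hV hs).const_mul c
  refine tendsto_nhds_unique h1 (h2.congr fun n => ?_)
  rw [← h (fun t x => rise n t * φ t x) ?_]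
  · simp only [mixedDeriv_zero_mul_time]
  · refine ⟨hs.mul_time (contDiff_rise n), 1 / ((n : ℝ) + 1), b, by positivity, hb,
      fun t x ht => ?_⟩
    simp only
    rcases ht with ht | ht
    · rw [show rise n t = 0 from Real.smoothTransition.zero_of_nonpos ?_, zero_mul]
      rw [lt_div_iff₀ (by positivity)] at ht
      linarith
    · rw [h0 t x ht, mul_zero]

end

/-! ### Testing with bounded Sobolev functions -/

section

variable {T L : ℝ}

/-- Smooth cut-offs in time that vanish near the final time `T`. -/
def IsTimeCutoff (T : ℝ) (χ : ℝ → ℝ) : Prop :=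
  ContDiff ℝ ∞ χ ∧ ∃ b < T, ∀ t, b < t → χ t = 0

lemma IsTimeCutoff.contDiff_deriv {χ : ℝ → ℝ} (h : IsTimeCutoff T χ) : ContDiff ℝ ∞ (deriv χ) :=
  (contDiff_infty_iff_deriv.1 h.1).2

lemma IsTimeCutoff.memLp {t₀ : ℝ} {χ : ℝ → ℝ} (h : IsTimeCutoff T χ) :
    MemLp (fun p : ℝ × ℝ => χ p.1) ∞ (strip t₀ T L) :=
  memLp_top_of_continuous (h.1.continuous.comp continuous_fst)

lemma IsTimeCutoff.memLp_deriv {t₀ : ℝ} {χ : ℝ → ℝ} (h : IsTimeCutoff T χ) :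
    MemLp (fun p : ℝ × ℝ => deriv χ p.1) ∞ (strip t₀ T L) :=
  memLp_top_of_continuous (h.contDiff_deriv.continuous.comp continuous_fst)

lemma IsTimeCutoff.cauchyTest {χ : ℝ → ℝ} (h : IsTimeCutoff T χ) {w : ℝ → ℝ → ℝ}
    (hw : IsSmoothPeriodic L w) : IsCauchyTest T L (fun t x => χ t * w t x) := by
  obtain ⟨hs, b, hb, h0⟩ := h
  exact ⟨hw.mul_time hs, b, hb, fun t x ht => by simp [h0 t ht]⟩

lemma IsTimeCutoff.cauchyTest_self {χ : ℝ → ℝ} (h : IsTimeCutoff T χ) :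
    IsCauchyTest T L (fun t _ => χ t) := by
  obtain ⟨hs, b, hb, h0⟩ := h
  exact ⟨.of_time hs, b, hb, fun t x ht => h0 t ht⟩

lemma integral_add_four {α : Type*} [MeasurableSpace α] {ν : Measure α} {a b c d : α → ℝ}
    (ha : Integrable a ν) (hb : Integrable b ν) (hc : Integrable c ν) (hd : Integrable d ν) :
    ∫ p, (a p + b p + c p + d p) ∂ν
      = ∫ p, a p ∂ν + ∫ p, b p ∂ν + ∫ p, c p ∂ν + ∫ p, d p ∂ν := by
  have h1 : Integrable (fun p => a p + b p) ν := ha.add hb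
  have h2 : Integrable (fun p => a p + b p + c p) ν := h1.add hc
  rw [integral_add h2 hd, integral_add h1 hc, integral_add ha hb]

/-- A weak identity extends from smooth test functions to `χ W`, where `W` is bounded with bounded
weak first derivatives. No trace of `W` at the initial time is needed, as the identity carries no
initial data. -/
lemma extend_test (hL : 0 < L) {A B C : ℝ × ℝ → ℝ} (hA : Integrable A (strip 0 T L))
    (hB : Integrable B (strip 0 T L)) (hC : Integrable C (strip 0 T L))
    (h : ∀ φ, IsCauchyTest T L φ → ∫ p, (A p * mixedDeriv 1 0 φ p.1 p.2
      + B p * mixedDeriv 0 1 φ p.1 p.2 + C p * φ p.1 p.2) ∂(strip 0 T L) = 0)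
    {W Wt Wx : ℝ × ℝ → ℝ} (hW : MemLp W ∞ (strip 0 T L)) (hWt : MemLp Wt ∞ (strip 0 T L))
    (hWx : MemLp Wx ∞ (strip 0 T L)) (ht : WeakT 0 T L W Wt) (hx : WeakX 0 T L W Wx)
    {χ : ℝ → ℝ} (hχ : IsTimeCutoff T χ) :
    ∫ p, (A p * (deriv χ p.1 * W p + χ p.1 * Wt p) + B p * (χ p.1 * Wx p)
      + C p * (χ p.1 * W p)) ∂(strip 0 T L) = 0 := by
  obtain ⟨b, hb, h0⟩ := hχ.2
  have hWi := hW.integrable le_top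
  have iA' := integrable_mul_top hA (hχ.memLp_deriv (L := L) (t₀ := 0))
  have iA := integrable_mul_top hA (hχ.memLp (L := L) (t₀ := 0))
  have iB := integrable_mul_top hB (hχ.memLp (L := L) (t₀ := 0))
  have iC := integrable_mul_top hC (hχ.memLp (L := L) (t₀ := 0))
  have l1 := tendsto_integral_moll hL iA' hW
  have l2 := tendsto_integral_moll_dt hL iA hb (fun p hp => by simp [h0 _ hp]) hW hWt ht
  have l3 := tendsto_integral_moll_dx hL iB hb (fun p hp => by simp [h0 _ hp]) hW hWx hx
  have l4 := tendsto_integral_moll hL iC hW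
  have key : ∫ p, (A p * (deriv χ p.1 * W p + χ p.1 * Wt p) + B p * (χ p.1 * Wx p)
      + C p * (χ p.1 * W p)) ∂(strip 0 T L)
      = ∫ p, A p * deriv χ p.1 * W p ∂(strip 0 T L) + ∫ p, A p * χ p.1 * Wt p ∂(strip 0 T L)
        + ∫ p, B p * χ p.1 * Wx p ∂(strip 0 T L) + ∫ p, C p * χ p.1 * W p ∂(strip 0 T L) := by
    have j1 := integrable_mul_top iA' hW
    have j2 := integrable_mul_top iA hWt
    have j3 := integrable_mul_top iB hWx
    have j4 := integrable_mul_top iC hW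
    rw [← integral_add_four j1 j2 j3 j4]
    congr 1; ext p; ring
  rw [key]
  refine tendsto_nhds_unique (((l1.add l2).add l3).add l4) (tendsto_const_nhds.congr fun n => ?_)
  have hs := moll_smooth hL n hWi
  have b1 := memLp_top_of_continuous (t₀ := 0) (T := T) (L := L) hs.continuous
  have b2 := memLp_top_of_continuous (t₀ := 0) (T := T) (L := L) hs.dt.continuous
  have b3 := memLp_top_of_continuous (t₀ := 0) (T := T) (L := L) hs.dx.continuous
  have j1 := integrable_mul_top iA' b1
  have j2 := integrable_mul_top iA b2
  have j3 := integrable_mul_top iB b3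
  have j4 := integrable_mul_top iC b1
  rw [← integral_add_four j1 j2 j3 j4]
  refine (h _ (hχ.cauchyTest hs)).symm.trans ?_
  congr 1; ext p
  rw [hs.mul_time_dt hχ.1, mixedDeriv_zero_mul_time]
  ring

lemma strip_eq_add (hT : 0 < T) : strip (-1) T L = strip (-1) 0 L + strip 0 T L := by
  have h1 : (volume.restrict (Ioo (-1) 0) : Measure ℝ) = volume.restrict (Ioc (-1) 0) :=
    Measure.restrict_congr_set Ioo_ae_eq_Ioc
  have h2 : Disjoint (Ioc (-1 : ℝ) 0) (Ioo 0 T) :=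
    Set.disjoint_left.2 fun t h h' => absurd h'.1 (not_lt.2 h.2)
  simp only [strip_eq_prod]
  rw [← Measure.add_prod, h1, ← Measure.restrict_union h2 measurableSet_Ioo,
    Ioc_union_Ioo_eq_Ioo (by norm_num) hT]

/-- Integration by parts in time against functions independent of time. -/
lemma integral_initial_slab {g : ℝ → ℝ} (hg : MemLp g ∞ (period L)) {φ : ℝ → ℝ → ℝ}
    (hφ : IsSmoothPeriodic L φ) :
    ∫ p, g p.2 * mixedDeriv 1 0 φ p.1 p.2 ∂(strip (-1) 0 L)
      = ∫ x, g x * (φ 0 x - φ (-1) x) ∂(period L) := by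
  have hgi : Integrable (fun p : ℝ × ℝ => g p.2) (strip (-1) 0 L) := by
    have : IsFiniteMeasure (period L) := by unfold period; infer_instance
    rw [strip_eq_prod]; exact (hg.integrable le_top).comp_snd _
  have hi := integrable_mul_top hgi (memLp_top_of_continuous (t₀ := -1) (T := 0) (L := L)
    hφ.dt.continuous)
  rw [strip_eq_prod] at hi ⊢
  rw [integral_prod_symm _ hi, period]
  congr 1; ext x
  simp only
  rw [integral_const_mul, ← integral_Ioc_eq_integral_Ioo,
    ← intervalIntegral.integral_of_le (by norm_num),
    intervalIntegral.integral_eq_sub_of_hasDerivAt (f := fun t => φ t x)]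
  · intro t _
    rw [hφ.t_eq]; exact hφ.hasDerivAt_t t x
  · exact (hφ.dt.continuous.comp (by fun_prop : Continuous fun t : ℝ => (t, x))).intervalIntegrable
      _ _

/-- Extension of `V` to negative times by the time-independent function `g`. -/
def extendPast (V : ℝ × ℝ → ℝ) (g : ℝ → ℝ) (p : ℝ × ℝ) : ℝ := if 0 < p.1 then V p else g p.2

lemma extendPast_pos (V : ℝ × ℝ → ℝ) (g : ℝ → ℝ) : ∀ᵐ p ∂(strip 0 T L), extendPast V g p = V p := by
  filter_upwards [ae_strip_mem] with p hp
  simp [extendPast, hp.1.1]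

lemma extendPast_neg (V : ℝ × ℝ → ℝ) (g : ℝ → ℝ) :
    ∀ᵐ p ∂(strip (-1) 0 L), extendPast V g p = g p.2 := by
  filter_upwards [ae_strip_mem] with p hp
  simp [extendPast, not_lt.2 hp.1.2.le]

lemma memLp_extendPast (hT : 0 < T) {V : ℝ × ℝ → ℝ} {g : ℝ → ℝ} (hV : MemLp V ∞ (strip 0 T L))
    (hg : MemLp g ∞ (period L)) : MemLp (extendPast V g) ∞ (strip (-1) T L) := by
  have : IsFiniteMeasure (period L) := by unfold period; infer_instance
  have hg' : MemLp (fun p : ℝ × ℝ => g p.2) ∞ (strip (-1) 0 L) := by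
    rw [strip_eq_prod]; exact hg.comp_snd _
  obtain ⟨B, -, hB⟩ := exists_bound_of_memLp_top hV
  obtain ⟨B', -, hB'⟩ := exists_bound_of_memLp_top hg'
  rw [strip_eq_add hT]
  refine memLp_top_of_bound (AEStronglyMeasurable.add_measure
    (hg'.aestronglyMeasurable.congr ((extendPast_neg V g).mono fun _ h => h.symm))
    (hV.aestronglyMeasurable.congr ((extendPast_pos V g).mono fun _ h => h.symm))) (max B B') ?_
  rw [ae_add_measure_iff]
  constructor
  · filter_upwards [extendPast_neg V g, hB'] with p h1 h2
    rw [h1]; exact h2.trans (le_max_right _ _)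
  · filter_upwards [extendPast_pos V g, hB] with p h1 h2
    rw [h1]; exact h2.trans (le_max_left _ _)

/-- The energy identity for a bounded function `V` with bounded time derivative `Vt` and initial
value `g`. Extending `V` by `g` to negative times turns the initial condition into the weak
differentiability in time of the extension, which can then be mollified. -/
lemma integral_sq_of_trace (hL : 0 < L) (hT : 0 < T) {V Vt : ℝ × ℝ → ℝ} {g : ℝ → ℝ}
    (hV : MemLp V ∞ (strip 0 T L)) (hVt : MemLp Vt ∞ (strip 0 T L)) (hg : MemLp g ∞ (period L))
    (htr : ∀ φ, IsCauchyTest T L φ → ∫ p, (V p * mixedDeriv 1 0 φ p.1 p.2 + Vt p * φ p.1 p.2)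
      ∂(strip 0 T L) + ∫ x, g x * φ 0 x ∂(period L) = 0) {χ : ℝ → ℝ} (hχ : IsTimeCutoff T χ) :
    ∫ p, (V p ^ 2 * deriv χ p.1 + 2 * (V p * Vt p) * χ p.1) ∂(strip 0 T L)
      + χ 0 * ∫ x, g x ^ 2 ∂(period L) = 0 := by
  set U := extendPast V g with hU
  set Ut := extendPast Vt 0 with hUt
  have mU : MemLp U ∞ (strip (-1) T L) := memLp_extendPast hT hV hg
  have mUt : MemLp Ut ∞ (strip (-1) T L) := memLp_extendPast hT hVt MemLp.zero
  -- integrals over the extended strip split at the initial time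
  have hsplit : ∀ F : ℝ × ℝ → ℝ, Integrable F (strip (-1) T L) →
      ∫ p, F p ∂(strip (-1) T L) = ∫ p, F p ∂(strip (-1) 0 L) + ∫ p, F p ∂(strip 0 T L) := by
    intro F hF
    rw [strip_eq_add hT] at hF ⊢
    exact integral_add_measure hF.left_of_add_measure hF.right_of_add_measure
  have hweak : WeakT (-1) T L U Ut := by
    intro φ hφ
    have c1 := memLp_top_of_continuous (t₀ := -1) (T := T) (L := L) hφ.1.continuous
    have c2 := memLp_top_of_continuous (t₀ := -1) (T := T) (L := L) hφ.1.dt.continuous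
    have d1 := memLp_top_of_continuous (t₀ := 0) (T := T) (L := L) hφ.1.continuous
    have d2 := memLp_top_of_continuous (t₀ := 0) (T := T) (L := L) hφ.1.dt.continuous
    rw [hsplit _ (integrable_mul_top (mU.integrable le_top) c2),
      hsplit _ (integrable_mul_top (mUt.integrable le_top) c1)]
    have e1 : ∫ p, U p * mixedDeriv 1 0 φ p.1 p.2 ∂(strip (-1) 0 L)
        = ∫ x, g x * φ 0 x ∂(period L) := by
      have h1 : φ (-1) = fun _ => 0 := by
        obtain ⟨-, a, b, ha, hb, h0⟩ := hφ
        ext x; exact h0 _ _ (Or.inl ha)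
      calc ∫ p, U p * mixedDeriv 1 0 φ p.1 p.2 ∂(strip (-1) 0 L)
          = ∫ p, g p.2 * mixedDeriv 1 0 φ p.1 p.2 ∂(strip (-1) 0 L) :=
            integral_congr_ae ((extendPast_neg V g).mono fun p h => by simp only [hU, h])
        _ = _ := by rw [integral_initial_slab hg hφ.1]; simp [h1]
    have e2 : ∫ p, Ut p * φ p.1 p.2 ∂(strip (-1) 0 L) = 0 := by
      rw [integral_congr_ae (g := fun _ => (0 : ℝ))
        ((extendPast_neg Vt 0).mono fun p h => by simp [hUt, h])]
      simp
    have e3 : ∫ p, U p * mixedDeriv 1 0 φ p.1 p.2 ∂(strip 0 T L)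
        = ∫ p, V p * mixedDeriv 1 0 φ p.1 p.2 ∂(strip 0 T L) :=
      integral_congr_ae ((extendPast_pos V g).mono fun p h => by simp only [hU, h])
    have e4 : ∫ p, Ut p * φ p.1 p.2 ∂(strip 0 T L) = ∫ p, Vt p * φ p.1 p.2 ∂(strip 0 T L) :=
      integral_congr_ae ((extendPast_pos Vt 0).mono fun p h => by simp only [hUt, h])
    have := htr φ hφ.cauchy
    rw [integral_add (integrable_mul_top (hV.integrable le_top) d2)
      (integrable_mul_top (hVt.integrable le_top) d1)] at this
    rw [e1, e2, e3, e4]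
    linarith
  -- the cut-off is switched off before time `-1`
  set ψ : ℝ → ℝ := fun t => χ t * Real.smoothTransition (4 * t + 3) with hψ
  have hψs : ContDiff ℝ ∞ ψ := hχ.1.mul (Real.smoothTransition.contDiff.comp
    ((contDiff_const.mul contDiff_id).add contDiff_const))
  have hψχ : ∀ t, -1 / 2 < t → ψ t = χ t := fun t ht => by
    simp only [hψ]; rw [Real.smoothTransition.one_of_one_le (by linarith), mul_one]
  have hψ0 : ∀ t, t < -3 / 4 → ψ t = 0 := fun t ht => by
    simp only [hψ]; rw [Real.smoothTransition.zero_of_nonpos (by linarith), mul_zero]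
  have hψχ' : ∀ t, 0 < t → deriv ψ t = deriv χ t := fun t ht => by
    apply Filter.EventuallyEq.deriv_eq
    filter_upwards [lt_mem_nhds (show -1 / 2 < t by linarith)] with s hs using hψχ s hs
  have hψc : IsTimeCutoff T ψ := by
    obtain ⟨b, hb, h0⟩ := hχ.2
    exact ⟨hψs, b, hb, fun t ht => by simp [hψ, h0 t ht]⟩
  have mψ := hψc.memLp (L := L) (t₀ := -1)
  have mψ' := hψc.memLp_deriv (L := L) (t₀ := -1)
  have iU := mU.integrable le_top
  have iUt := mUt.integrable le_top
  have key : ∫ p, (U p ^ 2 * deriv ψ p.1 + 2 * (U p * Ut p) * ψ p.1) ∂(strip (-1) T L) = 0 := by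
    obtain ⟨b, hb, h0⟩ := hψc.2
    have l1 := tendsto_integral_moll hL (integrable_mul_top iU mψ') mU
    have l2 := tendsto_integral_moll_dt hL (integrable_mul_top iU mψ) hb
      (fun p hp => by simp [h0 _ hp]) mU mUt hweak
    have l3 := tendsto_integral_moll hL (integrable_mul_top iUt mψ) mU
    have j1 := integrable_mul_top (integrable_mul_top iU mψ') mU
    have j2 := integrable_mul_top (integrable_mul_top iU mψ) mUt
    have j3 := integrable_mul_top (integrable_mul_top iUt mψ) mU
    have j4 : Integrable (fun _ : ℝ × ℝ => (0 : ℝ)) (strip (-1) T L) := integrable_zero _ _ _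
    have hz : ∫ p, (0 : ℝ) ∂(strip (-1) T L) = 0 := by simp
    have e : ∫ p, (U p ^ 2 * deriv ψ p.1 + 2 * (U p * Ut p) * ψ p.1) ∂(strip (-1) T L)
        = ∫ p, U p * deriv ψ p.1 * U p ∂(strip (-1) T L)
          + ∫ p, U p * ψ p.1 * Ut p ∂(strip (-1) T L)
          + ∫ p, Ut p * ψ p.1 * U p ∂(strip (-1) T L) + ∫ p, (0 : ℝ) ∂(strip (-1) T L) := by
      rw [← integral_add_four j1 j2 j3 j4]
      congr 1; ext p; ring
    rw [e, hz, add_zero]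
    refine tendsto_nhds_unique ((l1.add l2).add l3) (tendsto_const_nhds.congr fun n => ?_)
    have hs := moll_smooth hL n iU
    have ht : IsTest (-1) T L (fun t x => ψ t * moll hL (-1) T n U t x) :=
      ⟨hs.mul_time hψs, -3 / 4, b, by norm_num, hb, fun t x ht => by
        rcases ht with ht | ht
        · simp [hψ0 t ht]
        · simp [h0 t ht]⟩
    have b1 := memLp_top_of_continuous (t₀ := -1) (T := T) (L := L) hs.continuous
    have b2 := memLp_top_of_continuous (t₀ := -1) (T := T) (L := L) hs.dt.continuous
    have hw := hweak _ ht
    rw [eq_neg_iff_add_eq_zero] at hw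
    have k1 := integrable_mul_top (integrable_mul_top iU mψ') b1
    have k2 := integrable_mul_top (integrable_mul_top iU mψ) b2
    rw [← integral_add k1 k2]
    refine hw.symm.trans ?_
    congr 1
    · congr 1; ext p; rw [hs.mul_time_dt hψs]; ring
    · congr 1; ext p; ring
  rw [hsplit] at key
  · rw [add_comm]
    refine Eq.trans ?_ key
    congr 1
    · have h1 : ∫ p, (U p ^ 2 * deriv ψ p.1 + 2 * (U p * Ut p) * ψ p.1) ∂(strip (-1) 0 L)
          = ∫ p, g p.2 ^ 2 * mixedDeriv 1 0 (fun t _ => ψ t) p.1 p.2 ∂(strip (-1) 0 L) := by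
        refine integral_congr_ae ?_
        filter_upwards [extendPast_neg V g, extendPast_neg Vt 0] with p h1 h2
        rw [hU, hUt, h1, h2, mixedDeriv_of_time_t]; simp
      have hg2 : MemLp (fun x => g x ^ 2) ∞ (period L) := by
        simpa only [sq] using memLp_top_mul hg hg
      rw [h1, integral_initial_slab hg2 (.of_time hψs), hψχ 0 (by norm_num),
        hψ0 (-1) (by norm_num), sub_zero, integral_mul_const, mul_comm]
    · refine integral_congr_ae ?_
      filter_upwards [extendPast_pos V g, extendPast_pos Vt 0, ae_strip_mem] with p h1 h2 h3
      rw [hU, hUt, h1, h2, hψχ' _ h3.1.1, hψχ _ (by linarith [h3.1.1])]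
  · have j1 := integrable_mul_top (integrable_mul_top iU mψ') mU
    have j2 := integrable_mul_top (integrable_mul_top iU mψ) mUt
    refine (j1.add (j2.const_mul 2)).congr (Eventually.of_forall fun p => ?_)
    simp only [Pi.add_apply]; ring

end

/-! ### Algebraic identities for the source and flux -/

section

variable {T L : ℝ} {m : ℕ} {σ μ τ : ℝ} {f : ℝ → ℝ}

lemma source_add (v w : ℕ → ℝ) (j : ℕ) :
    source m σ μ (fun i => v i + w i) j = source m σ μ v j + source m σ μ w j := by
  unfold source; split_ifs <;> ring

lemma source_sub (v w : ℕ → ℝ) (j : ℕ) :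
    source m σ μ (fun i => v i - w i) j = source m σ μ v j - source m σ μ w j := by
  unfold source; split_ifs <;> ring

/-- The source terms dissipate energy: as `m` is odd, the dispersive terms cancel in pairs. -/
lemma energyProduction_nonpos (hm : Odd m) (hμ : 0 ≤ μ) (v : ℕ → ℝ) :
    energyProduction m σ μ v ≤ 0 := by
  obtain ⟨k, rfl⟩ := hm
  unfold energyProduction
  rw [Finset.sum_range_succ']
  have h0 : v 0 * source (2 * k + 1) σ μ v 0 = 0 := by simp [source]
  rw [h0, add_zero]
  have e : ∀ j ∈ Finset.range (2 * k), v (j + 1) * source (2 * k + 1) σ μ v (j + 1)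
      = σ * (-1) ^ (j + 1) * v (j + 1) * v (2 * k - j)
        - (if j = 0 then μ * v 1 ^ 2 else 0) := by
    intro j hj
    have : 2 * k + 1 - (j + 1) = 2 * k - j := by omega
    unfold source
    rw [if_neg (Nat.succ_ne_zero j), this]
    rcases Nat.eq_zero_or_pos j with rfl | hpos
    · simp; ring
    · rw [if_neg (by omega), if_neg (by omega)]; ring
  rw [Finset.sum_congr rfl e, Finset.sum_sub_distrib]
  have hS : ∑ j ∈ Finset.range (2 * k), σ * (-1) ^ (j + 1) * v (j + 1) * v (2 * k - j) = 0 := by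
    have hr := Finset.sum_range_reflect
      (fun j => σ * (-1) ^ (j + 1) * v (j + 1) * v (2 * k - j)) (2 * k)
    have : ∑ j ∈ Finset.range (2 * k),
        (fun j => σ * (-1) ^ (j + 1) * v (j + 1) * v (2 * k - j)) (2 * k - 1 - j)
        = - ∑ j ∈ Finset.range (2 * k), σ * (-1) ^ (j + 1) * v (j + 1) * v (2 * k - j) := by
      rw [← Finset.sum_neg_distrib]
      refine Finset.sum_congr rfl fun j hj => ?_
      rw [Finset.mem_range] at hj
      simp only
      rw [show 2 * k - 1 - j + 1 = 2 * k - j by omega, show 2 * k - (2 * k - 1 - j) = j + 1 by omega]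
      have hs : (-1 : ℝ) ^ (2 * k - j) = - (-1) ^ (j + 1) := by
        have h1 : (-1 : ℝ) ^ (2 * k - j) * (-1) ^ j = 1 := by
          rw [← pow_add, show 2 * k - j + j = 2 * k by omega]; simp
        have h2 : (-1 : ℝ) ^ j * (-1) ^ j = 1 := by rw [← pow_add, ← two_mul]; simp
        have h3 : (-1 : ℝ) ^ (2 * k - j) = (-1) ^ j := by
          calc (-1 : ℝ) ^ (2 * k - j) = (-1) ^ (2 * k - j) * ((-1) ^ j * (-1) ^ j) := by
                rw [h2, mul_one]
            _ = (-1) ^ j := by rw [← mul_assoc, h1, one_mul]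
        rw [h3, pow_succ]; ring
      rw [hs]; ring
    linarith
  rw [hS, zero_sub]
  have : 0 ≤ ∑ j ∈ Finset.range (2 * k), (if j = 0 then μ * v 1 ^ 2 else 0) :=
    Finset.sum_nonneg fun j _ => by split_ifs <;> positivity
  linarith

/-- The linear part of the flux is symmetric, as `m - 1` is even. -/
lemma sum_flux_symm (hm : Odd m) (v w : ℕ → ℝ) :
    ∑ j ∈ Finset.range m, σ * (-1) ^ j * (v j * w (m - 1 - j))
      = ∑ j ∈ Finset.range m, σ * (-1) ^ j * (v (m - 1 - j) * w j) := by
  obtain ⟨k, rfl⟩ := hm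
  rw [← Finset.sum_range_reflect]
  refine Finset.sum_congr rfl fun j hj => ?_
  rw [Finset.mem_range] at hj
  rw [show 2 * k + 1 - 1 - (2 * k + 1 - 1 - j) = j by omega]
  have hs : (-1 : ℝ) ^ (2 * k + 1 - 1 - j) = (-1) ^ j := by
    have h1 : (-1 : ℝ) ^ (2 * k - j) * (-1) ^ j = 1 := by
      rw [← pow_add, show 2 * k - j + j = 2 * k by omega]; simp
    have h2 : (-1 : ℝ) ^ j * (-1) ^ j = 1 := by rw [← pow_add, ← two_mul]; simp
    calc (-1 : ℝ) ^ (2 * k - j) = (-1) ^ (2 * k - j) * ((-1) ^ j * (-1) ^ j) := by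
          rw [h2, mul_one]
      _ = (-1) ^ j := by rw [← mul_assoc, h1, one_mul]
  rw [hs]

/-- The residual `τ ∂_t v_j` (`j ≥ 1`) of the limit equation in the hyperbolic system. -/
def residual (τ : ℝ) (vt : ℕ → ℝ) (j : ℕ) : ℝ := if j = 0 then 0 else τ * vt j

/-- Pointwise form of the relative energy computation. Here `v` is the reference state with
derivatives `vt`, `vx`, `e` is the error, `n` and `d` stand for `f(v₀ + e₀) - f(v₀)` and `f'(v₀)`,
and `a`, `b` for the derivative and the value of the cut-off. -/
lemma relative_energy_identity (hm : Odd m) {v e vt vx : ℕ → ℝ} {n d a b : ℝ}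
    (hrel : ∀ j < m, timeCoeff τ j * vt j + ((if j = 0 then d * vx 0 else 0)
      + σ * (-1) ^ j * vx (m - 1 - j)) = source m σ μ v j + residual τ vt j) :
    energy m τ (fun j => v j + e j) * a + energyProduction m σ μ (fun j => v j + e j) * b
      - ∑ j ∈ Finset.range m, (timeCoeff τ j * e j * (a * v j + b * vt j)
        + ((if j = 0 then n else 0) + σ * (-1) ^ j * e (m - 1 - j)) * (b * vx j)
        + (source m σ μ e j - residual τ vt j) * (b * v j))
      - ∑ j ∈ Finset.range m, timeCoeff τ j / 2 * (v j ^ 2 * a + 2 * (v j * vt j) * b)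
    = energy m τ e * a + b * (energyProduction m σ μ e
        - ∑ j ∈ Finset.range m, residual τ vt j * e j - (n - d * e 0) * vx 0)
      + b * ∑ j ∈ Finset.range m, σ * (-1) ^ j * (v j * vx (m - 1 - j))
      + b * (v 0 * d * vx 0) := by
  have hm0 : 0 < m := hm.pos
  have hδ : ∀ c : ℝ, ∑ j ∈ Finset.range m, (if j = 0 then c else 0) = c := fun c => by
    rw [Finset.sum_ite_eq' (Finset.range m) 0 (fun _ => c), if_pos (Finset.mem_range.2 hm0)]
  have hsym := sum_flux_symm (σ := σ) hm e vx
  have e1 : (n - d * e 0) * vx 0 = ∑ j ∈ Finset.range m,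
      (if j = 0 then (n - d * e 0) * vx 0 else 0) := (hδ _).symm
  have e2 : v 0 * d * vx 0 = ∑ j ∈ Finset.range m, (if j = 0 then v 0 * d * vx 0 else 0) :=
    (hδ _).symm
  have hz : b * (∑ j ∈ Finset.range m, σ * (-1) ^ j * (e j * vx (m - 1 - j))
      - ∑ j ∈ Finset.range m, σ * (-1) ^ j * (e (m - 1 - j) * vx j)) = 0 := by
    rw [hsym, sub_self, mul_zero]
  refine Eq.trans ?_ ((congrArg (fun z => _ + z) hz).trans (add_zero _))
  rw [e1, e2]
  unfold energy energyProduction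
  simp only [Finset.sum_mul, Finset.mul_sum, mul_sub, ← Finset.sum_sub_distrib,
    ← Finset.sum_add_distrib]
  refine Finset.sum_congr rfl fun j hj => ?_
  have h := hrel j (Finset.mem_range.1 hj)
  rw [source_add]
  by_cases h0 : j = 0
  · subst h0
    simp only [if_true] at h ⊢
    linear_combination (-(b * (v 0 + e 0))) * h
  · simp only [if_neg h0] at h ⊢
    linear_combination (-(b * (v j + e j))) * h

end

/-! ### The error equations -/

section

variable {T L : ℝ} {m : ℕ} {σ μ τ : ℝ} {f : ℝ → ℝ} {V Vt Vx : ℕ → ℝ × ℝ → ℝ}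
  {g : ℕ → ℝ → ℝ} {q : ℕ → ℝ → ℝ → ℝ}

/-- A bounded reference state `V` with bounded derivatives `Vt`, `Vx` and initial data `g`, which
satisfies the first equation of the hyperbolic system and, up to the terms `τ ∂_t V_j`, the other
ones. -/
structure IsReference (T L : ℝ) (m : ℕ) (σ μ : ℝ) (f : ℝ → ℝ) (V Vt Vx : ℕ → ℝ × ℝ → ℝ)
    (g : ℕ → ℝ → ℝ) : Prop where
  memLp : ∀ j < m, MemLp (V j) ∞ (strip 0 T L)
  memLp_t : ∀ j < m, MemLp (Vt j) ∞ (strip 0 T L)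
  memLp_x : ∀ j < m, MemLp (Vx j) ∞ (strip 0 T L)
  memLp_init : ∀ j < m, MemLp (g j) ∞ (period L)
  weak_x : ∀ j < m, WeakX 0 T L (V j) (Vx j)
  trace : ∀ j < m, ∀ φ, IsCauchyTest T L φ →
    ∫ p, (V j p * mixedDeriv 1 0 φ p.1 p.2 + Vt j p * φ p.1 p.2) ∂(strip 0 T L)
      + ∫ x, g j x * φ 0 x ∂(period L) = 0
  conservation : ∀ᵐ p ∂(strip 0 T L), Vt 0 p + deriv f (V 0 p) * Vx 0 p + σ * Vx (m - 1) p = 0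
  constraint : ∀ j, 1 ≤ j → j < m → ∀ p,
    σ * (-1) ^ j * Vx (m - 1 - j) p = source m σ μ (fun i => V i p) j

/-- The difference between a solution of the hyperbolic system and the reference state. -/
def err (q : ℕ → ℝ → ℝ → ℝ) (V : ℕ → ℝ × ℝ → ℝ) (j : ℕ) (p : ℝ × ℝ) : ℝ := q j p.1 p.2 - V j p

/-- The difference of the fluxes. -/
def errFlux (m : ℕ) (σ : ℝ) (f : ℝ → ℝ) (q : ℕ → ℝ → ℝ → ℝ) (V : ℕ → ℝ × ℝ → ℝ) (j : ℕ)
    (p : ℝ × ℝ) : ℝ :=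
  (if j = 0 then f (q 0 p.1 p.2) - f (V 0 p) else 0) + σ * (-1) ^ j * err q V (m - 1 - j) p

lemma memLp_source {α : Type*} [MeasurableSpace α] {ν : Measure α} {r : ℝ≥0∞} {v : ℕ → α → ℝ}
    (h : ∀ j < m, MemLp (v j) r ν) {j : ℕ} (hj : j < m) :
    MemLp (fun p => source m σ μ (fun i => v i p) j) r ν := by
  unfold source
  by_cases h0 : j = 0
  · simp [h0]
  · simp only [if_neg h0]
    refine ((h (m - j) (by omega)).const_mul _).sub ?_
    by_cases h1 : j = 1
    · simp only [if_pos h1]; exact (h 1 (by omega)).const_mul _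
    · simp [h1]

lemma integrable_source {α : Type*} [MeasurableSpace α] {ν : Measure α} {v : ℕ → α → ℝ}
    (h : ∀ j < m, Integrable (v j) ν) {j : ℕ} (hj : j < m) :
    Integrable (fun p => source m σ μ (fun i => v i p) j) ν :=
  memLp_one_iff_integrable.1 (memLp_source (fun i hi => memLp_one_iff_integrable.2 (h i hi)) hj)

lemma integrable_comp_of_quadratic {α : Type*} [MeasurableSpace α] {ν : Measure α}
    [IsFiniteMeasure ν] {M : ℝ} (hf : Continuous f)
    (hM : ∀ x y, |f y - f x - deriv f x * (y - x)| ≤ M * (y - x) ^ 2) {v : α → ℝ}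
    (hv : MemLp v 2 ν) : Integrable (fun p => f (v p)) ν := by
  have h1 : Integrable v ν := hv.integrable (by norm_num)
  have h2 : Integrable (fun p => v p ^ 2) ν := hv.integrable_sq
  refine (((integrable_const |f 0|).add (h1.abs.const_mul |deriv f 0|)).add
    (h2.const_mul M)).mono' (hf.comp_aestronglyMeasurable hv.1) (Eventually.of_forall fun p => ?_)
  have h := hM 0 (v p)
  rw [sub_zero] at h
  simp only [Pi.add_apply, Real.norm_eq_abs]
  have e : f (v p) = f 0 + deriv f 0 * v p + (f (v p) - f 0 - deriv f 0 * v p) := by ring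
  rw [e, ← abs_mul]
  exact (abs_add_three _ _ _).trans (by linarith)

lemma WeakX.add {t₀ : ℝ} {W Wx U Ux : ℝ × ℝ → ℝ} (h : WeakX t₀ T L W Wx) (h' : WeakX t₀ T L U Ux)
    (hW : Integrable W (strip t₀ T L)) (hWx : Integrable Wx (strip t₀ T L))
    (hU : Integrable U (strip t₀ T L)) (hUx : Integrable Ux (strip t₀ T L)) :
    WeakX t₀ T L (fun p => W p + U p) (fun p => Wx p + Ux p) := by
  intro φ hφ
  have c1 := memLp_top_of_continuous (t₀ := t₀) (T := T) (L := L) hφ.1.continuous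
  have c2 := memLp_top_of_continuous (t₀ := t₀) (T := T) (L := L) hφ.1.dx.continuous
  simp only [add_mul]
  rw [integral_add (integrable_mul_top hW c2) (integrable_mul_top hU c2),
    integral_add (integrable_mul_top hWx c1) (integrable_mul_top hUx c1), h φ hφ, h' φ hφ]
  ring

lemma WeakX.const_mul {t₀ : ℝ} {W Wx : ℝ × ℝ → ℝ} (h : WeakX t₀ T L W Wx) (c : ℝ) :
    WeakX t₀ T L (fun p => c * W p) (fun p => c * Wx p) := by
  intro φ hφ
  simp only [mul_assoc, integral_const_mul, h φ hφ]
  ring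

lemma WeakX.cauchy {W Wx : ℝ × ℝ → ℝ} (h : WeakX 0 T L W Wx) (hW : Integrable W (strip 0 T L))
    (hWx : Integrable Wx (strip 0 T L)) {φ : ℝ → ℝ → ℝ} (hφ : IsCauchyTest T L φ) :
    ∫ p, W p * mixedDeriv 0 1 φ p.1 p.2 ∂(strip 0 T L)
      = - ∫ p, Wx p * φ p.1 p.2 ∂(strip 0 T L) := by
  have := integral_cauchy_of_test hW hWx 1 (-1) (fun φ hφ => by rw [h φ hφ]; ring) hφ
  rw [this]; ring

lemma WeakX.comp_memLp {F : ℝ → ℝ} (hF : Continuous F) {t₀ : ℝ} {W : ℝ × ℝ → ℝ}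
    (hW : MemLp W ∞ (strip t₀ T L)) : MemLp (fun p => F (W p)) ∞ (strip t₀ T L) := by
  obtain ⟨B, hB0, hB⟩ := exists_bound_of_memLp_top hW
  obtain ⟨C, hC⟩ := (isCompact_Icc (a := -B) (b := B)).exists_bound_of_continuousOn hF.continuousOn
  refine memLp_top_of_bound (hF.comp_aestronglyMeasurable hW.1) C ?_
  filter_upwards [hB] with p hp using hC _ (abs_le.1 hp)

lemma memLp_solution (hq : IsEntropySolution T L m σ μ τ f g q) {j : ℕ} (hj : j < m) :
    MemLp (fun p : ℝ × ℝ => q j p.1 p.2) 2 (strip 0 T L) :=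
  hq.memLp j hj

namespace IsReference

lemma weak_t (hV : IsReference T L m σ μ f V Vt Vx g) {j : ℕ} (hj : j < m) :
    WeakT 0 T L (V j) (Vt j) := by
  intro φ hφ
  have h := hV.trace j hj φ hφ.cauchy
  have c1 := memLp_top_of_continuous (t₀ := 0) (T := T) (L := L) hφ.1.continuous
  have c2 := memLp_top_of_continuous (t₀ := 0) (T := T) (L := L) hφ.1.dt.continuous
  have h0 : φ 0 = fun _ => 0 := by
    obtain ⟨-, a, b, ha, hb, h0⟩ := hφ
    ext x; exact h0 _ _ (Or.inl ha)
  rw [integral_add (integrable_mul_top ((hV.memLp j hj).integrable le_top) c2)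
    (integrable_mul_top ((hV.memLp_t j hj).integrable le_top) c1)] at h
  simp only [h0, mul_zero, integral_zero, add_zero] at h
  linarith

/-- The reference state satisfies the hyperbolic system up to the residual. -/
lemma system (hV : IsReference T L m σ μ f V Vt Vx g) :
    ∀ᵐ p ∂(strip 0 T L), ∀ j < m, timeCoeff τ j * Vt j p
      + ((if j = 0 then deriv f (V 0 p) * Vx 0 p else 0) + σ * (-1) ^ j * Vx (m - 1 - j) p)
      = source m σ μ (fun i => V i p) j + residual τ (fun i => Vt i p) j := by
  filter_upwards [hV.conservation] with p hp j hj
  by_cases h0 : j = 0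
  · subst h0
    simp only [timeCoeff, residual, source, if_true, Nat.sub_zero]
    linarith
  · rw [if_neg h0, hV.constraint j (Nat.one_le_iff_ne_zero.2 h0) hj p]
    simp only [timeCoeff, residual, if_neg h0]
    ring

lemma memLp_err (hV : IsReference T L m σ μ f V Vt Vx g)
    (hq : IsEntropySolution T L m σ μ τ f g q) {j : ℕ} (hj : j < m) :
    MemLp (err q V j) 2 (strip 0 T L) :=
  (memLp_solution hq hj).sub ((hV.memLp j hj).mono_exponent le_top)

lemma integrable_err (hV : IsReference T L m σ μ f V Vt Vx g)
    (hq : IsEntropySolution T L m σ μ τ f g q) {j : ℕ} (hj : j < m) :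
    Integrable (err q V j) (strip 0 T L) :=
  (hV.memLp_err hq hj).integrable (by norm_num)

lemma integrable_errFlux (hV : IsReference T L m σ μ f V Vt Vx g) (hf : IsAdmissibleFlux f)
    (hq : IsEntropySolution T L m σ μ τ f g q) {j : ℕ} (hj : j < m) :
    Integrable (errFlux m σ f q V j) (strip 0 T L) := by
  obtain ⟨M, hM0, hfd, -, hM⟩ := hf.exists_lipschitz
  refine Integrable.add ?_ ((hV.integrable_err hq (by omega)).const_mul _)
  by_cases h0 : j = 0
  · simp only [if_pos h0]
    exact (integrable_comp_of_quadratic hfd.continuous hM (memLp_solution hq (by omega))).sub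
      ((WeakX.comp_memLp hfd.continuous (hV.memLp 0 (by omega))).integrable le_top)
  · simp [h0]

lemma integrable_residual (hV : IsReference T L m σ μ f V Vt Vx g) {j : ℕ} (hj : j < m) :
    Integrable (fun p => residual τ (fun i => Vt i p) j) (strip 0 T L) := by
  unfold residual
  by_cases h0 : j = 0
  · simp [h0]
  · simp only [if_neg h0]; exact ((hV.memLp_t j hj).integrable le_top).const_mul _

/-- The error satisfies a linearized system with the residual as right-hand side and with zero
initial data. -/
lemma err_equation (hV : IsReference T L m σ μ f V Vt Vx g) (hL : 0 < L) (hf : IsAdmissibleFlux f)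
    (hq : IsEntropySolution T L m σ μ τ f g q) {j : ℕ} (hj : j < m) {φ : ℝ → ℝ → ℝ}
    (hφ : IsCauchyTest T L φ) :
    ∫ p, (timeCoeff τ j * err q V j p * mixedDeriv 1 0 φ p.1 p.2
      + errFlux m σ f q V j p * mixedDeriv 0 1 φ p.1 p.2
      + (source m σ μ (fun i => err q V i p) j - residual τ (fun i => Vt i p) j) * φ p.1 p.2)
      ∂(strip 0 T L) = 0 := by
  obtain ⟨M, hM0, hfd, hfc, hM⟩ := hf.exists_lipschitz
  have h0m : 0 < m := by omega
  have c0 := memLp_top_of_continuous (t₀ := 0) (T := T) (L := L) hφ.1.continuous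
  have c1 := memLp_top_of_continuous (t₀ := 0) (T := T) (L := L) hφ.1.dt.continuous
  have c2 := memLp_top_of_continuous (t₀ := 0) (T := T) (L := L) hφ.1.dx.continuous
  -- the flux of the reference state and its space derivative
  set Φ : ℝ × ℝ → ℝ := fun p => (if j = 0 then f (V 0 p) else 0)
    + σ * (-1) ^ j * V (m - 1 - j) p with hΦ
  set Φx : ℝ × ℝ → ℝ := fun p => (if j = 0 then deriv f (V 0 p) * Vx 0 p else 0)
    + σ * (-1) ^ j * Vx (m - 1 - j) p with hΦx
  have iV : ∀ i < m, Integrable (V i) (strip 0 T L) := fun i hi => (hV.memLp i hi).integrable le_top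
  have iVx : ∀ i < m, Integrable (Vx i) (strip 0 T L) :=
    fun i hi => (hV.memLp_x i hi).integrable le_top
  have iVt : ∀ i < m, Integrable (Vt i) (strip 0 T L) :=
    fun i hi => (hV.memLp_t i hi).integrable le_top
  have iq : ∀ i < m, Integrable (fun p : ℝ × ℝ => q i p.1 p.2) (strip 0 T L) :=
    fun i hi => (memLp_solution hq hi).integrable (by norm_num)
  have hlast : m - 1 - j < m := by omega
  have wlin := (hV.weak_x (m - 1 - j) hlast).const_mul (σ * (-1) ^ j)
  have hΦi : Integrable Φ (strip 0 T L) ∧ Integrable Φx (strip 0 T L) ∧ WeakX 0 T L Φ Φx := by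
    by_cases h0 : j = 0
    · have k1 := (WeakX.comp_memLp hfd.continuous (hV.memLp 0 h0m)).integrable le_top
      have k2 := (memLp_top_mul (WeakX.comp_memLp hfc (hV.memLp 0 h0m))
        (hV.memLp_x 0 h0m)).integrable le_top
      simp only [hΦ, hΦx, if_pos h0]
      exact ⟨k1.add ((iV _ hlast).const_mul _), k2.add ((iVx _ hlast).const_mul _),
        (WeakX.comp hL (hV.memLp 0 h0m) (hV.memLp_x 0 h0m) (hV.weak_x 0 h0m) hfd hfc).add wlin
          k1 k2 ((iV _ hlast).const_mul _) ((iVx _ hlast).const_mul _)⟩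
    · simp only [hΦ, hΦx, if_neg h0, zero_add]
      exact ⟨(iV _ hlast).const_mul _, (iVx _ hlast).const_mul _, wlin⟩
  have hx := hΦi.2.2.cauchy hΦi.1 hΦi.2.1 hφ
  have ht := hV.trace j hj φ hφ
  have he := hq.equation j hj φ hφ
  have iflux : Integrable (fun p => flux m σ f (values q p) j) (strip 0 T L) := by
    unfold flux values
    refine Integrable.add ?_ ((iq (m - 1 - j) hlast).const_mul _)
    by_cases h0 : j = 0
    · simp only [if_pos h0]
      exact integrable_comp_of_quadratic hfd.continuous hM (memLp_solution hq h0m)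
    · simp [h0]
  have isrc : Integrable (fun p => source m σ μ (values q p) j) (strip 0 T L) :=
    integrable_source iq hj
  have j1 := integrable_mul_top ((iq j hj).const_mul (timeCoeff τ j)) c1
  have j2 := integrable_mul_top iflux c2
  have j3 := integrable_mul_top isrc c0
  have k1 := integrable_mul_top (iV j hj) c1
  have k2 := integrable_mul_top (iVt j hj) c0
  have k3 := integrable_mul_top hΦi.1 c2
  have k4 := integrable_mul_top hΦi.2.1 c0
  have hsum : ∫ p, (timeCoeff τ j * q j p.1 p.2 * mixedDeriv 1 0 φ p.1 p.2
        + flux m σ f (values q p) j * mixedDeriv 0 1 φ p.1 p.2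
        + source m σ μ (values q p) j * φ p.1 p.2) ∂(strip 0 T L)
      - timeCoeff τ j * ∫ p, (V j p * mixedDeriv 1 0 φ p.1 p.2 + Vt j p * φ p.1 p.2)
          ∂(strip 0 T L)
      - (∫ p, (Φ p * mixedDeriv 0 1 φ p.1 p.2 + Φx p * φ p.1 p.2) ∂(strip 0 T L)) = 0 := by
    rw [integral_add k3 k4, hx]
    simp only [mul_assoc, integral_const_mul] at he
    simp only [mul_assoc]
    change _ + timeCoeff τ j * _ = 0 at he
    have he' := he
    unfold cell at he'
    unfold strip at ht ⊢
    linear_combination he' - timeCoeff τ j * ht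
  refine Eq.trans ?_ hsum
  rw [← integral_const_mul, ← integral_sub, ← integral_sub]
  · refine integral_congr_ae ?_
    filter_upwards [hV.system (τ := τ)] with p hp
    have h := hp j hj
    have e1 : source m σ μ (fun i => err q V i p) j
        = source m σ μ (values q p) j - source m σ μ (fun i => V i p) j :=
      source_sub (fun i => q i p.1 p.2) (fun i => V i p) j
    rw [e1]
    simp only [errFlux, err, flux, values, hΦ, hΦx]
    by_cases h0 : j = 0
    · simp only [if_pos h0] at h ⊢
      linear_combination (φ p.1 p.2) * h
    · simp only [if_neg h0] at h ⊢
      linear_combination (φ p.1 p.2) * h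
  · exact ((j1.add j2).add j3).sub ((k1.add k2).const_mul _)
  · exact k3.add k4
  · exact (j1.add j2).add j3
  · exact (k1.add k2).const_mul _

/-- The error equations may be tested with bounded functions with bounded weak derivatives. -/
lemma err_test (hV : IsReference T L m σ μ f V Vt Vx g) (hL : 0 < L) (hf : IsAdmissibleFlux f)
    (hq : IsEntropySolution T L m σ μ τ f g q) {j : ℕ} (hj : j < m)
    {W Wt Wx : ℝ × ℝ → ℝ} (hW : MemLp W ∞ (strip 0 T L)) (hWt : MemLp Wt ∞ (strip 0 T L))
    (hWx : MemLp Wx ∞ (strip 0 T L)) (ht : WeakT 0 T L W Wt) (hx : WeakX 0 T L W Wx)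
    {χ : ℝ → ℝ} (hχ : IsTimeCutoff T χ) :
    ∫ p, (timeCoeff τ j * err q V j p * (deriv χ p.1 * W p + χ p.1 * Wt p)
      + errFlux m σ f q V j p * (χ p.1 * Wx p)
      + (source m σ μ (fun i => err q V i p) j - residual τ (fun i => Vt i p) j) * (χ p.1 * W p))
      ∂(strip 0 T L) = 0 :=
  extend_test hL ((hV.integrable_err hq hj).const_mul _) (hV.integrable_errFlux hf hq hj)
    ((integrable_source (fun _ hi => hV.integrable_err hq hi) hj).sub (hV.integrable_residual hj))
    (fun _ hφ => hV.err_equation hL hf hq hj hφ) hW hWt hWx ht hx hχ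

/-- The product rule in space, integrated over full periods. -/
lemma integral_product (hV : IsReference T L m σ μ f V Vt Vx g) (hL : 0 < L) {i j : ℕ} (hi : i < m)
    (hj : j < m) {χ : ℝ → ℝ} (hχ : IsTimeCutoff T χ) :
    ∫ p, χ p.1 * (V i p * Vx j p + Vx i p * V j p) ∂(strip 0 T L) = 0 := by
  have iV := (hV.memLp i hi).integrable le_top
  have iVx := (hV.memLp_x i hi).integrable le_top
  have h := extend_test hL (A := fun _ => 0) (integrable_zero _ _ _) iV iVx (fun φ hφ => ?_) (hV.memLp j hj)
    (hV.memLp_t j hj) (hV.memLp_x j hj) (hV.weak_t hj) (hV.weak_x j hj) hχ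
  · refine Eq.trans ?_ h
    congr 1; ext p; ring
  · have c0 := memLp_top_of_continuous (t₀ := 0) (T := T) (L := L) hφ.1.continuous
    have c2 := memLp_top_of_continuous (t₀ := 0) (T := T) (L := L) hφ.1.dx.continuous
    have := (hV.weak_x i hi).cauchy iV iVx hφ
    rw [eq_neg_iff_add_eq_zero, ← integral_add (integrable_mul_top iV c2)
      (integrable_mul_top iVx c0)] at this
    refine Eq.trans ?_ this
    congr 1; ext p; ring

/-- `V₀ f'(V₀) ∂ₓV₀` is a space derivative. -/
lemma integral_convection (hV : IsReference T L m σ μ f V Vt Vx g) (hL : 0 < L) (hm : 0 < m)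
    (hfc : Continuous (deriv f)) {χ : ℝ → ℝ} (hχ : IsTimeCutoff T χ) :
    ∫ p, χ p.1 * (V 0 p * deriv f (V 0 p) * Vx 0 p) ∂(strip 0 T L) = 0 := by
  have hc : Continuous fun s => s * deriv f s := continuous_id.mul hfc
  have hd : ∀ s, HasDerivAt (fun r => ∫ s in (0 : ℝ)..r, s * deriv f s) (s * deriv f s) s :=
    fun s => intervalIntegral.integral_hasDerivAt_right (hc.intervalIntegrable _ _)
      (hc.stronglyMeasurableAtFilter _ _) hc.continuousAt
  have he : deriv (fun r => ∫ s in (0 : ℝ)..r, s * deriv f s) = fun s => s * deriv f s := by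
    ext s; exact (hd s).deriv
  have hF : Differentiable ℝ (fun r => ∫ s in (0 : ℝ)..r, s * deriv f s) :=
    fun s => (hd s).differentiableAt
  have hw := WeakX.comp hL (hV.memLp 0 hm) (hV.memLp_x 0 hm) (hV.weak_x 0 hm) hF (by rw [he]; exact hc)
  rw [he] at hw
  have := hw.cauchy ((WeakX.comp_memLp hF.continuous (hV.memLp 0 hm)).integrable le_top)
    ((memLp_top_mul (WeakX.comp_memLp hc (hV.memLp 0 hm)) (hV.memLp_x 0 hm)).integrable le_top)
    hχ.cauchyTest_self
  simp only [mixedDeriv_of_time_x, mul_zero, integral_zero] at this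
  rw [zero_eq_neg] at this
  refine Eq.trans ?_ this
  congr 1; ext p; ring

end IsReference

end

/-! ### The relative energy inequality -/

section

variable {T L : ℝ} {m : ℕ} {σ μ τ : ℝ} {f : ℝ → ℝ} {V Vt Vx : ℕ → ℝ × ℝ → ℝ}
  {g : ℕ → ℝ → ℝ} {q : ℕ → ℝ → ℝ → ℝ}

lemma integrable_energyProduction {α : Type*} [MeasurableSpace α] {ν : Measure α}
    {v : ℕ → α → ℝ} (h : ∀ j < m, MemLp (v j) 2 ν) :
    Integrable (fun p => energyProduction m σ μ (fun i => v i p)) ν := by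
  unfold energyProduction
  refine integrable_finsetSum _ fun j hj => ?_
  have hj' := Finset.mem_range.1 hj
  exact (h j hj').integrable_mul (memLp_source h hj')

lemma integrable_energy {α : Type*} [MeasurableSpace α] {ν : Measure α}
    {v : ℕ → α → ℝ} (h : ∀ j < m, MemLp (v j) 2 ν) :
    Integrable (fun p => energy m τ (fun i => v i p)) ν := by
  unfold energy
  refine integrable_finsetSum _ fun j hj => ?_
  exact ((h j (Finset.mem_range.1 hj)).integrable_sq).const_mul _

lemma energy_nonneg (hτ : 0 < τ) (v : ℕ → ℝ) : 0 ≤ energy m τ v :=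
  Finset.sum_nonneg fun j _ => by unfold timeCoeff; split_ifs <;> positivity

lemma single_le_energy (hτ : 0 < τ) (v : ℕ → ℝ) {j : ℕ} (hj : j < m) :
    timeCoeff τ j / 2 * v j ^ 2 ≤ energy m τ v :=
  Finset.single_le_sum (f := fun j => timeCoeff τ j / 2 * v j ^ 2)
    (fun j _ => by unfold timeCoeff; split_ifs <;> positivity) (Finset.mem_range.2 hj)

/-- The error energy density. -/
def errEnergy (m : ℕ) (τ : ℝ) (q : ℕ → ℝ → ℝ → ℝ) (V : ℕ → ℝ × ℝ → ℝ) (p : ℝ × ℝ) : ℝ :=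
  energy m τ (fun j => err q V j p)

namespace IsReference

lemma integrable_errEnergy (hV : IsReference T L m σ μ f V Vt Vx g)
    (hq : IsEntropySolution T L m σ μ τ f g q) : Integrable (errEnergy m τ q V) (strip 0 T L) :=
  integrable_energy fun _ hj => hV.memLp_err hq hj

/-- The spatially symmetric linear part of the flux does not contribute to the energy balance. -/
lemma integral_dispersion (hV : IsReference T L m σ μ f V Vt Vx g) (hL : 0 < L) (hm : Odd m)
    {χ : ℝ → ℝ} (hχ : IsTimeCutoff T χ) :
    ∫ p, χ p.1 * ∑ j ∈ Finset.range m, σ * (-1) ^ j * (V j p * Vx (m - 1 - j) p)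
      ∂(strip 0 T L) = 0 := by
  have hp : ∀ p, χ p.1 * ∑ j ∈ Finset.range m, σ * (-1) ^ j * (V j p * Vx (m - 1 - j) p)
      = ∑ j ∈ Finset.range m, σ * (-1) ^ j / 2 *
        (χ p.1 * (V j p * Vx (m - 1 - j) p + Vx j p * V (m - 1 - j) p)) := by
    intro p
    have h := sum_flux_symm (σ := σ) hm (fun j => V j p) (fun j => Vx j p)
    have h2 : ∑ j ∈ Finset.range m, σ * (-1) ^ j * (V j p * Vx (m - 1 - j) p)
        = ∑ j ∈ Finset.range m, σ * (-1) ^ j / 2 *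
          (V j p * Vx (m - 1 - j) p + Vx j p * V (m - 1 - j) p) := by
      have h3 : ∑ j ∈ Finset.range m, σ * (-1) ^ j / 2 *
          (V j p * Vx (m - 1 - j) p + Vx j p * V (m - 1 - j) p)
          = (∑ j ∈ Finset.range m, σ * (-1) ^ j * (V j p * Vx (m - 1 - j) p)) / 2
            + (∑ j ∈ Finset.range m, σ * (-1) ^ j * (V (m - 1 - j) p * Vx j p)) / 2 := by
        rw [Finset.sum_div, Finset.sum_div, ← Finset.sum_add_distrib]
        exact Finset.sum_congr rfl fun j _ => by ring
      rw [h3, ← h]; ring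
    rw [h2, Finset.mul_sum]
    exact Finset.sum_congr rfl fun j _ => by ring
  simp only [hp]
  rw [integral_finsetSum]
  · refine Finset.sum_eq_zero fun j hj => ?_
    have hj' := Finset.mem_range.1 hj
    rw [integral_const_mul, hV.integral_product hL hj' (by omega) hχ, mul_zero]
  · intro j hj
    have hj' := Finset.mem_range.1 hj
    have hl : m - 1 - j < m := by omega
    exact (((hχ.memLp.integrable le_top).mul_of_top_left
      ((memLp_top_mul (hV.memLp j hj') (hV.memLp_x _ hl)).add
        (memLp_top_mul (hV.memLp_x j hj') (hV.memLp _ hl))))).const_mul _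

/-- The relative energy inequality: the entropy inequality, minus the error equations tested with
the reference state, minus the energy balance of the reference state. The constant `K` accounts for
the quadratic remainder of the nonlinear flux. -/
lemma energy_inequality (hV : IsReference T L m σ μ f V Vt Vx g) (hL : 0 < L) (hT : 0 < T)
    (hm : Odd m) (hμ : 0 ≤ μ) (hf : IsAdmissibleFlux f) :
    ∃ K : ℝ, 0 ≤ K ∧ ∀ τ, ∀ q, IsEntropySolution T L m σ μ τ f g q →
      ∀ χ, IsTimeCutoff T χ → (∀ t, 0 ≤ χ t) →
      0 ≤ ∫ p, (errEnergy m τ q V p * deriv χ p.1 + χ p.1 * (K * err q V 0 p ^ 2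
        - ∑ j ∈ Finset.range m, residual τ (fun i => Vt i p) j * err q V j p)) ∂(strip 0 T L) := by
  obtain ⟨M, hM0, hfd, hfc, hM⟩ := hf.exists_lipschitz
  have h0m : 0 < m := hm.pos
  obtain ⟨B, hB0, hB⟩ := exists_bound_of_memLp_top (hV.memLp_x 0 h0m)
  refine ⟨M * B, by positivity, fun τ q hq χ hχ hχ0 => ?_⟩
  have mχ := hχ.memLp (L := L) (t₀ := 0)
  have mχ' := hχ.memLp_deriv (L := L) (t₀ := 0)
  have mq : ∀ j < m, MemLp (fun p : ℝ × ℝ => q j p.1 p.2) 2 (strip 0 T L) :=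
    fun j hj => memLp_solution hq hj
  have me : ∀ j < m, MemLp (err q V j) 2 (strip 0 T L) := fun j hj => hV.memLp_err hq hj
  -- the entropy inequality, tested with the cut-off
  have hent := hq.entropy _ hχ.cauchyTest_self (fun t _ => hχ0 t)
  simp only [mixedDeriv_of_time_t, mixedDeriv_of_time_x, mul_zero, add_zero] at hent
  rw [integral_mul_const] at hent
  set X : ℕ → ℝ × ℝ → ℝ := fun j p =>
    timeCoeff τ j * err q V j p * (deriv χ p.1 * V j p + χ p.1 * Vt j p)
      + errFlux m σ f q V j p * (χ p.1 * Vx j p)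
      + (source m σ μ (fun i => err q V i p) j - residual τ (fun i => Vt i p) j)
        * (χ p.1 * V j p) with hX
  set Y : ℕ → ℝ × ℝ → ℝ := fun j p =>
    timeCoeff τ j / 2 * (V j p ^ 2 * deriv χ p.1 + 2 * (V j p * Vt j p) * χ p.1) with hY
  have hXi : ∀ j < m, Integrable (X j) (strip 0 T L) := by
    intro j hj
    have m1 : MemLp (fun p => deriv χ p.1 * V j p + χ p.1 * Vt j p) ∞ (strip 0 T L) :=
      (memLp_top_mul mχ' (hV.memLp j hj)).add (memLp_top_mul mχ (hV.memLp_t j hj))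
    exact ((integrable_mul_top ((hV.integrable_err hq hj).const_mul _) m1).add
      (integrable_mul_top (hV.integrable_errFlux hf hq hj)
        (memLp_top_mul mχ (hV.memLp_x j hj)))).add
      (integrable_mul_top ((integrable_source (fun i hi => hV.integrable_err hq hi) hj).sub
        (hV.integrable_residual hj)) (memLp_top_mul mχ (hV.memLp j hj)))
  have hYm : ∀ j < m, Integrable
      (fun p => V j p ^ 2 * deriv χ p.1 + 2 * (V j p * Vt j p) * χ p.1) (strip 0 T L) := by
    intro j hj
    have m1 := memLp_top_mul (memLp_top_mul (hV.memLp j hj) (hV.memLp j hj)) mχ'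
    have m2 := memLp_top_mul (memLp_top_mul (hV.memLp j hj) (hV.memLp_t j hj)) mχ
    refine ((m1.integrable le_top).add ((m2.integrable le_top).const_mul 2)).congr
      (Eventually.of_forall fun p => ?_)
    simp only [Pi.add_apply]; ring
  have hYi : ∀ j < m, Integrable (Y j) (strip 0 T L) := fun j hj => (hYm j hj).const_mul _
  have hX0 : ∀ j < m, ∫ p, X j p ∂(strip 0 T L) = 0 := fun j hj =>
    hV.err_test hL hf hq hj (hV.memLp j hj) (hV.memLp_t j hj) (hV.memLp_x j hj) (hV.weak_t hj)
      (hV.weak_x j hj) hχ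
  have hY0 : ∑ j ∈ Finset.range m, ∫ p, Y j p ∂(strip 0 T L)
      = - ((∫ x, energy m τ (fun j => g j x) ∂(period L)) * χ 0) := by
    have hpf : IsFiniteMeasure (period L) := by unfold period; infer_instance
    have e1 : ∫ x, energy m τ (fun j => g j x) ∂(period L)
        = ∑ j ∈ Finset.range m, timeCoeff τ j / 2 * ∫ x, g j x ^ 2 ∂(period L) := by
      unfold energy
      rw [integral_finsetSum]
      · simp only [integral_const_mul]
      · intro j hj
        exact (((hV.memLp_init j (Finset.mem_range.1 hj)).mono_exponent
          le_top).integrable_sq).const_mul _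
    rw [e1, Finset.sum_mul, ← Finset.sum_neg_distrib]
    refine Finset.sum_congr rfl fun j hj => ?_
    have hj' := Finset.mem_range.1 hj
    have := integral_sq_of_trace hL hT (hV.memLp j hj') (hV.memLp_t j hj') (hV.memLp_init j hj')
      (hV.trace j hj') hχ
    simp only [hY]
    rw [integral_const_mul]
    linear_combination (timeCoeff τ j / 2) * this
  have iE : Integrable (fun p : ℝ × ℝ => energy m τ (values q p) * deriv χ p.1) (strip 0 T L) :=
    integrable_mul_top (integrable_energy mq) mχ'
  have iP : Integrable (fun p : ℝ × ℝ => energyProduction m σ μ (values q p) * χ p.1)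
      (strip 0 T L) := integrable_mul_top (integrable_energyProduction mq) mχ
  have iEP : Integrable (fun p : ℝ × ℝ => energy m τ (values q p) * deriv χ p.1
      + energyProduction m σ μ (values q p) * χ p.1) (strip 0 T L) := iE.add iP
  have iX : Integrable (fun p => ∑ j ∈ Finset.range m, X j p) (strip 0 T L) :=
    integrable_finsetSum _ fun j hj => hXi j (Finset.mem_range.1 hj)
  have iY : Integrable (fun p => ∑ j ∈ Finset.range m, Y j p) (strip 0 T L) :=
    integrable_finsetSum _ fun j hj => hYi j (Finset.mem_range.1 hj)
  have iEPX : Integrable (fun p : ℝ × ℝ => energy m τ (values q p) * deriv χ p.1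
      + energyProduction m σ μ (values q p) * χ p.1 - ∑ j ∈ Finset.range m, X j p)
      (strip 0 T L) := iEP.sub iX
  have hF : 0 ≤ ∫ p, (energy m τ (values q p) * deriv χ p.1
      + energyProduction m σ μ (values q p) * χ p.1 - ∑ j ∈ Finset.range m, X j p
      - ∑ j ∈ Finset.range m, Y j p) ∂(strip 0 T L) := by
    rw [integral_sub iEPX iY, integral_sub iEP iX, integral_finsetSum _ fun j hj =>
      hXi j (Finset.mem_range.1 hj), integral_finsetSum _ fun j hj =>
      hYi j (Finset.mem_range.1 hj), hY0, Finset.sum_eq_zero fun j hj =>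
      hX0 j (Finset.mem_range.1 hj)]
    have : 0 ≤ ∫ p, (energy m τ (values q p) * deriv χ p.1
      + energyProduction m σ μ (values q p) * χ p.1) ∂(strip 0 T L)
      + (∫ x, energy m τ (fun j => g j x) ∂(period L)) * χ 0 := hent
    linarith
  -- the two quadratic terms in the reference state integrate to zero
  have iD : Integrable (fun p => χ p.1 * ∑ j ∈ Finset.range m,
      σ * (-1) ^ j * (V j p * Vx (m - 1 - j) p)) (strip 0 T L) := by
    refine (mχ.integrable le_top).mul_of_top_left (memLp_finsetSum _ fun j hj => ?_)
    have hj' := Finset.mem_range.1 hj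
    exact (memLp_top_mul (hV.memLp j hj') (hV.memLp_x _ (by omega))).const_mul _
  have iC : Integrable (fun p => χ p.1 * (V 0 p * deriv f (V 0 p) * Vx 0 p)) (strip 0 T L) :=
    (mχ.integrable le_top).mul_of_top_left (memLp_top_mul
      (WeakX.comp_memLp (continuous_id.mul hfc) (hV.memLp 0 h0m)) (hV.memLp_x 0 h0m))
  have iF : Integrable (fun p : ℝ × ℝ => energy m τ (values q p) * deriv χ p.1
      + energyProduction m σ μ (values q p) * χ p.1 - ∑ j ∈ Finset.range m, X j p
      - ∑ j ∈ Finset.range m, Y j p) (strip 0 T L) := iEPX.sub iY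
  have iFD : Integrable (fun p : ℝ × ℝ => energy m τ (values q p) * deriv χ p.1
      + energyProduction m σ μ (values q p) * χ p.1 - ∑ j ∈ Finset.range m, X j p
      - ∑ j ∈ Finset.range m, Y j p - χ p.1 * ∑ j ∈ Finset.range m,
        σ * (-1) ^ j * (V j p * Vx (m - 1 - j) p)) (strip 0 T L) := iF.sub iD
  have hFDC := (integral_sub iFD iC).trans (congrArg (· - _) (integral_sub iF iD))
  rw [hV.integral_dispersion hL hm hχ, hV.integral_convection hL h0m hfc hχ, sub_zero,
    sub_zero] at hFDC
  refine (hF.trans_eq hFDC.symm).trans (integral_mono_ae (iFD.sub iC) ?_ ?_)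
  · refine (integrable_mul_top (hV.integrable_errEnergy hq) mχ').add
      (Integrable.congr (integrable_mul_top ((((me 0 h0m).integrable_sq).const_mul (M * B)).sub
        (integrable_finsetSum (Finset.range m) (f := fun j p =>
          residual τ (fun i => Vt i p) j * err q V j p) fun j hj => ?_)) mχ)
        (Eventually.of_forall fun p => mul_comm _ _))
    have hj' := Finset.mem_range.1 hj
    refine Integrable.congr (integrable_mul_top (hV.integrable_err hq hj')
      (W := fun p => residual τ (fun i => Vt i p) j) ?_) (Eventually.of_forall fun p => mul_comm _ _)
    unfold residual
    by_cases hj0 : j = 0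
    · simp [hj0]
    · simp only [if_neg hj0]; exact (hV.memLp_t j hj').const_mul _
  · filter_upwards [hV.system (τ := τ), hB] with p hp hb
    have hid := relative_energy_identity (v := fun j => V j p) (vt := fun j => Vt j p)
      (vx := fun j => Vx j p) (d := deriv f (V 0 p)) (e := fun j => err q V j p)
      (n := f (q 0 p.1 p.2) - f (V 0 p))
      (a := deriv χ p.1) (b := χ p.1) hm hp
    have e1 : (fun j => V j p + err q V j p) = values q p := by
      ext j; simp [err, values]
    rw [e1] at hid
    have hP := energyProduction_nonpos (σ := σ) hm hμ (fun j => err q V j p)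
    have hrel : |(f (q 0 p.1 p.2) - f (V 0 p) - deriv f (V 0 p) * err q V 0 p) * Vx 0 p|
        ≤ M * B * err q V 0 p ^ 2 := by
      rw [abs_mul]
      have := mul_le_mul (hM (V 0 p) (q 0 p.1 p.2)) hb (abs_nonneg _) (by positivity)
      refine this.trans (le_of_eq ?_)
      simp only [err]; ring
    have hrel' := (neg_le_abs _).trans hrel
    have hmono := mul_le_mul_of_nonneg_left (add_le_add hP hrel') (hχ0 p.1)
    simp only [hX, hY, errFlux, errEnergy] at hid ⊢
    linear_combination hid + hmono

end IsReference

end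

/-! ### Negligible functionals of the error -/

section

variable {T L : ℝ} {m : ℕ} {σ μ τ : ℝ} {f : ℝ → ℝ} {V Vt Vx : ℕ → ℝ × ℝ → ℝ}
  {g : ℕ → ℝ → ℝ} {q : ℕ → ℝ → ℝ → ℝ}

/-- Nonnegative nonincreasing cut-offs in time. -/
def IsDecreasingCutoff (T : ℝ) (χ : ℝ → ℝ) : Prop :=
  IsTimeCutoff T χ ∧ (∀ t, 0 ≤ χ t) ∧ ∀ t, deriv χ t ≤ 0

/-- The density of the terms that a Gronwall argument can absorb: `ε` times the energy at the
final time (represented by `-χ'`), the time integral of the energy, and `O(τ²)`. -/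
def majorant (ε K τ : ℝ) (χ : ℝ → ℝ) (η : ℝ × ℝ → ℝ) (p : ℝ × ℝ) : ℝ :=
  -deriv χ p.1 * (ε * η p + K * τ ^ 2) + χ p.1 * (K * (η p + τ ^ 2))

/-- Functionals `F` of the solution and the cut-off for which `τ F` is bounded by the integral of
`majorant ε K`, for every `ε > 0` with some `K` that depends neither on `τ` nor on the solution. -/
def Negligible (T L : ℝ) (m : ℕ) (σ μ : ℝ) (f : ℝ → ℝ) (V : ℕ → ℝ × ℝ → ℝ) (g : ℕ → ℝ → ℝ)
    (F : (ℕ → ℝ → ℝ → ℝ) → (ℝ → ℝ) → ℝ) : Prop :=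
  ∀ ε > 0, ∃ K : ℝ, 0 ≤ K ∧ ∀ τ, 0 < τ → τ ≤ 1 → ∀ q, IsEntropySolution T L m σ μ τ f g q →
    ∀ χ, IsDecreasingCutoff T χ →
      |τ * F q χ| ≤ ∫ p, majorant ε K τ χ (errEnergy m τ q V) p ∂(strip 0 T L)

/-- The weighted integral `∫ χ w e_k` of the error. -/
def pairing (T L : ℝ) (V : ℕ → ℝ × ℝ → ℝ) (w : ℝ × ℝ → ℝ) (k : ℕ) (q : ℕ → ℝ → ℝ → ℝ)
    (χ : ℝ → ℝ) : ℝ :=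
  ∫ p, χ p.1 * w p * err q V k p ∂(strip 0 T L)

lemma young {ε : ℝ} (hε : 0 < ε) (a b : ℝ) : a * b ≤ ε * (a ^ 2 / 2) + b ^ 2 / (2 * ε) := by
  have h : b ^ 2 / (2 * ε) = ε * ((b / ε) ^ 2 / 2) := by field_simp
  have h2 : a * b = ε * (a * (b / ε)) := by field_simp
  rw [h, h2, ← mul_add]
  exact mul_le_mul_of_nonneg_left (by nlinarith [sq_nonneg (a - b / ε)]) hε.le

lemma integrable_majorant {ε K : ℝ} {χ : ℝ → ℝ} (hχ : IsTimeCutoff T χ) {η : ℝ × ℝ → ℝ}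
    (hη : Integrable η (strip 0 T L)) : Integrable (majorant ε K τ χ η) (strip 0 T L) := by
  have h1 : Integrable (fun p => ε * η p + K * τ ^ 2) (strip 0 T L) :=
    (hη.const_mul _).add (integrable_const _)
  have h2 : Integrable (fun p => K * (η p + τ ^ 2)) (strip 0 T L) :=
    (hη.add (integrable_const _)).const_mul _
  refine ((integrable_mul_top h1 hχ.memLp_deriv).neg.add (integrable_mul_top h2 hχ.memLp)).congr
    (Eventually.of_forall fun p => ?_)
  simp only [majorant, Pi.add_apply, Pi.neg_apply]; ring

lemma majorant_mono {ε ε' K K' : ℝ} (hτ : 0 < τ) {χ : ℝ → ℝ} (hχ : IsDecreasingCutoff T χ)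
    (hε : ε ≤ ε') (hK : K ≤ K') (p : ℝ × ℝ) :
    majorant ε K τ χ (errEnergy m τ q V) p ≤ majorant ε' K' τ χ (errEnergy m τ q V) p := by
  have hη : 0 ≤ errEnergy m τ q V p := energy_nonneg hτ _
  have h1 := hχ.2.2 p.1
  have h2 := hχ.2.1 p.1
  unfold majorant
  gcongr
  linarith

namespace IsReference

variable {F G : (ℕ → ℝ → ℝ → ℝ) → (ℝ → ℝ) → ℝ}

lemma negligible_of_bound (hV : IsReference T L m σ μ f V Vt Vx g)
    (h : ∀ ε > 0, ∃ K : ℝ, 0 ≤ K ∧ ∀ τ, 0 < τ → τ ≤ 1 → ∀ q,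
      IsEntropySolution T L m σ μ τ f g q → ∀ χ, IsDecreasingCutoff T χ →
      ∃ X : ℝ × ℝ → ℝ, τ * F q χ = ∫ p, X p ∂(strip 0 T L) ∧
        ∀ᵐ p ∂(strip 0 T L), |X p| ≤ majorant ε K τ χ (errEnergy m τ q V) p) :
    Negligible T L m σ μ f V g F := by
  intro ε hε
  obtain ⟨K, hK0, hK⟩ := h ε hε
  refine ⟨K, hK0, fun τ hτ hτ1 q hq χ hχ => ?_⟩
  obtain ⟨X, hX, hb⟩ := hK τ hτ hτ1 q hq χ hχ
  rw [hX, ← Real.norm_eq_abs]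
  exact norm_integral_le_of_norm_le (integrable_majorant hχ.1 (hV.integrable_errEnergy hq)) hb

lemma negligible_add (hV : IsReference T L m σ μ f V Vt Vx g) (hF : Negligible T L m σ μ f V g F)
    (hG : Negligible T L m σ μ f V g G) :
    Negligible T L m σ μ f V g (fun q χ => F q χ + G q χ) := by
  intro ε hε
  obtain ⟨K, hK0, hK⟩ := hF (ε / 2) (by positivity)
  obtain ⟨K', hK0', hK'⟩ := hG (ε / 2) (by positivity)
  refine ⟨K + K', by positivity, fun τ hτ hτ1 q hq χ hχ => ?_⟩
  have i := hV.integrable_errEnergy hq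
  rw [mul_add]
  refine (abs_add_le _ _).trans ((add_le_add (hK τ hτ hτ1 q hq χ hχ)
    (hK' τ hτ hτ1 q hq χ hχ)).trans (le_of_eq ?_))
  rw [← integral_add (integrable_majorant hχ.1 i) (integrable_majorant hχ.1 i)]
  congr 1; ext p; simp only [majorant]; ring

lemma negligible_const_mul (hV : IsReference T L m σ μ f V Vt Vx g)
    (hF : Negligible T L m σ μ f V g F) (c : ℝ) :
    Negligible T L m σ μ f V g (fun q χ => c * F q χ) := by
  intro ε hε
  obtain ⟨K, hK0, hK⟩ := hF (ε / (|c| + 1)) (by positivity)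
  refine ⟨|c| * K, by positivity, fun τ hτ hτ1 q hq χ hχ => ?_⟩
  have i := hV.integrable_errEnergy hq
  rw [mul_left_comm, abs_mul]
  refine (mul_le_mul_of_nonneg_left (hK τ hτ hτ1 q hq χ hχ) (abs_nonneg c)).trans ?_
  rw [← integral_const_mul]
  refine integral_mono ((integrable_majorant hχ.1 i).const_mul _) (integrable_majorant hχ.1 i)
    fun p => ?_
  have e : |c| * majorant (ε / (|c| + 1)) K τ χ (errEnergy m τ q V) p
      = majorant (|c| * (ε / (|c| + 1))) (|c| * K) τ χ (errEnergy m τ q V) p := by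
    simp only [majorant]; ring
  simp only
  rw [e]
  refine majorant_mono hτ hχ ?_ le_rfl p
  rw [mul_div_assoc', div_le_iff₀ (by positivity)]
  nlinarith [abs_nonneg c]

lemma negligible_sub (hV : IsReference T L m σ μ f V Vt Vx g) (hF : Negligible T L m σ μ f V g F)
    (hG : Negligible T L m σ μ f V g G) :
    Negligible T L m σ μ f V g (fun q χ => F q χ - G q χ) := by
  have := hV.negligible_add hF (hV.negligible_const_mul hG (-1))
  simpa [sub_eq_add_neg] using this

lemma integrable_pairing (hV : IsReference T L m σ μ f V Vt Vx g)
    (hq : IsEntropySolution T L m σ μ τ f g q) {χ : ℝ → ℝ} (hχ : IsTimeCutoff T χ)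
    {w : ℝ × ℝ → ℝ} (hw : MemLp w ∞ (strip 0 T L)) {k : ℕ} (hk : k < m) :
    Integrable (fun p => χ p.1 * w p * err q V k p) (strip 0 T L) :=
  (integrable_mul_top (hV.integrable_err hq hk) (memLp_top_mul hχ.memLp hw)).congr
    (Eventually.of_forall fun p => by simp only; ring)

lemma negligible_pairing_zero (hV : IsReference T L m σ μ f V Vt Vx g) (hm : 0 < m)
    {w : ℝ × ℝ → ℝ} (hw : MemLp w ∞ (strip 0 T L)) :
    Negligible T L m σ μ f V g (pairing T L V w 0) := by
  obtain ⟨B, hB0, hB⟩ := exists_bound_of_memLp_top hw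
  refine hV.negligible_of_bound fun ε hε => ⟨1 + B ^ 2 / 2, by positivity,
    fun τ hτ hτ1 q hq χ hχ => ⟨fun p => τ * (χ p.1 * w p * err q V 0 p), ?_, ?_⟩⟩
  · rw [integral_const_mul]; rfl
  · filter_upwards [hB] with p hp
    have hη : err q V 0 p ^ 2 / 2 ≤ errEnergy m τ q V p := by
      have := single_le_energy hτ (fun j => err q V j p) hm
      simp only [timeCoeff, if_true] at this
      unfold errEnergy; linarith
    have hη0 : 0 ≤ errEnergy m τ q V p := energy_nonneg hτ _
    have h1 : |τ * (χ p.1 * w p * err q V 0 p)| = χ p.1 * (|err q V 0 p| * (τ * |w p|)) := by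
      rw [abs_mul, abs_mul, abs_mul, abs_of_pos hτ, abs_of_nonneg (hχ.2.1 _)]; ring
    have h2 := young one_pos |err q V 0 p| (τ * |w p|)
    have h3 : (τ * |w p|) ^ 2 ≤ τ ^ 2 * B ^ 2 := by rw [mul_pow]; gcongr
    rw [sq_abs] at h2
    rw [h1, majorant]
    have h4 : |err q V 0 p| * (τ * |w p|)
        ≤ (1 + B ^ 2 / 2) * (errEnergy m τ q V p + τ ^ 2) := by
      have : 0 ≤ B ^ 2 / 2 * errEnergy m τ q V p := by positivity
      nlinarith [sq_nonneg τ]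
    have h5 : 0 ≤ -deriv χ p.1 * (ε * errEnergy m τ q V p + (1 + B ^ 2 / 2) * τ ^ 2) :=
      mul_nonneg (by linarith [hχ.2.2 p.1]) (by positivity)
    have := mul_le_mul_of_nonneg_left h4 (hχ.2.1 p.1)
    linarith

lemma sign_sq (hσ : σ = -1 ∨ σ = 1) (i : ℕ) : (σ * (-1) ^ i) * (σ * (-1) ^ i) = 1 := by
  have h1 : σ * σ = 1 := by rcases hσ with rfl | rfl <;> norm_num
  have h2 : (-1 : ℝ) ^ i * (-1) ^ i = 1 := by rw [← pow_add, ← two_mul]; simp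
  calc (σ * (-1) ^ i) * (σ * (-1) ^ i) = (σ * σ) * ((-1) ^ i * (-1) ^ i) := by ring
    _ = 1 := by rw [h1, h2, one_mul]

/-- Testing the constraint `∂ₓ e_{k-1} = e_k + O(τ)` moves a space derivative from the weight to
the error. The time derivative in the remainder `O(τ)` falls on the weight and on the cut-off. -/
lemma negligible_constraint (hV : IsReference T L m σ μ f V Vt Vx g) (hL : 0 < L)
    (hf : IsAdmissibleFlux f) (hσ : σ = -1 ∨ σ = 1) {k : ℕ} (hk : 1 ≤ k) (hkm : k < m)
    {W Wt Wx : ℝ × ℝ → ℝ} (hW : MemLp W ∞ (strip 0 T L)) (hWt : MemLp Wt ∞ (strip 0 T L))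
    (hWx : MemLp Wx ∞ (strip 0 T L)) (ht : WeakT 0 T L W Wt) (hx : WeakX 0 T L W Wx) :
    Negligible T L m σ μ f V g (fun q χ => pairing T L V Wx (k - 1) q χ + pairing T L V W k q χ
      + (if k = m - 1 then σ * μ else 0) * pairing T L V W 1 q χ) := by
  obtain ⟨B₀, hB0', hB₀⟩ := exists_bound_of_memLp_top hW
  obtain ⟨B₁, hB1', hB₁⟩ := exists_bound_of_memLp_top hWt
  obtain ⟨i, hi⟩ : ∃ i, i = m - k := ⟨_, rfl⟩
  have hi0 : i ≠ 0 := by omega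
  have him : i < m := by omega
  obtain ⟨B₂, hB2', hB₂⟩ := exists_bound_of_memLp_top (hV.memLp_t i him)
  set s : ℝ := σ * (-1) ^ i with hs
  have hss : s * s = 1 := sign_sq hσ i
  have habs : |s| = 1 := by
    have : |s| * |s| = 1 := by rw [← abs_mul, hss, abs_one]
    nlinarith [abs_nonneg s]
  refine hV.negligible_of_bound fun ε hε => ⟨B₀ ^ 2 / (2 * ε) + 1 + B₁ ^ 2 / 2 + B₂ * B₀,
    by positivity, fun τ hτ hτ1 q hq χ hχ => ⟨fun p => -s * τ * (τ * err q V i p *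
      (deriv χ p.1 * W p + χ p.1 * Wt p) - τ * Vt i p * (χ p.1 * W p)), ?_, ?_⟩⟩
  · have h := hV.err_test hL hf hq him hW hWt hWx ht hx hχ.1
    have i1 := hV.integrable_pairing hq hχ.1 hWx (k := k - 1) (by omega)
    have i2 := hV.integrable_pairing hq hχ.1 hW hkm
    have i3 := (hV.integrable_pairing hq hχ.1 hW (k := 1) (by omega)).const_mul
      (if k = m - 1 then σ * μ else 0)
    have e1 : pairing T L V Wx (k - 1) q χ + pairing T L V W k q χ
        + (if k = m - 1 then σ * μ else 0) * pairing T L V W 1 q χ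
        = ∫ p, (χ p.1 * Wx p * err q V (k - 1) p + χ p.1 * W p * err q V k p
          + (if k = m - 1 then σ * μ else 0) * (χ p.1 * W p * err q V 1 p)) ∂(strip 0 T L) := by
      have i12 : Integrable (fun p => χ p.1 * Wx p * err q V (k - 1) p
        + χ p.1 * W p * err q V k p) (strip 0 T L) := i1.add i2
      rw [integral_add i12 i3, integral_add i1 i2, integral_const_mul]
      rfl
    have e2 : ∀ p, -s * τ * (τ * err q V i p *
        (deriv χ p.1 * W p + χ p.1 * Wt p) - τ * Vt i p * (χ p.1 * W p))
        = τ * (χ p.1 * Wx p * err q V (k - 1) p + χ p.1 * W p * err q V k p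
          + (if k = m - 1 then σ * μ else 0) * (χ p.1 * W p * err q V 1 p))
        + (-s * τ) * (timeCoeff τ i * err q V i p * (deriv χ p.1 * W p + χ p.1 * Wt p)
      + errFlux m σ f q V i p * (χ p.1 * Wx p)
      + (source m σ μ (fun i => err q V i p) i - residual τ (fun i => Vt i p) i)
        * (χ p.1 * W p)) := by
      intro p
      simp only [timeCoeff, errFlux, source, residual, if_neg hi0]
      rw [show m - 1 - i = k - 1 by omega, show m - i = k by omega, ← hs]
      by_cases hk1 : k = m - 1
      · have hi1 : i = 1 := by omega
        have hs1 : s = -σ := by rw [hs, hi1]; ring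
        rw [if_pos hk1, if_pos hi1]
        linear_combination (τ * (χ p.1 * Wx p * err q V (k - 1) p + χ p.1 * W p * err q V k p)) * hss
          - (τ * μ * χ p.1 * W p * err q V 1 p) * hs1
      · have hi1 : i ≠ 1 := by omega
        rw [if_neg hk1, if_neg hi1]
        linear_combination (τ * (χ p.1 * Wx p * err q V (k - 1) p + χ p.1 * W p * err q V k p)) * hss
    rw [e1]
    simp only [e2]
    have i123 : Integrable (fun p => χ p.1 * Wx p * err q V (k - 1) p
        + χ p.1 * W p * err q V k p
          + (if k = m - 1 then σ * μ else 0) * (χ p.1 * W p * err q V 1 p)) (strip 0 T L) :=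
      (i1.add i2).add i3
    rw [integral_add (i123.const_mul τ), integral_const_mul, integral_const_mul, h, mul_zero,
      add_zero]
    refine Integrable.const_mul ?_ _
    exact ((integrable_mul_top ((hV.integrable_err hq him).const_mul _)
      ((memLp_top_mul hχ.1.memLp_deriv hW).add (memLp_top_mul hχ.1.memLp hWt))).add
      (integrable_mul_top (hV.integrable_errFlux hf hq him) (memLp_top_mul hχ.1.memLp hWx))).add
      (integrable_mul_top ((integrable_source (fun _ hi => hV.integrable_err hq hi) him).sub
        (hV.integrable_residual him)) (memLp_top_mul hχ.1.memLp hW))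
  · filter_upwards [hB₀, hB₁, hB₂] with p h0 h1 h2
    have hη : τ * (err q V i p ^ 2 / 2) ≤ errEnergy m τ q V p := by
      have := single_le_energy hτ (fun j => err q V j p) him
      simp only [timeCoeff, if_neg hi0] at this
      unfold errEnergy; linarith
    set η := errEnergy m τ q V p
    set e := |err q V i p| with he
    have he0 : 0 ≤ e := abs_nonneg _
    have hη0 : 0 ≤ η := (mul_nonneg hτ.le (by positivity)).trans hη
    have hη' : τ * (e ^ 2 / 2) ≤ η := by rwa [he, sq_abs]
    have hc := hχ.2.1 p.1
    have hd : 0 ≤ -deriv χ p.1 := by linarith [hχ.2.2 p.1]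
    have y1 : τ ^ 2 * (e * B₀) ≤ ε * η + B₀ ^ 2 / (2 * ε) * τ ^ 2 := by
      have := young hε e (τ * B₀)
      have h3 : τ * (e * (τ * B₀)) ≤ τ * (ε * (e ^ 2 / 2) + (τ * B₀) ^ 2 / (2 * ε)) :=
        mul_le_mul_of_nonneg_left this hτ.le
      have h4 : τ * ((τ * B₀) ^ 2 / (2 * ε)) ≤ 1 * ((τ * B₀) ^ 2 / (2 * ε)) :=
        mul_le_mul_of_nonneg_right hτ1 (by positivity)
      have h5 : ε * (τ * (e ^ 2 / 2)) ≤ ε * η := mul_le_mul_of_nonneg_left hη' hε.le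
      have h6 : 1 * ((τ * B₀) ^ 2 / (2 * ε)) = B₀ ^ 2 / (2 * ε) * τ ^ 2 := by ring
      linarith
    have y2 : τ ^ 2 * (e * B₁) ≤ η + B₁ ^ 2 / 2 * τ ^ 2 := by
      have := young one_pos e (τ * B₁)
      have h3 : τ * (e * (τ * B₁)) ≤ τ * (1 * (e ^ 2 / 2) + (τ * B₁) ^ 2 / (2 * 1)) :=
        mul_le_mul_of_nonneg_left this hτ.le
      have h4 : τ * ((τ * B₁) ^ 2 / (2 * 1)) ≤ 1 * ((τ * B₁) ^ 2 / (2 * 1)) :=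
        mul_le_mul_of_nonneg_right hτ1 (by positivity)
      linarith
    have hX : |-s * τ * (τ * err q V i p * (deriv χ p.1 * W p + χ p.1 * Wt p)
        - τ * Vt i p * (χ p.1 * W p))|
        ≤ -deriv χ p.1 * (τ ^ 2 * (e * B₀)) + χ p.1 * (τ ^ 2 * (e * B₁) + τ ^ 2 * (B₂ * B₀)) := by
      rw [abs_mul, abs_mul, abs_neg, habs, one_mul, abs_of_pos hτ]
      have a1 : |deriv χ p.1 * W p| ≤ -deriv χ p.1 * B₀ := by
        rw [abs_mul, abs_of_nonpos (hχ.2.2 p.1)]; exact mul_le_mul_of_nonneg_left h0 hd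
      have a2 : |χ p.1 * Wt p| ≤ χ p.1 * B₁ := by
        rw [abs_mul, abs_of_nonneg hc]; exact mul_le_mul_of_nonneg_left h1 hc
      have a3 : |χ p.1 * W p| ≤ χ p.1 * B₀ := by
        rw [abs_mul, abs_of_nonneg hc]; exact mul_le_mul_of_nonneg_left h0 hc
      have a4 : |τ * err q V i p * (deriv χ p.1 * W p + χ p.1 * Wt p)|
          ≤ τ * e * (-deriv χ p.1 * B₀ + χ p.1 * B₁) := by
        rw [abs_mul, abs_mul, abs_of_pos hτ]
        exact mul_le_mul_of_nonneg_left ((abs_add_le _ _).trans (add_le_add a1 a2)) (by positivity)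
      have a5 : |τ * Vt i p * (χ p.1 * W p)| ≤ τ * B₂ * (χ p.1 * B₀) := by
        rw [abs_mul, abs_mul, abs_of_pos hτ]
        exact mul_le_mul (mul_le_mul_of_nonneg_left h2 hτ.le) a3 (abs_nonneg _) (by positivity)
      have a6 := mul_le_mul_of_nonneg_left ((abs_sub _ _).trans (add_le_add a4 a5)) hτ.le
      refine a6.trans (le_of_eq ?_)
      ring
    refine hX.trans ?_
    unfold majorant
    refine add_le_add (mul_le_mul_of_nonneg_left (y1.trans ?_) hd)
      (mul_le_mul_of_nonneg_left ?_ hc)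
    · have : 0 ≤ (1 + B₁ ^ 2 / 2 + B₂ * B₀) * τ ^ 2 := by positivity
      linarith
    · have z1 : 0 ≤ (B₀ ^ 2 / (2 * ε) + B₁ ^ 2 / 2 + B₂ * B₀) * η := by positivity
      have z2 : 0 ≤ (B₀ ^ 2 / (2 * ε) + 1) * τ ^ 2 := by positivity
      linarith

/-- Testing the conservation law `∂ₜ e₀ + ∂ₓ (f(q₀) - f(V₀) + σ e_{m-1}) = 0`. -/
lemma negligible_conservation (hV : IsReference T L m σ μ f V Vt Vx g) (hL : 0 < L)
    (hf : IsAdmissibleFlux f) (hσ : σ = -1 ∨ σ = 1) (hm : 0 < m)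
    {W Wt Wx : ℝ × ℝ → ℝ} (hW : MemLp W ∞ (strip 0 T L)) (hWt : MemLp Wt ∞ (strip 0 T L))
    (hWx : MemLp Wx ∞ (strip 0 T L)) (ht : WeakT 0 T L W Wt) (hx : WeakX 0 T L W Wx) :
    Negligible T L m σ μ f V g (pairing T L V Wx (m - 1)) := by
  obtain ⟨M, hM0, hfd, hfc, hM⟩ := hf.exists_lipschitz
  obtain ⟨B₀, hB0', hB₀⟩ := exists_bound_of_memLp_top hW
  obtain ⟨B₁, hB1', hB₁⟩ := exists_bound_of_memLp_top hWt
  obtain ⟨B₂, hB2', hB₂⟩ := exists_bound_of_memLp_top hWx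
  obtain ⟨B₃, hB3', hB₃⟩ := exists_bound_of_memLp_top (WeakX.comp_memLp hfc (hV.memLp 0 hm))
  have hσσ : σ * σ = 1 := by rcases hσ with rfl | rfl <;> norm_num
  have habs : |σ| = 1 := by rcases hσ with rfl | rfl <;> norm_num
  refine hV.negligible_of_bound fun ε hε => ⟨B₀ ^ 2 / (2 * ε) + 1
    + (B₁ + B₃ * B₂) ^ 2 / 2 + 2 * M * B₂,
    by positivity, fun τ hτ hτ1 q hq χ hχ => ⟨fun p => -σ * τ * (err q V 0 p *
      (deriv χ p.1 * W p + χ p.1 * Wt p) + (f (q 0 p.1 p.2) - f (V 0 p)) * (χ p.1 * Wx p)),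
      ?_, ?_⟩⟩
  · have h := hV.err_test hL hf hq hm hW hWt hWx ht hx hχ.1
    have i1 := hV.integrable_pairing hq hχ.1 hWx (k := m - 1) (by omega)
    have e2 : ∀ p, -σ * τ * (err q V 0 p * (deriv χ p.1 * W p + χ p.1 * Wt p)
          + (f (q 0 p.1 p.2) - f (V 0 p)) * (χ p.1 * Wx p))
        = τ * (χ p.1 * Wx p * err q V (m - 1) p)
        + (-σ * τ) * (timeCoeff τ 0 * err q V 0 p * (deriv χ p.1 * W p + χ p.1 * Wt p)
      + errFlux m σ f q V 0 p * (χ p.1 * Wx p)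
      + (source m σ μ (fun i => err q V i p) 0 - residual τ (fun i => Vt i p) 0)
        * (χ p.1 * W p)) := by
      intro p
      simp only [timeCoeff, errFlux, source, residual, if_true, Nat.sub_zero, pow_zero, mul_one]
      linear_combination (τ * (χ p.1 * Wx p * err q V (m - 1) p)) * hσσ
    simp only [e2]
    rw [integral_add (i1.const_mul τ), integral_const_mul, integral_const_mul, h, mul_zero,
      add_zero]
    · rfl
    refine Integrable.const_mul ?_ _
    exact ((integrable_mul_top ((hV.integrable_err hq hm).const_mul _)
      ((memLp_top_mul hχ.1.memLp_deriv hW).add (memLp_top_mul hχ.1.memLp hWt))).add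
      (integrable_mul_top (hV.integrable_errFlux hf hq hm) (memLp_top_mul hχ.1.memLp hWx))).add
      (integrable_mul_top ((integrable_source (fun _ hi => hV.integrable_err hq hi) hm).sub
        (hV.integrable_residual hm)) (memLp_top_mul hχ.1.memLp hW))
  · filter_upwards [hB₀, hB₁, hB₂, hB₃] with p h0 h1 h2 h3
    have hη : err q V 0 p ^ 2 / 2 ≤ errEnergy m τ q V p := by
      have := single_le_energy hτ (fun j => err q V j p) hm
      simp only [timeCoeff, if_true] at this
      unfold errEnergy; linarith
    set η := errEnergy m τ q V p
    set e := |err q V 0 p| with he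
    have he0 : 0 ≤ e := abs_nonneg _
    have hη' : e ^ 2 / 2 ≤ η := by rwa [he, sq_abs]
    have hη0 : 0 ≤ η := (by positivity : 0 ≤ e ^ 2 / 2).trans hη'
    have hc := hχ.2.1 p.1
    have hd : 0 ≤ -deriv χ p.1 := by linarith [hχ.2.2 p.1]
    have hΔ : |f (q 0 p.1 p.2) - f (V 0 p)| ≤ B₃ * e + M * e ^ 2 := by
      have a1 := hM (V 0 p) (q 0 p.1 p.2)
      have a2 : f (q 0 p.1 p.2) - f (V 0 p) = deriv f (V 0 p) * err q V 0 p
          + (f (q 0 p.1 p.2) - f (V 0 p) - deriv f (V 0 p) * (q 0 p.1 p.2 - V 0 p)) := by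
        simp only [err]; ring
      rw [a2]
      refine (abs_add_le _ _).trans (add_le_add ?_ (a1.trans (le_of_eq ?_)))
      · rw [abs_mul]; exact mul_le_mul_of_nonneg_right h3 he0
      · rw [he, sq_abs, err]
    have y1 : τ * (e * B₀) ≤ ε * η + B₀ ^ 2 / (2 * ε) * τ ^ 2 := by
      have := young hε e (τ * B₀)
      have h5 : ε * (e ^ 2 / 2) ≤ ε * η := mul_le_mul_of_nonneg_left hη' hε.le
      have h6 : (τ * B₀) ^ 2 / (2 * ε) = B₀ ^ 2 / (2 * ε) * τ ^ 2 := by ring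
      linarith
    have y2 : τ * (e * B₁ + (B₃ * e + M * e ^ 2) * B₂)
        ≤ η + (B₁ + B₃ * B₂) ^ 2 / 2 * τ ^ 2 + 2 * M * B₂ * η := by
      have := young one_pos e (τ * (B₁ + B₃ * B₂))
      have h7 : τ * (M * B₂ * e ^ 2) ≤ 1 * (M * B₂ * e ^ 2) :=
        mul_le_mul_of_nonneg_right hτ1 (by positivity)
      have h8 : M * B₂ * (e ^ 2 / 2) ≤ M * B₂ * η :=
        mul_le_mul_of_nonneg_left hη' (by positivity)
      linarith
    have hX : |-σ * τ * (err q V 0 p * (deriv χ p.1 * W p + χ p.1 * Wt p)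
        + (f (q 0 p.1 p.2) - f (V 0 p)) * (χ p.1 * Wx p))|
        ≤ -deriv χ p.1 * (τ * (e * B₀))
          + χ p.1 * (τ * (e * B₁ + (B₃ * e + M * e ^ 2) * B₂)) := by
      rw [abs_mul, abs_mul, abs_neg, habs, one_mul, abs_of_pos hτ]
      have a1 : |deriv χ p.1 * W p| ≤ -deriv χ p.1 * B₀ := by
        rw [abs_mul, abs_of_nonpos (hχ.2.2 p.1)]; exact mul_le_mul_of_nonneg_left h0 hd
      have a2 : |χ p.1 * Wt p| ≤ χ p.1 * B₁ := by
        rw [abs_mul, abs_of_nonneg hc]; exact mul_le_mul_of_nonneg_left h1 hc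
      have a3 : |χ p.1 * Wx p| ≤ χ p.1 * B₂ := by
        rw [abs_mul, abs_of_nonneg hc]; exact mul_le_mul_of_nonneg_left h2 hc
      have a4 : |err q V 0 p * (deriv χ p.1 * W p + χ p.1 * Wt p)|
          ≤ e * (-deriv χ p.1 * B₀ + χ p.1 * B₁) := by
        rw [abs_mul]
        exact mul_le_mul_of_nonneg_left ((abs_add_le _ _).trans (add_le_add a1 a2)) he0
      have a5 : |(f (q 0 p.1 p.2) - f (V 0 p)) * (χ p.1 * Wx p)|
          ≤ (B₃ * e + M * e ^ 2) * (χ p.1 * B₂) := by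
        rw [abs_mul]
        exact mul_le_mul hΔ a3 (abs_nonneg _) (by positivity)
      have a6 := mul_le_mul_of_nonneg_left ((abs_add_le _ _).trans (add_le_add a4 a5)) hτ.le
      refine a6.trans (le_of_eq ?_)
      ring
    refine hX.trans ?_
    unfold majorant
    refine add_le_add (mul_le_mul_of_nonneg_left (y1.trans ?_) hd)
      (mul_le_mul_of_nonneg_left (y2.trans ?_) hc)
    · have : 0 ≤ (1 + (B₁ + B₃ * B₂) ^ 2 / 2 + 2 * M * B₂) * τ ^ 2 := by positivity
      linarith
    · have z1 : 0 ≤ (B₀ ^ 2 / (2 * ε) + (B₁ + B₃ * B₂) ^ 2 / 2) * η := by positivity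
      have z2 : 0 ≤ (B₀ ^ 2 / (2 * ε) + 1 + 2 * M * B₂) * τ ^ 2 := by positivity
      linarith

end IsReference

end

/-! ### The consistency error is of second order -/

section

variable {T L : ℝ} {m : ℕ} {σ μ τ : ℝ} {f : ℝ → ℝ} {V Vt Vx : ℕ → ℝ × ℝ → ℝ}
  {g : ℕ → ℝ → ℝ} {q : ℕ → ℝ → ℝ → ℝ}

namespace IsReference

lemma negligible_congr {F G : (ℕ → ℝ → ℝ → ℝ) → (ℝ → ℝ) → ℝ}
    (hF : Negligible T L m σ μ f V g F) (h : ∀ q χ, F q χ = G q χ) :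
    Negligible T L m σ μ f V g G := by
  have : F = G := by ext q χ; exact h q χ
  rwa [← this]

lemma negligible_zero (hV : IsReference T L m σ μ f V Vt Vx g) :
    Negligible T L m σ μ f V g (fun _ _ => 0) :=
  hV.negligible_of_bound fun ε hε => ⟨0, le_rfl, fun τ hτ _ q hq χ hχ => ⟨fun _ => 0, by simp,
    Eventually.of_forall fun p => by
      have h0 : 0 ≤ errEnergy m τ q V p := energy_nonneg hτ _
      have := mul_nonneg (neg_nonneg.2 (hχ.2.2 p.1)) (mul_nonneg hε.le h0)
      simpa [majorant] using this⟩⟩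

lemma negligible_finset_sum (hV : IsReference T L m σ μ f V Vt Vx g)
    {F : ℕ → (ℕ → ℝ → ℝ → ℝ) → (ℝ → ℝ) → ℝ} (n : ℕ)
    (h : ∀ j < n, Negligible T L m σ μ f V g (F j)) :
    Negligible T L m σ μ f V g (fun q χ => ∑ j ∈ Finset.range n, F j q χ) := by
  induction n with
  | zero => simpa using hV.negligible_zero
  | succ n ih =>
    simp only [Finset.sum_range_succ]
    exact hV.negligible_add (ih fun j hj => h j (by omega)) (h n (by omega))

/-- Pairings of the error components with the functions `H a = ∂ₓ^a H 0` are negligible, apart from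
the pairing of `H 0` with the last component. Derivatives are moved between the weight and the
error by the constraints `∂ₓ e_{k-1} ≈ e_k`: for `a + k ≤ m - 1` down to `e₀`, and for `a + k ≥ m`
up to `e_{m-1}`, where the conservation law takes over. In both cases no more than `m - 1` space
derivatives fall on the weight. -/
lemma negligible_pairing (hV : IsReference T L m σ μ f V Vt Vx g) (hL : 0 < L)
    (hf : IsAdmissibleFlux f) (hσ : σ = -1 ∨ σ = 1) (hm : 3 ≤ m) {H Ht : ℕ → ℝ × ℝ → ℝ}
    (mH : ∀ a < m, MemLp (H a) ∞ (strip 0 T L))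
    (mHt : ∀ a, a + 1 < m → MemLp (Ht a) ∞ (strip 0 T L))
    (wt : ∀ a, a + 1 < m → WeakT 0 T L (H a) (Ht a))
    (wx : ∀ a, a + 1 < m → WeakX 0 T L (H a) (H (a + 1))) {a k : ℕ} (ha : a < m) (hk : k < m)
    (hak : a ≠ 0 ∨ k ≠ m - 1) :
    Negligible T L m σ μ f V g (pairing T L V (H a) k) := by
  have step : ∀ a k, a + 1 < m → k + 1 < m → Negligible T L m σ μ f V g (fun q χ =>
      pairing T L V (H (a + 1)) k q χ + pairing T L V (H a) (k + 1) q χ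
      + (if k + 1 = m - 1 then σ * μ else 0) * pairing T L V (H a) 1 q χ) := fun a k ha hk =>
    hV.negligible_constraint hL hf hσ (Nat.le_add_left 1 k) hk (mH a (by omega)) (mHt a ha)
      (mH _ ha) (wt a ha) (wx a ha)
  have low : ∀ k a, a + k < m → k + 1 < m → Negligible T L m σ μ f V g (pairing T L V (H a) k) := by
    intro k
    induction k with
    | zero => exact fun a ha _ => hV.negligible_pairing_zero (by omega) (mH a (by omega))
    | succ k ih =>
      intro a ha hk
      refine negligible_congr (hV.negligible_sub (step a k (by omega) (by omega))
        (ih (a + 1) (by omega) (by omega))) fun q χ => ?_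
      rw [if_neg (by omega)]; ring
  have high : ∀ i k a, k + i + 1 = m → m ≤ a + k → a < m →
      Negligible T L m σ μ f V g (pairing T L V (H a) k) := by
    intro i
    induction i with
    | zero =>
      intro k a hk hak ha
      obtain ⟨a, rfl⟩ : ∃ b, a = b + 1 := ⟨a - 1, by omega⟩
      rw [show k = m - 1 by omega]
      exact hV.negligible_conservation hL hf hσ (by omega) (mH a (by omega)) (mHt a ha) (mH _ ha)
        (wt a ha) (wx a ha)
    | succ i ih =>
      intro k a hk hak ha
      obtain ⟨a, rfl⟩ : ∃ b, a = b + 1 := ⟨a - 1, by omega⟩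
      have h1 := hV.negligible_sub (step a k ha (by omega))
        (ih (k + 1) a (by omega) (by omega) (by omega))
      by_cases hk1 : k + 1 = m - 1
      · refine negligible_congr (hV.negligible_sub h1 (hV.negligible_const_mul
          (low 1 a (by omega) (by omega)) (σ * μ))) fun q χ => ?_
        rw [if_pos hk1]; ring
      · refine negligible_congr h1 fun q χ => ?_
        rw [if_neg hk1]; ring
  by_cases hs : a + k < m
  · by_cases hk1 : k + 1 < m
    · exact low k a hs hk1
    · omega
  · exact high (m - 1 - k) k a (by omega) (by omega) ha

/-- The relative energy inequality with the consistency error absorbed. -/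
lemma absorbed_energy_inequality (hV : IsReference T L m σ μ f V Vt Vx g) (hL : 0 < L) (hT : 0 < T)
    (hm : Odd m) (hμ : 0 ≤ μ) (hf : IsAdmissibleFlux f) (hσ : σ = -1 ∨ σ = 1)
    {H Ht : ℕ → ℝ × ℝ → ℝ}
    (mH : ∀ a < m, MemLp (H a) ∞ (strip 0 T L))
    (mHt : ∀ a, a + 1 < m → MemLp (Ht a) ∞ (strip 0 T L))
    (wt : ∀ a, a + 1 < m → WeakT 0 T L (H a) (Ht a))
    (wx : ∀ a, a + 1 < m → WeakX 0 T L (H a) (H (a + 1)))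
    (hVt : ∀ j, 1 ≤ j → j < m → Vt j
      = fun p => H j p - (if j = m - 1 then σ * μ else 0) * H 1 p) :
    ∃ K : ℝ, 0 ≤ K ∧ ∀ τ, 0 < τ → τ ≤ 1 → ∀ q, IsEntropySolution T L m σ μ τ f g q →
      ∀ χ, IsDecreasingCutoff T χ →
      0 ≤ ∫ p, (deriv χ p.1 * errEnergy m τ q V p / 2 + K * (χ p.1 * (errEnergy m τ q V p + τ ^ 2)
        - τ ^ 2 * deriv χ p.1)) ∂(strip 0 T L) := by
  obtain ⟨K₀, hK₀, hE⟩ := hV.energy_inequality hL hT hm hμ hf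
  have hneg : Negligible T L m σ μ f V g (fun q χ => ∑ j ∈ Finset.range m,
      (if j = 0 then 0 else pairing T L V (Vt j) j q χ)) := by
    refine hV.negligible_finset_sum m fun j hj => ?_
    rcases Nat.eq_zero_or_pos j with rfl | hj0
    · simpa using hV.negligible_zero
    have hm3 : 3 ≤ m := by obtain ⟨k, rfl⟩ := hm; omega
    have n1 := hV.negligible_pairing hL hf hσ hm3 mH mHt wt wx hj hj (Or.inl hj0.ne')
    have n2 := hV.negligible_pairing hL hf hσ hm3 mH mHt wt wx (a := 1) (by omega) hj
      (Or.inl one_ne_zero)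
    intro ε hε
    obtain ⟨K, hK, h⟩ := hV.negligible_sub n1 (hV.negligible_const_mul n2
      (if j = m - 1 then σ * μ else 0)) ε hε
    refine ⟨K, hK, fun τ hτ hτ1 q hq χ hχ => ?_⟩
    have e : (if j = 0 then 0 else pairing T L V (Vt j) j q χ) = pairing T L V (H j) j q χ
        - (if j = m - 1 then σ * μ else 0) * pairing T L V (H 1) j q χ := by
      rw [if_neg hj0.ne', hVt j hj0 hj]
      unfold pairing
      rw [← integral_const_mul, ← integral_sub (hV.integrable_pairing hq hχ.1 (mH j hj) hj)
        ((hV.integrable_pairing hq hχ.1 (mH 1 (by omega)) hj).const_mul _)]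
      congr 1; ext p; ring
    beta_reduce
    rw [e]
    exact h τ hτ hτ1 q hq χ hχ
  obtain ⟨K₁, hK₁, hN⟩ := hneg (1 / 2) (by norm_num)
  refine ⟨K₁ + 2 * K₀, by positivity, fun τ hτ hτ1 q hq χ hχ => ?_⟩
  have h1 := hE τ q hq χ hχ.1 hχ.2.1
  have h2 := hN τ hτ hτ1 q hq χ hχ
  have h0m := hm.pos
  have iη := hV.integrable_errEnergy hq
  have iη' := integrable_mul_top iη (hχ.1.memLp_deriv (L := L) (t₀ := 0))
  have iχη := integrable_mul_top iη (hχ.1.memLp (L := L) (t₀ := 0))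
  have ie := integrable_mul_top ((hV.memLp_err hq h0m).integrable_sq)
    (hχ.1.memLp (L := L) (t₀ := 0))
  have ir : ∀ j ∈ Finset.range m, Integrable (fun p => χ p.1 * (residual τ (fun i => Vt i p) j
      * err q V j p)) (strip 0 T L) := by
    intro j hj
    have hj' := Finset.mem_range.1 hj
    by_cases hj0 : j = 0
    · simp [residual, hj0]
    · simp only [residual, if_neg hj0]
      exact ((hV.integrable_pairing hq hχ.1 (hV.memLp_t j hj') hj').const_mul τ).congr
        (Eventually.of_forall fun p => by simp only; ring)
  have hsum : ∫ p, ∑ j ∈ Finset.range m, χ p.1 * (residual τ (fun i => Vt i p) j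
      * err q V j p) ∂(strip 0 T L) = τ * ∑ j ∈ Finset.range m,
      (if j = 0 then 0 else pairing T L V (Vt j) j q χ) := by
    rw [integral_finsetSum _ ir, Finset.mul_sum]
    refine Finset.sum_congr rfl fun j hj => ?_
    by_cases hj0 : j = 0
    · simp [residual, hj0]
    · simp only [residual, if_neg hj0, pairing]
      rw [← integral_const_mul]
      congr 1; ext p; ring
  have i1 : Integrable (fun p => errEnergy m τ q V p * deriv χ p.1
      + K₀ * (err q V 0 p ^ 2 * χ p.1)) (strip 0 T L) := iη'.add (ie.const_mul K₀)
  have i2 := integrable_finsetSum _ ir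
  have im := integrable_majorant (ε := 1 / 2) (K := K₁) (τ := τ) hχ.1 iη
  have h3 : 0 ≤ ∫ p, (errEnergy m τ q V p * deriv χ p.1
      + K₀ * (err q V 0 p ^ 2 * χ p.1)) ∂(strip 0 T L)
      - ∫ p, ∑ j ∈ Finset.range m, χ p.1 * (residual τ (fun i => Vt i p) j
      * err q V j p) ∂(strip 0 T L) := by
    rw [← integral_sub i1 i2]
    refine h1.trans_eq ?_
    congr 1; ext p
    rw [← Finset.mul_sum]; ring
  rw [hsum] at h3
  have h4 : 0 ≤ ∫ p, (errEnergy m τ q V p * deriv χ p.1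
      + K₀ * (err q V 0 p ^ 2 * χ p.1)) ∂(strip 0 T L)
      + ∫ p, majorant (1 / 2) K₁ τ χ (errEnergy m τ q V) p ∂(strip 0 T L) := by
    have := neg_le_abs (τ * ∑ j ∈ Finset.range m,
      (if j = 0 then 0 else pairing T L V (Vt j) j q χ))
    linarith
  rw [← integral_add i1 im] at h4
  refine h4.trans (integral_mono (i1.add im) ?_ fun p => ?_)
  · have iχ' := (hχ.1.memLp_deriv (L := L) (t₀ := 0)).integrable le_top
    have iχ := (hχ.1.memLp (L := L) (t₀ := 0)).integrable le_top
    refine ((iη'.div_const 2).add (((iχη.add (iχ.const_mul (τ ^ 2))).sub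
      (iχ'.const_mul (τ ^ 2))).const_mul (K₁ + 2 * K₀))).congr (Eventually.of_forall fun p => ?_)
    simp only [Pi.add_apply, Pi.sub_apply]; ring
  · have hη : err q V 0 p ^ 2 ≤ 2 * errEnergy m τ q V p := by
      have := single_le_energy hτ (fun j => err q V j p) h0m
      simp only [timeCoeff, if_true] at this
      unfold errEnergy; linarith
    have z1 := mul_le_mul_of_nonneg_left hη (mul_nonneg hK₀ (hχ.2.1 p.1))
    have z2 : 0 ≤ K₀ * τ ^ 2 * (-deriv χ p.1) :=
      mul_nonneg (by positivity) (neg_nonneg.2 (hχ.2.2 p.1))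
    have z3 : 0 ≤ K₀ * τ ^ 2 * χ p.1 := mul_nonneg (by positivity) (hχ.2.1 p.1)
    simp only [majorant]
    linarith

end IsReference

/-! ### A Gronwall argument in weak form -/

/-- A cut-off that solves the backward equation `-χ' = 2 K χ + ψ`. -/
def backwardCutoff (K T : ℝ) (ψ : ℝ → ℝ) (t : ℝ) : ℝ :=
  Real.exp (-(2 * K * t)) * ∫ s in t..T, Real.exp (2 * K * s) * ψ s

lemma hasDerivAt_backwardCutoff {K : ℝ} {ψ : ℝ → ℝ} (hψ : Continuous ψ) (t : ℝ) :
    HasDerivAt (backwardCutoff K T ψ) (-(2 * K * backwardCutoff K T ψ t + ψ t)) t := by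
  have hc : Continuous fun s => Real.exp (2 * K * s) * ψ s := by fun_prop
  have h1 : HasDerivAt (fun t => ∫ s in t..T, Real.exp (2 * K * s) * ψ s)
      (-(Real.exp (2 * K * t) * ψ t)) t :=
    intervalIntegral.integral_hasDerivAt_left (hc.intervalIntegrable _ _)
      (hc.stronglyMeasurableAtFilter _ _) hc.continuousAt
  have h2 : HasDerivAt (fun t => Real.exp (-(2 * K * t))) (Real.exp (-(2 * K * t)) * (-(2 * K))) t :=
    (((hasDerivAt_id t).const_mul (2 * K)).neg.congr_deriv (by simp)).exp
  refine (h2.mul h1).congr_deriv ?_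
  have h3 : Real.exp (-(2 * K * t)) * Real.exp (2 * K * t) = 1 := by
    rw [← Real.exp_add]; simp
  unfold backwardCutoff
  linear_combination (-ψ t) * h3

lemma isDecreasingCutoff_backward {K : ℝ} (hK : 0 ≤ K) {ψ : ℝ → ℝ} (hψ : ContDiff ℝ ∞ ψ)
    (hψ0 : ∀ t, 0 ≤ ψ t) {b : ℝ} (hb : b < T) (hψb : ∀ t, b < t → ψ t = 0) :
    IsDecreasingCutoff T (backwardCutoff K T ψ) := by
  have hd := fun t => hasDerivAt_backwardCutoff (K := K) (T := T) hψ.continuous t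
  have hn : ∀ t, 0 ≤ backwardCutoff K T ψ t := by
    intro t
    refine mul_nonneg (Real.exp_pos _).le ?_
    rcases le_or_gt t T with h | h
    · exact intervalIntegral.integral_nonneg h fun s _ => mul_nonneg (Real.exp_pos _).le (hψ0 s)
    · rw [intervalIntegral.integral_congr (g := fun _ => 0) fun s hs => ?_]
      · simp
      · rw [uIcc_of_ge h.le] at hs
        simp [hψb s (hb.trans_le hs.1)]
  refine ⟨⟨?_, b, hb, fun t ht => ?_⟩, hn, fun t => ?_⟩
  · have hc : ContDiff ℝ ∞ fun s => Real.exp (2 * K * s) * ψ s := by fun_prop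
    have e : backwardCutoff K T ψ = fun t => Real.exp (-(2 * K * t)) *
        ((∫ s in (0 : ℝ)..T, Real.exp (2 * K * s) * ψ s)
          - ∫ s in (0 : ℝ)..t, Real.exp (2 * K * s) * ψ s) := by
      ext t
      rw [backwardCutoff, intervalIntegral.integral_interval_sub_left
        (hc.continuous.intervalIntegrable _ _) (hc.continuous.intervalIntegrable _ _)]
    have hI : ContDiff ℝ ∞ fun t => ∫ s in (0 : ℝ)..t, Real.exp (2 * K * s) * ψ s := by
      have hdI : ∀ t, HasDerivAt (fun t => ∫ s in (0 : ℝ)..t, Real.exp (2 * K * s) * ψ s)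
          (Real.exp (2 * K * t) * ψ t) t := fun t =>
        intervalIntegral.integral_hasDerivAt_right (hc.continuous.intervalIntegrable _ _)
          (hc.continuous.stronglyMeasurableAtFilter _ _) hc.continuous.continuousAt
      refine contDiff_infty_iff_deriv.2 ⟨fun t => (hdI t).differentiableAt, ?_⟩
      have : deriv (fun t => ∫ s in (0 : ℝ)..t, Real.exp (2 * K * s) * ψ s)
          = fun s => Real.exp (2 * K * s) * ψ s := by ext t; exact (hdI t).deriv
      rwa [this]
    rw [e]
    fun_prop
  · unfold backwardCutoff
    rw [intervalIntegral.integral_congr (g := fun _ => 0) fun s hs => ?_]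
    · simp
    · have : b < s := lt_of_lt_of_le (lt_min ht hb) hs.1
      simp [hψb s this]
  · rw [(hd t).deriv]
    have := mul_nonneg (mul_nonneg zero_le_two hK) (hn t)
    linarith [hψ0 t]

lemma backwardCutoff_le {K : ℝ} (hK : 0 ≤ K) {ψ : ℝ → ℝ} (hψ : Continuous ψ)
    (hψ0 : ∀ t, 0 ≤ ψ t) {t : ℝ} (ht : t ∈ Ioo 0 T) :
    backwardCutoff K T ψ t ≤ Real.exp (2 * K * T) * ∫ s in Ioo 0 T, ψ s := by
  have h1 : Real.exp (-(2 * K * t)) ≤ 1 := Real.exp_le_one_iff.2 (by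
    have := mul_nonneg (mul_nonneg zero_le_two hK) ht.1.le; linarith)
  have hc : Continuous fun s => Real.exp (2 * K * s) * ψ s := by fun_prop
  have h0 : 0 ≤ ∫ s in t..T, Real.exp (2 * K * s) * ψ s :=
    intervalIntegral.integral_nonneg ht.2.le fun s _ => mul_nonneg (Real.exp_pos _).le (hψ0 s)
  have h2 : ∫ s in t..T, Real.exp (2 * K * s) * ψ s
      ≤ ∫ s in t..T, Real.exp (2 * K * T) * ψ s :=
    intervalIntegral.integral_mono_on ht.2.le (hc.intervalIntegrable _ _)
      ((continuous_const.mul hψ).intervalIntegrable _ _) fun s hs =>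
      mul_le_mul_of_nonneg_right (Real.exp_le_exp.2
        (mul_le_mul_of_nonneg_left hs.2 (by positivity))) (hψ0 s)
  have h3 : ∫ s in t..T, ψ s ≤ ∫ s in (0 : ℝ)..T, ψ s :=
    intervalIntegral.integral_mono_interval ht.1.le ht.2.le le_rfl
      (Eventually.of_forall fun s => hψ0 s) (hψ.intervalIntegrable _ _)
  rw [intervalIntegral.integral_const_mul] at h2
  rw [← integral_Ioc_eq_integral_Ioo, ← intervalIntegral.integral_of_le (ht.1.trans ht.2).le]
  calc backwardCutoff K T ψ t ≤ 1 * ∫ s in t..T, Real.exp (2 * K * s) * ψ s :=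
        mul_le_mul_of_nonneg_right h1 h0
    _ ≤ Real.exp (2 * K * T) * ∫ s in t..T, ψ s := by rw [one_mul]; exact h2
    _ ≤ _ := mul_le_mul_of_nonneg_left h3 (Real.exp_pos _).le

lemma integral_time_strip {t₀ : ℝ} (hL : 0 < L) (ψ : ℝ → ℝ) :
    ∫ p, ψ p.1 ∂(strip t₀ T L) = L * ∫ t in Ioo t₀ T, ψ t := by
  rw [strip_eq_prod, integral_fun_fst]
  simp [measureReal_def, hL.le]

/-- Gronwall's inequality for `η ≥ 0` in weak form: testing with the solution of a backward
equation. -/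
lemma integral_le_of_weak_gronwall (hL : 0 < L) (hT : 0 < T) {K : ℝ} (hK : 0 ≤ K)
    {η : ℝ × ℝ → ℝ} (hη : Integrable η (strip 0 T L))
    (h : ∀ χ, IsDecreasingCutoff T χ → 0 ≤ ∫ p, (deriv χ p.1 * η p / 2
      + K * (χ p.1 * (η p + τ ^ 2) - τ ^ 2 * deriv χ p.1)) ∂(strip 0 T L))
    {ψ : ℝ → ℝ} (hψ : ContDiff ℝ ∞ ψ) (hψ0 : ∀ t, 0 ≤ ψ t)
    {b : ℝ} (hb : b < T) (hψb : ∀ t, b < t → ψ t = 0) :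
    ∫ p, ψ p.1 * η p ∂(strip 0 T L)
      ≤ 2 * L * ((K + 2 * K ^ 2) * T * Real.exp (2 * K * T) + K) * τ ^ 2
        * ∫ t in Ioo 0 T, ψ t := by
  have hχ := isDecreasingCutoff_backward hK hψ hψ0 hb hψb
  set χ := backwardCutoff K T ψ with hχd
  have h1 := h χ hχ
  have hd : ∀ t, deriv χ t = -(2 * K * χ t + ψ t) := fun t =>
    (hasDerivAt_backwardCutoff hψ.continuous t).deriv
  have hψc : IsTimeCutoff T ψ := ⟨hψ, b, hb, hψb⟩
  have iψη : Integrable (fun p => ψ p.1 * η p) (strip 0 T L) :=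
    (integrable_mul_top hη hψc.memLp).congr (Eventually.of_forall fun p => mul_comm _ _)
  have iψ := (hψc.memLp (L := L) (t₀ := 0)).integrable le_top
  have iχ := (hχ.1.memLp (L := L) (t₀ := 0)).integrable le_top
  have e : ∀ p : ℝ × ℝ, deriv χ p.1 * η p / 2
      + K * (χ p.1 * (η p + τ ^ 2) - τ ^ 2 * deriv χ p.1)
      = τ ^ 2 * ((K + 2 * K ^ 2) * χ p.1 + K * ψ p.1) - (1 / 2) * (ψ p.1 * η p) := by
    intro p; rw [hd]; ring
  have i3 : Integrable (fun p : ℝ × ℝ => (K + 2 * K ^ 2) * χ p.1 + K * ψ p.1) (strip 0 T L) :=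
    (iχ.const_mul _).add (iψ.const_mul _)
  simp only [e] at h1
  rw [integral_sub (i3.const_mul _) (iψη.const_mul _), integral_const_mul, integral_const_mul,
    integral_add (iχ.const_mul _) (iψ.const_mul _), integral_const_mul, integral_const_mul,
    integral_time_strip hL, integral_time_strip hL] at h1
  set Ψ := ∫ t in Ioo 0 T, ψ t with hΨ
  have hχΨ : ∫ t in Ioo 0 T, χ t ≤ T * (Real.exp (2 * K * T) * Ψ) := by
    have := setIntegral_mono_on (μ := volume) (s := Ioo 0 T) (f := χ)
      (g := fun _ => Real.exp (2 * K * T) * Ψ)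
      ((hχ.1.1.continuous.integrableOn_Icc (a := 0) (b := T)).mono_set Ioo_subset_Icc_self)
      (integrableOn_const (by simp)) measurableSet_Ioo
      (fun t ht => backwardCutoff_le hK hψ.continuous hψ0 ht)
    rw [setIntegral_const] at this
    simpa [measureReal_def, hT.le] using this
  have h2 : τ ^ 2 * ((K + 2 * K ^ 2) * (L * ∫ t in Ioo 0 T, χ t))
      ≤ τ ^ 2 * ((K + 2 * K ^ 2) * (L * (T * (Real.exp (2 * K * T) * Ψ)))) := by gcongr
  linarith

/-- A bound for averages against nonnegative test functions is a pointwise bound. -/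
lemma ae_le_of_integral_test {h : ℝ → ℝ} (hi : IntegrableOn h (Ioo 0 T)) {c : ℝ}
    (hc : ∀ ψ : ℝ → ℝ, ContDiff ℝ ∞ ψ → (∀ t, 0 ≤ ψ t) →
      (∃ b < T, ∀ t, b < t → ψ t = 0) →
      ∫ t in Ioo 0 T, ψ t * h t ≤ c * ∫ t in Ioo 0 T, ψ t) :
    ∀ᵐ t ∂(volume.restrict (Ioo 0 T)), h t ≤ c := by
  let ρ : ℕ → ContDiffBump (0 : ℝ) := fun n =>
    ⟨1 / (n + 1) / 2, 1 / (n + 1), by positivity, by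
      have : (0 : ℝ) < 1 / (n + 1) := by positivity
      linarith⟩
  have hρ : Tendsto (fun n => (ρ n).rOut) atTop (𝓝 0) := tendsto_one_div_add_atTop_nhds_zero_nat
  have hi' : Integrable ((Ioo 0 T).indicator h) := hi.integrable_indicator measurableSet_Ioo
  have hae := ContDiffBump.ae_convolution_tendsto_right_of_locallyIntegrable (μ := volume) (φ := ρ)
    (K := 2) hρ (Eventually.of_forall fun n => by simp only [ρ]; linarith) hi'.locallyIntegrable
  filter_upwards [ae_restrict_of_ae hae, ae_restrict_mem measurableSet_Ioo] with t ht hm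
  rw [indicator_of_mem hm] at ht
  refine le_of_tendsto ht ?_
  have hd : 0 < min t (T - t) := lt_min hm.1 (by linarith [hm.2])
  filter_upwards [hρ.eventually_lt_const hd] with n hn
  rw [lt_min_iff] at hn
  set ψ : ℝ → ℝ := fun s => (ρ n).normed volume (t - s) with hψ
  have hψ0 : ∀ s, (ρ n).rOut ≤ |t - s| → ψ s = 0 := fun s hs => by
    simp only [hψ]
    rw [← Function.notMem_support, (ρ n).support_normed_eq, mem_ball_zero_iff, Real.norm_eq_abs]
    exact not_lt.2 hs
  have h1 := hc ψ ((ρ n).contDiff_normed.comp (contDiff_const.sub contDiff_id))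
    (fun s => (ρ n).nonneg_normed _) ⟨t + (ρ n).rOut, by linarith, fun s hs => hψ0 s (by
      rw [abs_sub_comm]; exact le_abs.2 (Or.inl (by linarith)))⟩
  have h2 : ∫ s in Ioo 0 T, ψ s = 1 := by
    rw [setIntegral_eq_integral_of_forall_compl_eq_zero]
    · simp only [hψ]
      rw [integral_sub_left_eq_self ((ρ n).normed volume) volume t]
      exact (ρ n).integral_normed
    · intro s hs
      apply hψ0
      by_contra hcon
      rw [not_le, abs_lt] at hcon
      exact hs ⟨by linarith, by linarith⟩
  rw [h2, mul_one] at h1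
  refine le_trans (le_of_eq ?_) h1
  rw [convolution_eq_swap, ← integral_indicator measurableSet_Ioo]
  congr 1; ext s
  by_cases hs : s ∈ Ioo 0 T
  · simp [indicator_of_mem hs, hψ]
  · simp [indicator_of_notMem hs]

end

/-! ### The limit solution as a reference state -/

section

variable {T L : ℝ} {m : ℕ} {σ μ τ : ℝ} {f : ℝ → ℝ} {u₀ : ℝ → ℝ} {d : ℕ → ℝ → ℝ}
  {u : ℝ → ℝ → ℝ} {D : ℕ → ℕ → ℝ → ℝ → ℝ}

lemma IsCauchyTest.mixedDeriv_t {φ : ℝ → ℝ → ℝ} (h : IsCauchyTest T L φ) :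
    IsCauchyTest T L (mixedDeriv 1 0 φ) := by
  obtain ⟨hs, c, hc, h0⟩ := h
  refine ⟨hs.dt, c, hc, fun t x ht => ?_⟩
  rw [mixedDeriv_one_zero]
  have : (fun s => φ s x) =ᶠ[𝓝 t] fun _ => 0 := by
    filter_upwards [lt_mem_nhds ht] with s hs' using h0 s x hs'
  rw [this.deriv_eq]; simp

namespace IsSobolev

lemma memLp (hu : IsSobolev T L m u D) {a b : ℕ} (h : a + b ≤ m) :
    MemLp (fun p : ℝ × ℝ => D a b p.1 p.2) ∞ (strip 0 T L) := (hu.2 a b h).1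

lemma ae_eq (hu : IsSobolev T L m u D) (hL : 0 < L) :
    ∀ᵐ p ∂(strip 0 T L), D 0 0 p.1 p.2 = u p.1 p.2 := by
  have i1 := (hu.memLp (a := 0) (b := 0) (by omega)).integrable le_top
  have i2 : Integrable (fun p : ℝ × ℝ => u p.1 p.2) (strip 0 T L) :=
    MemLp.integrable (μ := strip 0 T L) le_top hu.1
  have := ae_eq_zero_of_integral_test hL (i1.sub i2) fun φ hφ => by
    have hc := memLp_top_of_continuous (t₀ := 0) (T := T) (L := L) hφ.1.continuous
    have := (hu.2 0 0 (by omega)).2 φ hφ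
    simp only [mixedDeriv_zero_zero, add_zero, pow_zero, one_mul] at this
    simp only [Pi.sub_apply, sub_mul]
    rw [integral_sub (integrable_mul_top i1 hc) (integrable_mul_top i2 hc)]
    exact sub_eq_zero.2 this.symm
  filter_upwards [this] with p hp using sub_eq_zero.1 hp

lemma weak_test (hu : IsSobolev T L m u D) {a b k : ℕ} (h : a + b + k ≤ m) {φ : ℝ → ℝ → ℝ}
    (hφ : IsTest 0 T L φ) :
    ∫ p, D a b p.1 p.2 * mixedDeriv 0 k φ p.1 p.2 ∂(strip 0 T L)
      = (-1) ^ k * ∫ p, D a (b + k) p.1 p.2 * φ p.1 p.2 ∂(strip 0 T L) := by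
  have h1 := (hu.2 a b (by omega)).2 _ (hφ.mixedDeriv_x k)
  have h2 := (hu.2 a (b + k) (by omega)).2 φ hφ
  rw [mixedDeriv_x_iter, h2, ← add_assoc, pow_add _ (a + b) k, mul_assoc] at h1
  exact (mul_left_cancel₀ (pow_ne_zero _ (by norm_num)) h1).symm

lemma weak_cauchy (hu : IsSobolev T L m u D) {a b k : ℕ} (h : a + b + k ≤ m) {φ : ℝ → ℝ → ℝ}
    (hφ : IsCauchyTest T L φ) :
    ∫ p, D a b p.1 p.2 * mixedDeriv 0 k φ p.1 p.2 ∂(strip 0 T L)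
      = (-1) ^ k * ∫ p, D a (b + k) p.1 p.2 * φ p.1 p.2 ∂(strip 0 T L) :=
  integral_cauchy_of_test ((hu.memLp (by omega)).integrable le_top)
    ((hu.memLp (by omega)).integrable le_top) k _ (fun _ hψ => hu.weak_test h hψ) hφ

lemma weakX (hu : IsSobolev T L m u D) {a b : ℕ} (h : a + b + 1 ≤ m) :
    WeakX 0 T L (fun p => D a b p.1 p.2) (fun p => D a (b + 1) p.1 p.2) := fun φ hφ => by
  rw [hu.weak_test h hφ]; ring

lemma weakT (hu : IsSobolev T L m u D) {a b : ℕ} (h : a + b + 1 ≤ m) :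
    WeakT 0 T L (fun p => D a b p.1 p.2) (fun p => D (a + 1) b p.1 p.2) := fun φ hφ => by
  have h1 := (hu.2 a b (by omega)).2 _ hφ.mixedDeriv_t
  have h2 := (hu.2 (a + 1) b (by omega)).2 φ hφ
  rw [hφ.1.mixedDeriv_t, h2, add_right_comm, pow_succ, mul_assoc] at h1
  have := mul_left_cancel₀ (pow_ne_zero _ (by norm_num)) h1
  rw [neg_one_mul] at this
  exact this.symm

/-- The viscous term is bounded even if `m = 1`, when `∂_x² u` need not exist, because `μ = 0` then. -/
lemma memLp_viscous (hu : IsSobolev T L m u D) (hm : Odd m) (hmμ : m = 1 → μ = 0) :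
    MemLp (fun p : ℝ × ℝ => μ * D 0 2 p.1 p.2) ∞ (strip 0 T L) := by
  by_cases h1 : m = 1
  · simp [hmμ h1]
  · obtain ⟨k, rfl⟩ := hm
    exact (hu.memLp (a := 0) (b := 2) (by omega)).const_mul μ

end IsSobolev

/-- The spatial part of the limit equation, `∂_x f(u) - μ ∂_x² u + σ ∂_x^m u`. -/
def spatialPart (m : ℕ) (σ μ : ℝ) (f : ℝ → ℝ) (D : ℕ → ℕ → ℝ → ℝ → ℝ) (p : ℝ × ℝ) : ℝ :=
  deriv f (D 0 0 p.1 p.2) * D 0 1 p.1 p.2 - μ * D 0 2 p.1 p.2 + σ * D 0 m p.1 p.2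

lemma IsSobolev.memLp_spatialPart (hu : IsSobolev T L m u D) (hm : Odd m) (hmμ : m = 1 → μ = 0)
    (hf : IsAdmissibleFlux f) : MemLp (spatialPart m σ μ f D) ∞ (strip 0 T L) := by
  obtain ⟨M, -, -, hf', -⟩ := hf.exists_lipschitz
  have := hm.pos
  exact ((memLp_top_mul (WeakX.comp_memLp hf' (hu.memLp (a := 0) (b := 0) (by omega)))
    (hu.memLp (a := 0) (b := 1) (by omega))).sub (hu.memLp_viscous hm hmμ)).add
      ((hu.memLp (a := 0) (b := m) (by omega)).const_mul σ)

namespace IsLimitSolution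

/-- The limit equation with all space derivatives moved from the test function to the solution. -/
lemma weak_spatialPart (hsol : IsLimitSolution T L m σ μ f u₀ u) (hu : IsSobolev T L m u D)
    (hL : 0 < L) (hm : Odd m) (hmμ : m = 1 → μ = 0) (hf : IsAdmissibleFlux f)
    {φ : ℝ → ℝ → ℝ} (hφ : IsCauchyTest T L φ) :
    ∫ p, D 0 0 p.1 p.2 * mixedDeriv 1 0 φ p.1 p.2 ∂(strip 0 T L)
      - ∫ p, spatialPart m σ μ f D p * φ p.1 p.2 ∂(strip 0 T L)
      + ∫ x, u₀ x * φ 0 x ∂(period L) = 0 := by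
  have hm0 := hm.pos
  obtain ⟨M, -, hfd, hf', -⟩ := hf.exists_lipschitz
  have c0 := memLp_top_of_continuous (t₀ := 0) (T := T) (L := L) hφ.1.continuous
  have ct := memLp_top_of_continuous (t₀ := 0) (T := T) (L := L) hφ.1.dt.continuous
  have cx := fun k => memLp_top_of_continuous (t₀ := 0) (T := T) (L := L) (hφ.1.dx_iter k).continuous
  have mU := hu.memLp (a := 0) (b := 0) (by omega)
  have mUx := hu.memLp (a := 0) (b := 1) (by omega)
  have iU := mU.integrable le_top
  have mf := WeakX.comp_memLp hf.1 mU
  have mf' := memLp_top_mul (WeakX.comp_memLp hf' mU) mUx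
  have mv := hu.memLp_viscous hm hmμ
  have mm := (hu.memLp (a := 0) (b := m) (by omega)).integrable le_top
  have h1 : ∫ p, f (D 0 0 p.1 p.2) * mixedDeriv 0 1 φ p.1 p.2 ∂(strip 0 T L)
      = -∫ p, deriv f (D 0 0 p.1 p.2) * D 0 1 p.1 p.2 * φ p.1 p.2 ∂(strip 0 T L) :=
    (WeakX.comp hL mU mUx (hu.weakX (a := 0) (b := 0) (by omega)) hfd hf').cauchy
      (mf.integrable le_top) (mf'.integrable le_top) hφ
  have h2 : ∫ p, μ * (D 0 0 p.1 p.2 * mixedDeriv 0 2 φ p.1 p.2) ∂(strip 0 T L)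
      = ∫ p, μ * D 0 2 p.1 p.2 * φ p.1 p.2 ∂(strip 0 T L) := by
    by_cases hm1 : m = 1
    · simp [hmμ hm1]
    · have h3 : 2 ≤ m := by omega
      have := hu.weak_cauchy (a := 0) (b := 0) (k := 2) (by omega) hφ
      simp only [mul_assoc, integral_const_mul]
      rw [this]; norm_num
  have h3 : ∫ p, σ * ((-1) ^ m * (D 0 0 p.1 p.2 * mixedDeriv 0 m φ p.1 p.2)) ∂(strip 0 T L)
      = ∫ p, σ * D 0 m p.1 p.2 * φ p.1 p.2 ∂(strip 0 T L) := by
    have := hu.weak_cauchy (a := 0) (b := 0) (k := m) (by omega) hφ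
    simp only [mul_assoc, integral_const_mul]
    rw [this, ← mul_assoc ((-1) ^ m), ← mul_pow]; norm_num
  have e : ∫ p, (u p.1 p.2 * mixedDeriv 1 0 φ p.1 p.2
        + f (u p.1 p.2) * mixedDeriv 0 1 φ p.1 p.2
        + μ * (u p.1 p.2 * mixedDeriv 0 2 φ p.1 p.2)
        - σ * ((-1) ^ m * (u p.1 p.2 * mixedDeriv 0 m φ p.1 p.2))) ∂(cell T L)
      = ∫ p, (D 0 0 p.1 p.2 * mixedDeriv 1 0 φ p.1 p.2
        + f (D 0 0 p.1 p.2) * mixedDeriv 0 1 φ p.1 p.2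
        + μ * (D 0 0 p.1 p.2 * mixedDeriv 0 2 φ p.1 p.2)
        + -(σ * ((-1) ^ m * (D 0 0 p.1 p.2 * mixedDeriv 0 m φ p.1 p.2)))) ∂(strip 0 T L) := by
    refine integral_congr_ae ?_
    filter_upwards [hu.ae_eq hL] with p hp
    rw [hp]; ring
  have iμ : Integrable (fun p : ℝ × ℝ => μ * D 0 2 p.1 p.2) (strip 0 T L) := mv.integrable le_top
  have iσ : Integrable (fun p : ℝ × ℝ => σ * D 0 m p.1 p.2) (strip 0 T L) := mm.const_mul σ
  have e2 : ∫ p, spatialPart m σ μ f D p * φ p.1 p.2 ∂(strip 0 T L)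
      = ∫ p, deriv f (D 0 0 p.1 p.2) * D 0 1 p.1 p.2 * φ p.1 p.2 ∂(strip 0 T L)
        - ∫ p, μ * D 0 2 p.1 p.2 * φ p.1 p.2 ∂(strip 0 T L)
        + ∫ p, σ * D 0 m p.1 p.2 * φ p.1 p.2 ∂(strip 0 T L) := by
    have i1 := integrable_mul_top (mf'.integrable le_top) c0
    have i2 := integrable_mul_top iμ c0
    have i3 := integrable_mul_top iσ c0
    have i12 : Integrable (fun p : ℝ × ℝ => deriv f (D 0 0 p.1 p.2) * D 0 1 p.1 p.2 * φ p.1 p.2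
        - μ * D 0 2 p.1 p.2 * φ p.1 p.2) (strip 0 T L) := i1.sub i2
    rw [← integral_sub i1 i2, ← integral_add i12 i3]
    congr 1; ext p; simp only [spatialPart]; ring
  have im : Integrable (fun p : ℝ × ℝ => -(σ * ((-1) ^ m * (D 0 0 p.1 p.2 * mixedDeriv 0 m φ p.1 p.2))))
      (strip 0 T L) := (((integrable_mul_top iU (cx m)).const_mul _).const_mul σ).neg
  have h := hsol φ hφ
  rw [e, integral_add_four (integrable_mul_top iU ct) (integrable_mul_top (mf.integrable le_top) (cx 1))
    ((integrable_mul_top iU (cx 2)).const_mul μ) im, integral_neg, h1, h2, h3] at h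
  rw [e2]
  linarith

/-- The limit equation holds almost everywhere. -/
lemma ae_equation (hsol : IsLimitSolution T L m σ μ f u₀ u) (hu : IsSobolev T L m u D)
    (hL : 0 < L) (hm : Odd m) (hmμ : m = 1 → μ = 0) (hf : IsAdmissibleFlux f) :
    ∀ᵐ p ∂(strip 0 T L), D 1 0 p.1 p.2 + spatialPart m σ μ f D p = 0 := by
  have hm0 := hm.pos
  have i1 := (hu.memLp (a := 1) (b := 0) (by omega)).integrable le_top
  have i2 := (hu.memLp_spatialPart (σ := σ) hm hmμ hf).integrable le_top
  refine ae_eq_zero_of_integral_test hL (i1.add i2) fun φ hφ => ?_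
  have c0 := memLp_top_of_continuous (t₀ := 0) (T := T) (L := L) hφ.1.continuous
  have h := hsol.weak_spatialPart hu hL hm hmμ hf hφ.cauchy
  have h0 : ∀ x, φ 0 x = 0 := by
    obtain ⟨-, a, b, ha, hb, h0⟩ := hφ
    exact fun x => h0 0 x (Or.inl ha)
  rw [hu.weakT (a := 0) (b := 0) (by omega) φ hφ] at h
  simp only [h0, mul_zero, integral_zero, add_zero] at h
  simp only [add_mul]
  rw [integral_add (integrable_mul_top i1 c0) (integrable_mul_top i2 c0)]
  linarith

/-- The solution and its space derivatives attain their initial values. -/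
lemma trace (hsol : IsLimitSolution T L m σ μ f u₀ u) (hu : IsSobolev T L m u D)
    (hu₀ : IsSobolevPeriod L m u₀ d)
    (hL : 0 < L) (hm : Odd m) (hmμ : m = 1 → μ = 0) (hf : IsAdmissibleFlux f)
    {j : ℕ} (hj : j < m) {φ : ℝ → ℝ → ℝ} (hφ : IsCauchyTest T L φ) :
    ∫ p, D 0 j p.1 p.2 * mixedDeriv 1 0 φ p.1 p.2 ∂(strip 0 T L)
      + ∫ p, D 1 j p.1 p.2 * φ p.1 p.2 ∂(strip 0 T L) + ∫ x, d j x * φ 0 x ∂(period L) = 0 := by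
  have h := hsol.weak_spatialPart hu hL hm hmμ hf (hφ.mixedDeriv_x j)
  have e : ∫ p, spatialPart m σ μ f D p * mixedDeriv 0 j φ p.1 p.2 ∂(strip 0 T L)
      = -∫ p, D 1 0 p.1 p.2 * mixedDeriv 0 j φ p.1 p.2 ∂(strip 0 T L) := by
    rw [← integral_neg]
    refine integral_congr_ae ?_
    filter_upwards [hsol.ae_equation hu hL hm hmμ hf] with p hp
    rw [eq_neg_of_add_eq_zero_right hp]; ring
  have e0 : ∫ x, u₀ x * mixedDeriv 0 j φ 0 x ∂(period L)
      = (-1) ^ j * ∫ x, d j x * φ 0 x ∂(period L) := by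
    have := (hu₀.2 j hj.le).2 (φ 0)
      (hφ.1.smooth.comp (contDiff_const.prodMk contDiff_id)) (hφ.1.periodic 0)
    simpa [mixedDeriv] using this
  rw [hφ.1.dt_dx_iter, hu.weak_cauchy (a := 0) (b := 0) (k := j) (by omega) hφ.mixedDeriv_t, e,
    hu.weak_cauchy (a := 1) (b := 0) (k := j) (by omega) hφ, e0, zero_add] at h
  refine mul_left_cancel₀ (pow_ne_zero j (by norm_num : (-1 : ℝ) ≠ 0)) ?_
  linear_combination h

end IsLimitSolution

/-- The component `j` of the state `(u, ∂_x u, …, ∂_x^{m-2} u, ∂_x^{m-1} u - σ μ ∂_x u)`,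
differentiated `a` times in time and `b` times in space. -/
def limitState (m : ℕ) (σ μ : ℝ) (D : ℕ → ℕ → ℝ → ℝ → ℝ) (a b j : ℕ) (p : ℝ × ℝ) : ℝ :=
  D a (j + b) p.1 p.2 - (if j = m - 1 then σ * μ else 0) * D a (1 + b) p.1 p.2

/-- The correction of the last component is absent unless the derivatives in it exist. -/
lemma correction_cases (hm : Odd m) (hmμ : m = 1 → μ = 0) (j : ℕ) :
    (if j = m - 1 then σ * μ else 0) = 0 ∨ 3 ≤ m := by
  by_cases h1 : m = 1
  · left; simp [hmμ h1]
  · right; obtain ⟨k, rfl⟩ := hm; omega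

lemma IsSobolev.memLp_limitState (hu : IsSobolev T L m u D) (hm : Odd m) (hmμ : m = 1 → μ = 0)
    {a b j : ℕ} (hab : a + b ≤ 1) (hj : j < m) :
    MemLp (limitState m σ μ D a b j) ∞ (strip 0 T L) := by
  have h1 := hu.memLp (a := a) (b := j + b) (by omega)
  rcases correction_cases (σ := σ) hm hmμ j with h | h
  · unfold limitState; rw [h]; simpa using h1
  · exact h1.sub ((hu.memLp (a := a) (b := 1 + b) (by omega)).const_mul _)

lemma IsSobolev.weakX_limitState (hu : IsSobolev T L m u D) (hm : Odd m) (hmμ : m = 1 → μ = 0)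
    {j : ℕ} (hj : j < m) :
    WeakX 0 T L (limitState m σ μ D 0 0 j) (limitState m σ μ D 0 1 j) := by
  have h1 := hu.weakX (a := 0) (b := j) (by omega)
  rcases correction_cases (σ := σ) hm hmμ j with h | h
  · unfold limitState; rw [h]; simpa using h1
  · have h2 := (hu.weakX (a := 0) (b := 1) (by omega)).const_mul
      (-(if j = m - 1 then σ * μ else 0))
    have := h1.add h2 ((hu.memLp (by omega)).integrable le_top)
      ((hu.memLp (by omega)).integrable le_top)
      (((hu.memLp (by omega)).integrable le_top).const_mul _)
      (((hu.memLp (by omega)).integrable le_top).const_mul _)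
    simp only [neg_mul, ← sub_eq_add_neg] at this
    exact this

lemma IsLimitSolution.trace_limitState (hsol : IsLimitSolution T L m σ μ f u₀ u)
    (hu : IsSobolev T L m u D) (hu₀ : IsSobolevPeriod L m u₀ d)
    (hL : 0 < L) (hm : Odd m) (hmμ : m = 1 → μ = 0) (hf : IsAdmissibleFlux f)
    {j : ℕ} (hj : j < m) {φ : ℝ → ℝ → ℝ} (hφ : IsCauchyTest T L φ) :
    ∫ p, (limitState m σ μ D 0 0 j p * mixedDeriv 1 0 φ p.1 p.2
        + limitState m σ μ D 1 0 j p * φ p.1 p.2) ∂(strip 0 T L)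
      + ∫ x, initialData m σ μ d j x * φ 0 x ∂(period L) = 0 := by
  have c0 := memLp_top_of_continuous (t₀ := 0) (T := T) (L := L) hφ.1.continuous
  have ct := memLp_top_of_continuous (t₀ := 0) (T := T) (L := L) hφ.1.dt.continuous
  have i0 : ∀ k ≤ m, Integrable (fun x => d k x * φ 0 x) (period L) := fun k hk => by
    have hc : Continuous (φ 0) :=
      hφ.1.continuous.comp (continuous_const.prodMk continuous_id)
    obtain ⟨B, hB⟩ := (isCompact_Icc (a := (0 : ℝ)) (b := L)).exists_bound_of_continuousOn
      hc.continuousOn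
    have : IsFiniteMeasure (period L) := by unfold period; infer_instance
    refine integrable_mul_top ((hu₀.2 k hk).1.integrable le_top)
      (memLp_top_of_bound hc.aestronglyMeasurable B ?_)
    exact (ae_restrict_mem measurableSet_Ioo).mono fun x hx => hB x (Ioo_subset_Icc_self hx)
  have key : ∀ k < m, ∫ p, (D 0 k p.1 p.2 * mixedDeriv 1 0 φ p.1 p.2 + D 1 k p.1 p.2 * φ p.1 p.2)
      ∂(strip 0 T L) + ∫ x, d k x * φ 0 x ∂(period L) = 0 := fun k hk => by
    rw [integral_add (integrable_mul_top ((hu.memLp (by omega)).integrable le_top) ct)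
      (integrable_mul_top ((hu.memLp (by omega)).integrable le_top) c0)]
    exact hsol.trace hu hu₀ hL hm hmμ hf hk hφ
  have ii : ∀ k < m, Integrable (fun p : ℝ × ℝ => D 0 k p.1 p.2 * mixedDeriv 1 0 φ p.1 p.2
      + D 1 k p.1 p.2 * φ p.1 p.2) (strip 0 T L) := fun k hk =>
    (integrable_mul_top ((hu.memLp (by omega)).integrable le_top) ct).add
      (integrable_mul_top ((hu.memLp (by omega)).integrable le_top) c0)
  have hg : ∀ x, initialData m σ μ d j x
      = d j x - (if j = m - 1 then σ * μ else 0) * d 1 x := fun x => by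
    unfold initialData; split_ifs <;> ring
  simp only [limitState, hg, add_zero]
  rcases correction_cases (σ := σ) hm hmμ j with h | h
  · rw [h]; simpa using key j hj
  · set c : ℝ := if j = m - 1 then σ * μ else 0
    have k1 := key 1 (by omega)
    have kj := key j hj
    have e1 : ∫ p, ((D 0 j p.1 p.2 - c * D 0 1 p.1 p.2) * mixedDeriv 1 0 φ p.1 p.2
        + (D 1 j p.1 p.2 - c * D 1 1 p.1 p.2) * φ p.1 p.2) ∂(strip 0 T L)
        = ∫ p, (D 0 j p.1 p.2 * mixedDeriv 1 0 φ p.1 p.2 + D 1 j p.1 p.2 * φ p.1 p.2)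
            ∂(strip 0 T L)
          - c * ∫ p, (D 0 1 p.1 p.2 * mixedDeriv 1 0 φ p.1 p.2 + D 1 1 p.1 p.2 * φ p.1 p.2)
            ∂(strip 0 T L) := by
      rw [← integral_const_mul, ← integral_sub (ii j hj) ((ii 1 (by omega)).const_mul c)]
      congr 1; ext p; ring
    have e2 : ∫ x, (d j x - c * d 1 x) * φ 0 x ∂(period L)
        = ∫ x, d j x * φ 0 x ∂(period L) - c * ∫ x, d 1 x * φ 0 x ∂(period L) := by
      rw [← integral_const_mul, ← integral_sub (i0 j hj.le) ((i0 1 (by omega)).const_mul c)]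
      congr 1; ext x; ring
    rw [e1, e2]
    linear_combination kj - c * k1

lemma limitState_constraint (hm : Odd m) (hσ : σ = -1 ∨ σ = 1) {j : ℕ} (hj : 1 ≤ j) (hjm : j < m)
    (p : ℝ × ℝ) :
    σ * (-1) ^ j * limitState m σ μ D 0 1 (m - 1 - j) p
      = source m σ μ (fun i => limitState m σ μ D 0 0 i p) j := by
  have hσ2 : σ * σ = 1 := by rcases hσ with rfl | rfl <;> norm_num
  have hm3 : 3 ≤ m := by obtain ⟨k, rfl⟩ := hm; omega
  have n1 : m - 1 - j ≠ m - 1 := by omega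
  have e1 : m - 1 - j + 1 = m - j := by omega
  have n0 : j ≠ 0 := by omega
  have n2 : (1 : ℕ) ≠ m - 1 := by omega
  simp only [limitState, source, if_neg n1, if_neg n0, if_neg n2, e1, add_zero]
  by_cases h1 : j = 1
  · subst h1
    simp only [if_true]
    linear_combination -μ * D 0 1 p.1 p.2 * hσ2
  · have n3 : m - j ≠ m - 1 := by omega
    rw [if_neg n3, if_neg h1]; ring

lemma IsLimitSolution.isReference (hsol : IsLimitSolution T L m σ μ f u₀ u)
    (hu : IsSobolev T L m u D) (hu₀ : IsSobolevPeriod L m u₀ d)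
    (hL : 0 < L) (hm : Odd m) (hσ : σ = -1 ∨ σ = 1) (hmμ : m = 1 → μ = 0)
    (hf : IsAdmissibleFlux f) :
    IsReference T L m σ μ f (limitState m σ μ D 0 0) (limitState m σ μ D 1 0)
      (limitState m σ μ D 0 1) (initialData m σ μ d) where
  memLp j hj := hu.memLp_limitState hm hmμ (by omega) hj
  memLp_t j hj := hu.memLp_limitState hm hmμ (by omega) hj
  memLp_x j hj := hu.memLp_limitState hm hmμ (by omega) hj
  memLp_init j hj := by
    unfold initialData
    by_cases h : j = m - 1
    · simp only [if_pos h]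
      exact (hu₀.2 j hj.le).1.sub ((hu₀.2 1 (by omega)).1.const_mul _)
    · simp only [if_neg h]; exact (hu₀.2 j hj.le).1
  weak_x j hj := hu.weakX_limitState hm hmμ hj
  trace j hj φ hφ := hsol.trace_limitState hu hu₀ hL hm hmμ hf hj hφ
  conservation := by
    filter_upwards [hsol.ae_equation hu hL hm hmμ hf] with p hp
    have hm0 := hm.pos
    have hσ2 : σ * σ = 1 := by rcases hσ with rfl | rfl <;> norm_num
    have e1 : m - 1 + 1 = m := by omega
    simp only [spatialPart] at hp
    by_cases h1 : m = 1
    · have hμ := hmμ h1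
      subst h1 hμ
      simp only [limitState, mul_zero, zero_mul, ite_self, sub_zero, Nat.sub_self, zero_add]
      linear_combination hp
    · have n0 : (0 : ℕ) ≠ m - 1 := by omega
      simp only [limitState, if_neg n0, e1, if_true, add_zero, zero_add, zero_mul, sub_zero]
      linear_combination hp + (-μ * D 0 2 p.1 p.2) * hσ2
  constraint j hj hjm p := limitState_constraint hm hσ hj hjm p

end

/-! ### From the energy density to the norms -/

section

variable {T L : ℝ} {m : ℕ} {σ μ τ : ℝ} {f : ℝ → ℝ} {V Vt Vx : ℕ → ℝ × ℝ → ℝ}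
  {g : ℕ → ℝ → ℝ}

/-- A bound on the energy at almost every time, from the weak bound on its time averages. -/
lemma ae_slice_integral_le {η : ℝ × ℝ → ℝ} (hη : Integrable η (strip 0 T L)) {c : ℝ}
    (hc : ∀ ψ : ℝ → ℝ, ContDiff ℝ ∞ ψ → (∀ t, 0 ≤ ψ t) → (∃ b < T, ∀ t, b < t → ψ t = 0) →
      ∫ p, ψ p.1 * η p ∂(strip 0 T L) ≤ c * ∫ t in Ioo 0 T, ψ t) :
    ∀ᵐ t ∂(volume.restrict (Ioo 0 T)), ∫ x in Ioo 0 L, η (t, x) ≤ c := by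
  have hη' := hη
  rw [strip_eq_prod] at hη'
  refine ae_le_of_integral_test hη'.integral_prod_left fun ψ hψ hψ0 hψb => ?_
  refine le_trans (le_of_eq ?_) (hc ψ hψ hψ0 hψb)
  obtain ⟨b, hb, hb0⟩ := hψb
  have hi : Integrable (fun p => ψ p.1 * η p) (strip 0 T L) :=
    (integrable_mul_top hη (IsTimeCutoff.memLp ⟨hψ, b, hb, hb0⟩)).congr
      (Eventually.of_forall fun p => mul_comm _ _)
  rw [strip_eq_prod] at hi ⊢
  rw [integral_prod _ hi]
  simp only [integral_const_mul]

/-- An `L^∞(0,T; L²)` bound from a bound on the energy at almost every time. -/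
lemma ofReal_mul_normLinfL2_le {η : ℝ × ℝ → ℝ} (hη : Integrable η (strip 0 T L))
    (h0 : ∀ p, 0 ≤ η p) {A : ℝ}
    (hA : ∀ᵐ t ∂(volume.restrict (Ioo 0 T)), ∫ x in Ioo 0 L, η (t, x) ≤ A)
    {w : ℝ → ℝ → ℝ} {s : ℝ} (hs : 0 ≤ s)
    (hw : ∀ᵐ p ∂(strip 0 T L), (s * w p.1 p.2) ^ 2 ≤ 2 * η p) :
    ENNReal.ofReal s * normLinfL2 T L w ≤ ENNReal.ofReal (Real.sqrt (2 * A)) := by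
  rw [strip_eq_prod] at hη hw
  unfold normLinfL2
  rw [← ENNReal.essSup_const_mul]
  refine essSup_le_of_ae_le _ ?_
  filter_upwards [hA, hη.prod_right_ae, Measure.ae_ae_of_ae_prod hw] with t ht hi hwt
  have h2 : ENNReal.ofReal s * eLpNorm (w t) 2 (period L)
      = eLpNorm (fun x => s * w t x) 2 (period L) := by
    have := eLpNorm_const_smul s (w t) 2 (period L)
    rw [show s • w t = fun x => s * w t x from rfl] at this
    rw [this, Real.enorm_eq_ofReal hs]
  rw [h2]
  have h3 : eLpNorm (fun x => s * w t x) 2 (period L) ^ (2 : ℝ)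
      = ∫⁻ x, ‖s * w t x‖ₑ ^ (2 : ℝ) ∂(period L) := by
    simpa using eLpNorm_nnreal_pow_eq_lintegral (f := fun x => s * w t x) (p := 2)
      (μ := period L) (by norm_num)
  have h4 : ∫⁻ x, ‖s * w t x‖ₑ ^ (2 : ℝ) ∂(period L) ≤ ENNReal.ofReal (2 * A) := by
    calc ∫⁻ x, ‖s * w t x‖ₑ ^ (2 : ℝ) ∂(period L)
        ≤ ∫⁻ x, ENNReal.ofReal (2 * η (t, x)) ∂(period L) := by
          refine lintegral_mono_ae ?_
          filter_upwards [hwt] with x hx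
          rw [← ofReal_norm, ENNReal.ofReal_rpow_of_nonneg (norm_nonneg _) (by norm_num)]
          refine ENNReal.ofReal_le_ofReal ?_
          rw [Real.rpow_two, Real.norm_eq_abs, sq_abs]
          exact hx
      _ = ENNReal.ofReal (∫ x in Ioo 0 L, 2 * η (t, x)) :=
          (ofReal_integral_eq_lintegral_ofReal (hi.const_mul 2)
            (Eventually.of_forall fun x => mul_nonneg (by norm_num) (h0 _))).symm
      _ ≤ _ := by
          rw [integral_const_mul]
          exact ENNReal.ofReal_le_ofReal (by linarith)
  rw [← ENNReal.rpow_le_rpow_iff (z := 2) (by norm_num), h3]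
  refine h4.trans ?_
  rw [ENNReal.ofReal_rpow_of_nonneg (Real.sqrt_nonneg _) (by norm_num), Real.rpow_two]
  by_cases hA0 : 0 ≤ A
  · rw [Real.sq_sqrt (by linarith)]
  · rw [ENNReal.ofReal_of_nonpos (by linarith)]; exact bot_le

end

end HyperbolicApprox

end

open MeasureTheory Filter Set

theorem theorem3p1 (T L : ℝ) (hT : 0 < T) (hL : 0 < L)
    (m : ℕ) (hm : Odd m) (σ μ : ℝ) (hσ : σ = -1 ∨ σ = 1) (hμ : 0 ≤ μ)
    (hmμ : m = 1 → μ = 0)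
    (f : ℝ → ℝ) (hf : IsAdmissibleFlux f)
    (u₀ : ℝ → ℝ) (d : ℕ → ℝ → ℝ) (hu₀ : IsSobolevPeriod L m u₀ d)
    (u : ℝ → ℝ → ℝ) (D : ℕ → ℕ → ℝ → ℝ → ℝ) (hu : IsSobolev T L m u D)
    (hsol : IsLimitSolution T L m σ μ f u₀ u) :
    ∃ C > (0 : ℝ), ∃ τ₀ > (0 : ℝ), ∀ τ : ℝ, 0 < τ → τ ≤ τ₀ →
      ∀ q : ℕ → ℝ → ℝ → ℝ, IsEntropySolution T L m σ μ τ f (initialData m σ μ d) q →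
        normLinfL2 T L (fun t x => u t x - q 0 t x)
          + ∑ j ∈ Finset.Icc 1 (m - 2), ENNReal.ofReal (Real.sqrt τ) *
              normLinfL2 T L (fun t x => D 0 j t x - q j t x)
          + ENNReal.ofReal (Real.sqrt τ) *
              normLinfL2 T L (fun t x =>
                σ * D 0 (m - 1) t x - μ * D 0 1 t x - σ * q (m - 1) t x)
        ≤ ENNReal.ofReal (C * τ) := by
  have hm0 := hm.pos
  have hσ2 : σ * σ = 1 := by rcases hσ with rfl | rfl <;> norm_num
  have hV := hsol.isReference hu hu₀ hL hm hσ hmμ hf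
  obtain ⟨K, hK, hE⟩ := hV.absorbed_energy_inequality hL hT hm hμ hf hσ
    (H := fun a p => D 1 a p.1 p.2) (Ht := fun a p => D 2 a p.1 p.2)
    (fun a ha => hu.memLp (by omega)) (fun a ha => hu.memLp (by omega))
    (fun a ha => hu.weakT (by omega)) (fun a ha => hu.weakX (by omega)) (fun j _ _ => rfl)
  set G : ℝ := 2 * L * ((K + 2 * K ^ 2) * T * Real.exp (2 * K * T) + K) with hG
  set B : ℝ := Real.sqrt (2 * G) with hB
  have hB0 : 0 ≤ B := Real.sqrt_nonneg _
  refine ⟨(m + 2) * B + 1, by positivity, 1, one_pos, fun τ hτ hτ1 q hq => ?_⟩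
  have hη := hV.integrable_errEnergy hq
  have hsl := ae_slice_integral_le (c := G * τ ^ 2) hη fun ψ hψ hψ0 ⟨b, hb, hb0⟩ =>
    integral_le_of_weak_gronwall hL hT hK hη (hE τ hτ hτ1 q hq) hψ hψ0 hb hb0
  have hsq : Real.sqrt (2 * (G * τ ^ 2)) = B * τ := by
    rw [← mul_assoc, Real.sqrt_mul' _ (sq_nonneg τ), Real.sqrt_sq hτ.le]
  have bound := fun (w : ℝ → ℝ → ℝ) (s : ℝ) (hs : 0 ≤ s) =>
    ofReal_mul_normLinfL2_le (w := w) (s := s) hη (fun p => energy_nonneg hτ _) hsl hs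
  rw [hsq] at bound
  have hsτ : Real.sqrt τ ^ 2 = τ := Real.sq_sqrt hτ.le
  have hη_j : ∀ j, 1 ≤ j → j < m → ∀ p, τ * (err q (limitState m σ μ D 0 0) j p) ^ 2
      ≤ 2 * errEnergy m τ q (limitState m σ μ D 0 0) p := fun j hj hjm p => by
    have := single_le_energy hτ (fun j => err q (limitState m σ μ D 0 0) j p) hjm
    rw [timeCoeff, if_neg (by omega)] at this
    unfold errEnergy; linarith
  have hη_0 : ∀ p, (err q (limitState m σ μ D 0 0) 0 p) ^ 2
      ≤ 2 * errEnergy m τ q (limitState m σ μ D 0 0) p := fun p => by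
    have := single_le_energy hτ (fun j => err q (limitState m σ μ D 0 0) j p) hm0
    rw [timeCoeff, if_pos rfl] at this
    unfold errEnergy; linarith
  have state_0 : ∀ p, limitState m σ μ D 0 0 0 p = D 0 0 p.1 p.2 := fun p => by
    simp only [limitState, add_zero]
    by_cases h1 : m = 1
    · simp [hmμ h1]
    · rw [if_neg (by omega)]; ring
  have b0 : normLinfL2 T L (fun t x => u t x - q 0 t x) ≤ ENNReal.ofReal (B * τ) := by
    have := bound (fun t x => u t x - q 0 t x) 1 zero_le_one (by
      filter_upwards [hu.ae_eq hL] with p hp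
      refine le_trans (le_of_eq ?_) (hη_0 p)
      rw [err, state_0, hp]; ring)
    simpa using this
  have bj : ∀ j ∈ Finset.Icc 1 (m - 2), ENNReal.ofReal (Real.sqrt τ) *
      normLinfL2 T L (fun t x => D 0 j t x - q j t x) ≤ ENNReal.ofReal (B * τ) := by
    intro j hj
    rw [Finset.mem_Icc] at hj
    refine bound _ _ (Real.sqrt_nonneg _) (Eventually.of_forall fun p => ?_)
    refine le_trans (le_of_eq ?_) (hη_j j hj.1 (by omega) p)
    rw [mul_pow, hsτ, err, limitState, if_neg (by omega), add_zero]; ring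
  have bl : ENNReal.ofReal (Real.sqrt τ) * normLinfL2 T L (fun t x =>
      σ * D 0 (m - 1) t x - μ * D 0 1 t x - σ * q (m - 1) t x) ≤ ENNReal.ofReal (B * τ) := by
    refine bound _ _ (Real.sqrt_nonneg _) (Eventually.of_forall fun p => ?_)
    have e : (Real.sqrt τ * (σ * D 0 (m - 1) p.1 p.2 - μ * D 0 1 p.1 p.2
        - σ * q (m - 1) p.1 p.2)) ^ 2
        = τ * (err q (limitState m σ μ D 0 0) (m - 1) p) ^ 2 := by
      have : σ * D 0 (m - 1) p.1 p.2 - μ * D 0 1 p.1 p.2 - σ * q (m - 1) p.1 p.2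
          = -σ * err q (limitState m σ μ D 0 0) (m - 1) p := by
        simp only [err, limitState, if_true, add_zero]
        linear_combination μ * D 0 1 p.1 p.2 * hσ2
      rw [this, mul_pow, hsτ, mul_pow]
      linear_combination τ * (err q (limitState m σ μ D 0 0) (m - 1) p) ^ 2 * hσ2
    refine e.trans_le ?_
    by_cases h1 : m = 1
    · subst h1
      exact le_trans (mul_le_of_le_one_left (sq_nonneg _) hτ1) (hη_0 p)
    · exact hη_j (m - 1) (by omega) (by omega) p
  calc _ ≤ ENNReal.ofReal (B * τ) + ∑ _j ∈ Finset.Icc 1 (m - 2), ENNReal.ofReal (B * τ)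
        + ENNReal.ofReal (B * τ) := add_le_add (add_le_add b0 (Finset.sum_le_sum bj)) bl
    _ = ENNReal.ofReal (B * τ + ∑ _j ∈ Finset.Icc 1 (m - 2), B * τ + B * τ) := by
        have hBτ : 0 ≤ B * τ := by positivity
        rw [ENNReal.ofReal_add (by positivity) hBτ, ENNReal.ofReal_add hBτ (by positivity),
          ENNReal.ofReal_sum_of_nonneg fun _ _ => hBτ]
    _ ≤ _ := by
        refine ENNReal.ofReal_le_ofReal ?_
        have hc : ((m - 2 : ℕ) : ℝ) ≤ m := by exact_mod_cast Nat.sub_le m 2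
        have hBτ : 0 ≤ B * τ := by positivity
        simp only [Finset.sum_const, Nat.card_Icc, nsmul_eq_mul, Nat.add_sub_cancel]
        nlinarith
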